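/- Let $Y$ be a locally finite tree which is uniform, i.e. $\mathrm{Aut}(Y)\backslash Y$ is a finite graph, and let $\Gamma$ be a group acting on $Y$ without inversions as a tree lattice: all edge stabilizers $\Gamma_e$ are finite and $\sum_{e \bmod \Gamma} 1/|\Gamma_e|<\infty$. A boundary point $c\in\partial Y$ with stabilizer $P_c\subset\mathrm{Aut}(Y)$, and with $N_c\subset P_c$ the subgroup stabilizing the horocycles of $c$, is a cusp of $\Gamma$ if $\Gamma\cap P_c=\Gamma\cap N_c$ and $\Gamma\cap N_c$ acts transitively on some horocycle of $c$; it is periodic if the valencies along a ray in $c$ are eventually periodic. Suppose $\Gamma$ is cuspidal: $X=\Gamma\backslash Y$ is the union of a finite graph and the images of finitely many rays belonging to periodic cusps. For an oriented edge $e$ of $X$ with lift $\tilde e$ to $Y$ let $w(e)=|\Gamma_{o(\tilde e)}\tilde e|$; for consecutive edges ($t(e)=o(e')$) let $w(e,e')=w(e')$ if $e'\neq e^{-1}$ and $w(e,e')=w(e')-1$ if $e'=e^{-1}$; for a closed path $p=(e_1,\dots,e_n)$ let $w(p)=\prod_{j \bmod n}w(e_j,e_{j+1})$. This depends only on the cycle,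 i.e. the class of $p$ under cyclic shifts. Let $Z(u)=\prod_c(1-w(c)u^{l(c)})^{-1}$, the product running over all prime cycles $c$ of $X$ (cycles that are not a power of a shorter one), $l(c)$ denoting the length. Let $T$ be the operator $Te=\sum_{o(e')=t(e)}w(e,e')e'$ on formal sums of oriented edges of $X$. For an operator $A:\bigoplus_{i\in I}\mathbb{C} i\to\prod_{i\in I}\mathbb{C} i$ with matrix coefficients $\langle Ai,j\rangle$ let $\det(A)=\lim_F\det(A_F)$ be the limit of the net of principal minors over the finite subsets $F\subset I$. $A$ is of determinant class if this limit exists and is non-zero, and satisfies the strong determinant class conditions if $\sum_i|\log\langle Ai,i\rangle|<\infty$ (in particular all $\langle Ai,i\rangle\ne0$) and $\sum_\sigma\left|\prod_i\langle Ai,\sigma i\rangle\right|<\infty$, where $\sigma$ runs over all permutations of $I$ that are the identity outside a finite set. Theorem. There is $\alpha>0$ such that for all $u\in\mathbb{C}$ with $|u|<\alpha$ the operator $1-uT$ satisfies the strong determinant class conditions and is of determinant class, the product $Z(u)$ converges, none of its factors $1-w(c)u^{l(c)}$ vanishes, and $$Z(u)^{-1}=\det(1-uT).$$ This is a rational function of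 $u$: there are polynomials $P,Q\in\mathbb{C}[u]$, with $Q$ without zeros in $|u|<\alpha$, such that $\det(1-uT)=P(u)/Q(u)$ for $|u|<\alpha$. Moreover, the cusps contribute explicit factors. Let $r_1,\dots,r_m$ be rays representing periodic cusps such that $X$ is the union of a finite graph and the images of the $r_i$. Suppose that from its $N_i$-th vertex on the valencies along $r_i$ are periodic with period $k_i\geq 1$, let $q_{i,j}+1$ be the valency of the $(N_i+j)$-th vertex of $r_i$, and put $$D_i(u)=\frac{\sum_{j=0}^{k_i-1}q_{i,0}\cdots q_{i,j-1}\,(1-q_{i,j})\,u^{2j+1}}{1-q_{i,0}\cdots q_{i,k_i-1}\,u^{2k_i}},$$ so that $D_i(u)=\frac{(1-q)u}{1-qu^2}$ if the period is one and the valency is $q+1$. Then there are polynomials $p_S\in\mathbb{C}[u]$, $S\subseteq\{1,\dots,m\}$, such that for $|u|$ small the denominators of the $D_i(u)$ do not vanish and $$\det(1-uT)=\sum_{S\subseteq\{1,\dots,m\}}p_S(u)\prod_{i\in S}D_i(u).$$ -/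

import Mathlib

open Filter Topology

noncomputable section

namespace TreeLattice

/-! ### Determinant class operators -/

section Determinant

variable {I : Type*}

/-- The matrix coefficient `⟨A i, j⟩` of an operator `A : S(I) → P(I)` from finite formal sums
to arbitrary formal sums. -/
def coeff (A : (I →₀ ℂ) →ₗ[ℂ] (I → ℂ)) (i j : I) : ℂ :=
  A (Finsupp.single i 1) j

open Classical in
/-- The principal minor `det A_F`, where `A_F : S(F) → P(F)` is the compression of `A` to the
finite set `F`. -/
def minor (A : (I →₀ ℂ) →ₗ[ℂ] (I → ℂ)) (F : Finset I) : ℂ :=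
  Matrix.det (Matrix.of fun j i : F => coeff A i j)

/-- `d` is the limit of the net of all finite principal minors of `A`. -/
def HasDet (A : (I →₀ ℂ) →ₗ[ℂ] (I → ℂ)) (d : ℂ) : Prop :=
  Tendsto (minor A) atTop (𝓝 d)

/-- `A` is of determinant class: the net of principal minors converges to a non-zero limit. -/
def IsDetClass (A : (I →₀ ℂ) →ₗ[ℂ] (I → ℂ)) : Prop :=
  ∃ d : ℂ, d ≠ 0 ∧ HasDet A d

/-- The determinant, i.e. the limit of the net of principal minors (meaningful if it exists). -/
def opDet (A : (I →₀ ℂ) →ₗ[ℂ] (I → ℂ)) : ℂ :=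
  limUnder atTop (minor A)

/-- Finite permutations of `I`: those which are the identity outside a finite set. -/
def FinitePerm (I : Type*) : Type _ :=
  {σ : Equiv.Perm I // {i | σ i ≠ i}.Finite}

/-- `A` is of strong determinant class: `∑ᵢ |log ⟨A i, i⟩| < ∞` (in particular no diagonal
coefficient vanishes) and `∑_σ |∏ᵢ ⟨A i, σ i⟩| < ∞`, the sum running over all finite
permutations. -/
def IsStrongDetClass (A : (I →₀ ℂ) →ₗ[ℂ] (I → ℂ)) : Prop :=
  (∀ i, coeff A i i ≠ 0) ∧
  Summable (fun i => ‖Complex.log (coeff A i i)‖) ∧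
  Summable (fun σ : FinitePerm I => ‖∏' i, coeff A i (σ.1 i)‖)

end Determinant

/-! ### Trees and group actions on them -/

section Tree

variable {V : Type*} {Y : SimpleGraph V}

/-- The action of the automorphism group on oriented edges. -/
instance dartAction : MulAction (Y ≃g Y) Y.Dart where
  smul g e := g.toHom.mapDart e
  one_smul _ := rfl
  mul_smul _ _ _ := rfl

lemma smul_fst (g : Y ≃g Y) (e : Y.Dart) : (g • e).fst = g • e.fst := rfl

lemma smul_snd (g : Y ≃g Y) (e : Y.Dart) : (g • e).snd = g • e.snd := rfl

lemma smul_symm (g : Y ≃g Y) (e : Y.Dart) : (g • e).symm = g • e.symm := rfl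

/-- The quotient graph of `Y` by its full automorphism group is finite. -/
def IsUniform (Y : SimpleGraph V) : Prop :=
  Finite (MulAction.orbitRel.Quotient (Y ≃g Y) V) ∧
  Finite (MulAction.orbitRel.Quotient (Y ≃g Y) Y.Dart)

/-- The valency of a vertex. -/
def val (Y : SimpleGraph V) (x : V) : ℕ := (Y.neighborSet x).ncard

/-- A ray, i.e. an infinite reduced path, given by the sequence of its vertices. -/
structure Ray (Y : SimpleGraph V) where
  vert : ℕ → V
  adj : ∀ n, Y.Adj (vert n) (vert (n + 1))
  reduced : ∀ n, vert n ≠ vert (n + 2)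

/-- The `n`-th oriented edge of a ray. -/
def Ray.edge (r : Ray Y) (n : ℕ) : Y.Dart := ⟨(r.vert n, r.vert (n + 1)), r.adj n⟩

/-- Two rays are equivalent if they join at some point. -/
def rayEquiv (r s : Ray Y) : Prop :=
  ∃ a b : ℕ, ∀ n, r.vert (a + n) = s.vert (b + n)

instance raySetoid (Y : SimpleGraph V) : Setoid (Ray Y) where
  r := rayEquiv
  iseqv :=
    { refl := fun _ => ⟨0, 0, fun _ => rfl⟩
      symm := fun ⟨a, b, h⟩ => ⟨b, a, fun n => (h n).symm⟩
      trans := by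
        rintro r s t ⟨a, b, h⟩ ⟨c, d, k⟩
        refine ⟨a + c, d + b, fun n => ?_⟩
        have h1 := h (c + n)
        have h2 := k (b + n)
        rw [show a + c + n = a + (c + n) by ring, h1, show b + (c + n) = c + (b + n) by ring, h2,
          show d + b + n = d + (b + n) by ring] }

/-- The boundary of the tree: the set of ends, i.e. of equivalence classes of rays. -/
def Boundary (Y : SimpleGraph V) : Type _ := Quotient (raySetoid Y)

/-- The end to which a ray belongs. -/
def Ray.toEnd (r : Ray Y) : Boundary Y := Quotient.mk (raySetoid Y) r

/-- The image of a ray under an automorphism. -/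
def Ray.map (g : Y ≃g Y) (r : Ray Y) : Ray Y where
  vert n := g (r.vert n)
  adj n := g.map_rel_iff.mpr (r.adj n)
  reduced n h := r.reduced n (g.injective h)

/-- The action of an automorphism on the boundary. -/
def Boundary.map (g : Y ≃g Y) : Boundary Y → Boundary Y :=
  Quotient.map (Ray.map g) fun _ _ ⟨a, b, h⟩ => ⟨a, b, fun n => congrArg g (h n)⟩

/-- `x` and `y` lie in the same horocycle with respect to `c`. -/
def SameHorocycle (c : Boundary Y) (x y : V) : Prop :=
  ∃ r s : Ray Y, r.toEnd = c ∧ s.toEnd = c ∧ r.vert 0 = x ∧ s.vert 0 = y ∧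
    ∃ n, r.vert n = s.vert n

/-- The horocycle of `x` with respect to `c`. -/
def horocycle (c : Boundary Y) (x : V) : Set V := {y | SameHorocycle c x y}

/-- The stabilizer `P_c` of a boundary point in the automorphism group. -/
def stabP (c : Boundary Y) : Set (Y ≃g Y) := {g | Boundary.map g c = c}

/-- The set `N_c` of all elements of `P_c` which stabilize a horocycle with respect to `c`. -/
def stabN (c : Boundary Y) : Set (Y ≃g Y) :=
  {g | g ∈ stabP c ∧ ∃ x : V, g '' horocycle c x = horocycle c x}

end Tree

section Lattice

variable {V : Type*} {Y : SimpleGraph V} {Γ : Type*} [Group Γ]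

/-- The vertices of the quotient graph `X = Γ \ Y`. -/
abbrev VX (ρ : Γ →* (Y ≃g Y)) : Type _ := MulAction.orbitRel.Quotient ρ.range V

/-- The oriented edges of the quotient graph `X = Γ \ Y`: the `Γ`-orbits of oriented edges
of `Y`. -/
abbrev OE (ρ : Γ →* (Y ≃g Y)) : Type _ := MulAction.orbitRel.Quotient ρ.range Y.Dart

variable (ρ : Γ →* (Y ≃g Y))

/-- The image in `X` of a vertex of `Y`. -/
def projV (x : V) : VX ρ := Quotient.mk _ x

/-- The image in `X` of an oriented edge of `Y`. -/
def projE (e : Y.Dart) : OE ρ := Quotient.mk _ e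

variable {ρ}

lemma orbit_iff {α : Type*} [MulAction (Y ≃g Y) α] {a b : α} :
    (MulAction.orbitRel ρ.range α) a b ↔ ∃ g : Γ, ρ g • b = a := by
  rw [MulAction.orbitRel_apply, MulAction.mem_orbit_iff]
  constructor
  · rintro ⟨⟨_, g, rfl⟩, h⟩
    exact ⟨g, h⟩
  · rintro ⟨g, h⟩
    exact ⟨⟨ρ g, g, rfl⟩, h⟩

/-- Origin of an oriented edge of `X`. -/
def origin : OE ρ → VX ρ :=
  Quotient.map' (fun e : Y.Dart => e.fst) fun a b h => by
    obtain ⟨g, rfl⟩ := orbit_iff.mp h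
    exact orbit_iff.mpr ⟨g, rfl⟩

/-- Terminus of an oriented edge of `X`. -/
def terminus : OE ρ → VX ρ :=
  Quotient.map' (fun e : Y.Dart => e.snd) fun a b h => by
    obtain ⟨g, rfl⟩ := orbit_iff.mp h
    exact orbit_iff.mpr ⟨g, rfl⟩

/-- The reverse of an oriented edge of `X`. -/
def rev : OE ρ → OE ρ :=
  Quotient.map' SimpleGraph.Dart.symm fun a b h => by
    obtain ⟨g, rfl⟩ := orbit_iff.mp h
    exact orbit_iff.mpr ⟨g, rfl⟩

variable (ρ)

/-- The order `|Γ_e|` of the stabilizer in `Γ` of an oriented edge `e` of `Y`. -/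
def stabCard (e : Y.Dart) : ℕ := Nat.card {g : Γ // ρ g • e = e}

/-- The orbit `Γ_{o(e)} e` of an oriented edge `e` of `Y` under the stabilizer of its origin. -/
def originOrbit (e : Y.Dart) : Set Y.Dart :=
  {e' | ∃ g : Γ, ρ g • e.fst = e.fst ∧ ρ g • e = e'}

lemma stabCard_smul (h : Γ) (e : Y.Dart) : stabCard ρ (ρ h • e) = stabCard ρ e := by
  refine Nat.card_congr ⟨fun g => ⟨h⁻¹ * g.1 * h, ?_⟩, fun g => ⟨h * g.1 * h⁻¹, ?_⟩, ?_, ?_⟩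
  · rw [map_mul, map_mul, mul_smul, mul_smul, g.2, map_inv, inv_smul_smul]
  · rw [map_mul, map_mul, mul_smul, mul_smul, map_inv, inv_smul_smul, g.2]
  · intro g; ext; simp [mul_assoc]
  · intro g; ext; simp [mul_assoc]

lemma ncard_originOrbit_smul (h : Γ) (e : Y.Dart) :
    (originOrbit ρ (ρ h • e)).ncard = (originOrbit ρ e).ncard := by
  have : originOrbit ρ (ρ h • e) = (fun e' => ρ h • e') '' originOrbit ρ e := by
    ext f
    constructor
    · rintro ⟨g, h1, rfl⟩
      refine ⟨ρ (h⁻¹ * g * h) • e, ⟨h⁻¹ * g * h, ?_, rfl⟩, ?_⟩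
      · rw [smul_fst] at h1
        rw [map_mul, map_mul, mul_smul, mul_smul, h1, map_inv, inv_smul_smul]
      · simp only [map_mul, map_inv, mul_smul, smul_inv_smul]
    · rintro ⟨_, ⟨g, h1, rfl⟩, rfl⟩
      refine ⟨h * g * h⁻¹, ?_, ?_⟩
      · rw [smul_fst, map_mul, map_mul, mul_smul, mul_smul, map_inv, inv_smul_smul, h1]
      · simp only [map_mul, map_inv, mul_smul, inv_smul_smul]
  rw [this, Set.ncard_image_of_injective _ (MulAction.injective (ρ h))]

variable {ρ}

/-- `|Γ_e|` for an oriented edge of `X`. -/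
def stabCardX : OE ρ → ℕ :=
  Quotient.lift (stabCard ρ) fun a b h => by
    obtain ⟨g, rfl⟩ := orbit_iff.mp h
    exact stabCard_smul ρ g b

/-- `w(e) = |Γ_{o(e)} e|` for an oriented edge of `X`. -/
def wt : OE ρ → ℕ :=
  Quotient.lift (fun e => (originOrbit ρ e).ncard) fun a b h => by
    obtain ⟨g, rfl⟩ := orbit_iff.mp h
    exact ncard_originOrbit_smul ρ g b

open Classical in
/-- The weight `w(e, e')` of two consecutive oriented edges of `X`. -/
def wt₂ (e e' : OE ρ) : ℂ :=
  if e' = rev e then (wt e' : ℂ) - 1 else (wt e' : ℂ)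

/-! ### Cuspidal tree lattices -/

variable (ρ)

/-- `Γ` is a tree lattice: edge stabilizers are finite and `∑ 1 / |Γ_e| < ∞`, the sum running
over the edges modulo `Γ`. -/
def IsTreeLattice : Prop :=
  (∀ e : Y.Dart, Finite {g : Γ // ρ g • e = e}) ∧
  Summable (fun e : OE ρ => (1 : ℝ) / stabCardX e)

/-- `Γ` preserves orientations, i.e. acts without inversions of edges. -/
def ActsWithoutInversion : Prop :=
  ∀ (g : Γ) (e : Y.Dart), ρ g • e ≠ e.symm

/-- `c` is a cusp of `Γ`: `Γ ∩ P_c = Γ ∩ N_c`, and there is a horocycle with respect to `c` on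
which `Γ ∩ N_c` acts transitively. -/
def IsCusp (c : Boundary Y) : Prop :=
  (∀ g : Γ, ρ g ∈ stabP c ↔ ρ g ∈ stabN c) ∧
  ∃ x₀ : V, ∀ x ∈ horocycle c x₀, ∀ y ∈ horocycle c x₀, ∃ g : Γ, ρ g ∈ stabN c ∧ ρ g x = y

/-- From the `N`-th vertex on, the valencies along the ray `r` are periodic with period `k`. -/
def PeriodicFrom (r : Ray Y) (N k : ℕ) : Prop :=
  0 < k ∧ ∀ n, N ≤ n → val Y (r.vert n) = val Y (r.vert (n + k))

/-- The rays `r₁, …, r_m` represent periodic cusps of `Γ`, and `X` is the union of a finite graph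
and the images of these rays. -/
def IsCuspDecomposition {m : ℕ} (r : Fin m → Ray Y) : Prop :=
  (∀ i, IsCusp ρ (r i).toEnd ∧ ∃ N k, PeriodicFrom (r i) N k) ∧
  {x : VX ρ | ∀ i n, x ≠ projV ρ ((r i).vert n)}.Finite ∧
  {e : OE ρ | ∀ i n, e ≠ projE ρ ((r i).edge n) ∧ e ≠ projE ρ ((r i).edge n).symm}.Finite

/-- `Γ` is cuspidal: `X` is the union of a finite graph and finitely many periodic cusp
sections. -/
def IsCuspidal : Prop :=
  ∃ (m : ℕ) (r : Fin m → Ray Y), IsCuspDecomposition ρ r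

/-! ### The zeta function and the edge operator -/

variable {ρ}

/-- A cyclic sequence of oriented edges is a cycle of `X` if it is non-empty and each edge ends
where its cyclic successor starts. (Mathlib's `Cycle` is the type of lists up to rotation.) -/
def IsCycle (c : Cycle (OE ρ)) : Prop :=
  c ≠ Cycle.nil ∧ c.Chain fun e e' => terminus e = origin e'

/-- A prime cycle is a cycle which is not a power of a shorter one. -/
def IsPrimeCycle (c : Cycle (OE ρ)) : Prop :=
  IsCycle c ∧ ∀ (l : List (OE ρ)) (n : ℕ), c = ((List.replicate n l).flatten : List _) → n = 1

/-- `w(p) = ∏_{j mod n} w(e_j, e_{j+1})` for a closed path `p = (e_1, …, e_n)`. -/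
def wtList (l : List (OE ρ)) : ℂ := (List.zipWith wt₂ l (l.rotate 1)).prod

lemma wtList_rotate (l : List (OE ρ)) (n : ℕ) : wtList (l.rotate n) = wtList l := by
  unfold wtList
  rw [List.rotate_rotate, Nat.add_comm, ← List.rotate_rotate,
    ← List.zipWith_rotate_distrib _ _ _ _ (by simp)]
  exact (List.rotate_perm _ _).prod_eq

/-- The weight `w(c)` of a cycle. -/
def wtCycle (c : Cycle (OE ρ)) : ℂ :=
  Quotient.lift wtList (fun a b h => by
    obtain ⟨n, rfl⟩ := h
    exact (wtList_rotate a n).symm) c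

variable (ρ)

/-- The Euler factor `(1 - w(c) u^{l(c)})⁻¹`. -/
def eulerFactor (u : ℂ) (c : {c : Cycle (OE ρ) // IsPrimeCycle c}) : ℂ :=
  (1 - wtCycle c.1 * u ^ c.1.length)⁻¹

/-- The Bass–Ihara zeta function, the product of the Euler factors over all prime cycles. -/
def zeta (u : ℂ) : ℂ := ∏' c, eulerFactor ρ u c

open Classical in
/-- The edge operator `T e = ∑_{e' : o(e') = t(e)} w(e, e') e'` on the oriented edges of `X`,
as an operator from finite to arbitrary formal sums. -/
def edgeOp : (OE ρ →₀ ℂ) →ₗ[ℂ] (OE ρ → ℂ) :=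
  Finsupp.linearCombination ℂ fun e e' : OE ρ =>
    if origin e' = terminus e then wt₂ e e' else 0

/-- The operator `1 - u T`, where `1` is the inclusion of finite into arbitrary formal sums. -/
def oneSub (u : ℂ) : (OE ρ →₀ ℂ) →ₗ[ℂ] (OE ρ → ℂ) :=
  Finsupp.lcoeFun - u • edgeOp ρ

/-- The denominator `1 - q_0 ⋯ q_{k-1} u^{2k}` of the factor of a cusp, where `q_j` is the valency
of the `(N + j)`-th vertex of the ray minus one. -/
def cuspDenom (r : Ray Y) (N k : ℕ) (u : ℂ) : ℂ :=
  1 - (∏ l ∈ Finset.range k, ((val Y (r.vert (N + l)) : ℂ) - 1)) * u ^ (2 * k)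

/-- The factor of a cusp of period `k`,
`∑_{j < k} q_0 ⋯ q_{j-1} (1 - q_j) u^{2j+1} / (1 - q_0 ⋯ q_{k-1} u^{2k})`.
For period one it is `(1 - q) u / (1 - q u²)`. -/
def cuspFactor (r : Ray Y) (N k : ℕ) (u : ℂ) : ℂ :=
  (∑ j ∈ Finset.range k, (∏ l ∈ Finset.range j, ((val Y (r.vert (N + l)) : ℂ) - 1)) *
    (1 - ((val Y (r.vert (N + j)) : ℂ) - 1)) * u ^ (2 * j + 1)) / cuspDenom r N k u

end Lattice

end TreeLattice

end

/-!
For small `u` the matrix `u T` has row sums less than one, as the valencies are bounded. The crucial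
point is that moreover only few closed paths have non-zero weight: the edges of `X` outside a finite
set `F` form the cusps, and a path which enters a cusp has to ascend, to turn once, and to descend
until it leaves the cusp again. Hence all closed paths meet `F`, and outside `F` the matrix is
triangular with respect to a suitable rank function (`HasFewCycles`).

This property alone yields the determinant formula. The total weight of the closed paths of length
`n` is at most `n |F| r ^ n`, where `r < 1` bounds the row sums (`tsum_cycWt_le`): a closed path can
be rotated until it starts in `F`. A finite minor of `1 - u T` is the exponential of minus the sum
of the weights, divided by the lengths, of the closed paths inside the finite set
(`det_one_sub_eq_exp`), so by dominated convergence the minors converge to the exponential of minus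
the sum over all closed paths (`HasFewCycles.tendsto_det`), which is not zero. As each closed path
is a power of a unique primitive one, which has as many rotations as its length, this limit is the
inverse of the Euler product (`HasFewCycles.hasProd_euler`). The sum over all finite permutations of
the absolute values of the products of coefficients is bounded by `2 ^ |F|`: indices outside `F` are
eliminated one after the other, and this does not increase the row sums (`sum_perm_one_add_le`).

The contributions of the cusps are found by eliminating their edges from the finite minors
(`CuspMatrix.det_level`). This changes the matrix on `F` by a sum of matrices of rank one, one for
each cusp, with the weight of the paths through the cusp as coefficient. By periodicity this weight
is, up to sign, the rational function `cuspFactor` (`hasSum_cuspFactor`), and a determinant is a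
multiaffine function of the coefficients of perturbations of rank one
(`exists_polynomial_det_perturbation`).

It remains to see that a cusp of a tree lattice has the shape described above. The end `c`
determines a parent map and a height on the vertices of the tree, and `Γ ∩ N_c` preserves both. As
stabilizers are finite, only finitely many vertices of a ray in `c` lie in any one orbit
(`finite_fiber_of_isCusp`). As `Γ ∩ N_c` is transitive on a horocycle, it is transitive on those
children of a vertex which have descendants on that horocycle. Far out these are all children, since
below any other child there is a leaf of the tree, at a bounded distance as the tree is uniform, and
the leaves lie in finitely many orbits (`exists_transitiveFrom`). Therefore an element of `Γ` which
maps a vertex far out in one of the rays to a vertex far out in one of the rays cannot turn the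
first ray back: otherwise the image of that ray in `X` would run down the cusp, and a vertex far out
would lie in the orbit of one of the first vertices of a ray. So the element maps the rest of the
first ray to the rest of the second one (`exists_cusp_index`). In `X` each vertex far out is thus
the origin of exactly two edges, the ascending one of weight `1` and the descending one of weight
`q`, where `q + 1` is the valency (`exists_cuspMatrix`).
-/

namespace TreeLattice

/-! ### Sums over permutations of products of matrix coefficients -/

/-- The terms of degree at most one in the `y i` of the expansion of `∏ (x i + y i)`. -/
lemma prod_add_sum_le_prod_add {K : Type*} [DecidableEq K] (s : Finset K) (x y : K → ℝ)
    (hx : ∀ i, 0 ≤ x i) (hy : ∀ i, 0 ≤ y i) :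
    ∏ i ∈ s, x i + ∑ a ∈ s, y a * ∏ i ∈ s.erase a, x i ≤ ∏ i ∈ s, (x i + y i) := by
  induction s using Finset.induction_on with
  | empty => simp
  | insert k s hk ih =>
    have e : ∀ a ∈ s, y a * ∏ i ∈ (insert k s).erase a, x i
        = x k * (y a * ∏ i ∈ s.erase a, x i) := by
      intro a ha
      have hak : a ≠ k := fun h => hk (h ▸ ha)
      rw [Finset.erase_insert_of_ne (Ne.symm hak), Finset.prod_insert (by simp [hk])]
      ring
    rw [Finset.prod_insert hk, Finset.prod_insert hk, Finset.sum_insert hk, Finset.erase_insert hk,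
      Finset.sum_congr rfl e, ← Finset.mul_sum]
    have h1 : ∏ i ∈ s, x i ≤ ∏ i ∈ s, (x i + y i) :=
      Finset.prod_le_prod (fun i _ => hx i) fun i _ => by linarith [hy i]
    nlinarith [mul_le_mul_of_nonneg_left ih (hx k), mul_le_mul_of_nonneg_left h1 (hy k)]

/-- Elimination of one index in a sum over permutations: the analogue for permanents of
non-negative matrices of the Schur complement formula for determinants. -/
lemma sum_perm_option_le {K : Type*} [Fintype K] [DecidableEq K]
    (M : Option K → Option K → ℝ) (hM : ∀ i j, 0 ≤ M i j) (h1 : M none none = 1) :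
    ∑ σ : Equiv.Perm (Option K), ∏ i, M i (σ i) ≤
      ∑ τ : Equiv.Perm K,
        ∏ i, (M (some i) (some (τ i)) + M (some i) none * M none (some (τ i))) := by
  rw [← Equiv.sum_comp (Equiv.Perm.decomposeOption (α := K)).symm, Fintype.sum_prod_type_right]
  -- A permutation of `Option K` is a permutation `τ` of `K`, possibly with `none` inserted after
  -- one of the elements of `K`.
  refine Finset.sum_le_sum fun τ _ => ?_
  refine le_trans (le_of_eq ?_) (prod_add_sum_le_prod_add Finset.univ
    (fun i => M (some i) (some (τ i))) (fun i => M (some i) none * M none (some (τ i)))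
    (fun _ => hM _ _) fun _ => mul_nonneg (hM _ _) (hM _ _))
  rw [Fintype.sum_option]
  congr 1
  · simp [Fintype.prod_option, h1]
  · rw [← Equiv.sum_comp τ]
    refine Finset.sum_congr rfl fun a _ => ?_
    rw [Fintype.prod_option, ← Finset.mul_prod_erase Finset.univ _ (Finset.mem_univ a)]
    have : ∀ i ∈ Finset.univ.erase a, M (some i)
        ((Equiv.Perm.decomposeOption (α := K)).symm (some (τ a), τ) (some i))
        = M (some i) (some (τ i)) := by
      intro i hi
      have : τ i ≠ τ a := fun h => (Finset.ne_of_mem_erase hi) (τ.injective h)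
      simp [Equiv.swap_apply_of_ne_of_ne, this]
    rw [Finset.prod_congr rfl this]
    simp
    ring

lemma sum_perm_le_prod_sum {K : Type*} [Fintype K] [DecidableEq K]
    (M : K → K → ℝ) (hM : ∀ i j, 0 ≤ M i j) :
    ∑ σ : Equiv.Perm K, ∏ i, M i (σ i) ≤ ∏ i, ∑ j, M i j := by
  rw [Finset.prod_univ_sum]
  have := Finset.sum_map (Finset.univ : Finset (Equiv.Perm K))
    ⟨fun σ : Equiv.Perm K => (σ : K → K), DFunLike.coe_injective⟩
    (fun p : K → K => ∏ i, M i (p i))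
  rw [Function.Embedding.coeFn_mk] at this
  rw [← this]
  exact Finset.sum_le_sum_of_subset_of_nonneg (fun p _ => by simp)
    fun p _ _ => Finset.prod_nonneg fun i _ => hM _ _

/-- If the row sums of `A ≥ 0` are at most `1` and all closed paths of `A` meet the set `F`,
then the sum over permutations of the products of the coefficients of `1 + A` is at most `2 ^ |F|`,
whatever the size of the index set: all indices outside `F` are eliminated. -/
theorem sum_perm_one_add_le {K : Type*} [Fintype K] [DecidableEq K] (A : K → K → ℝ)
    (hA : ∀ i j, 0 ≤ A i j) (hrow : ∀ i, ∑ j, A i j ≤ 1) (F : Finset K) (h : K → ℚ)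
    (hacyc : ∀ i j, i ∉ F → j ∉ F → A i j ≠ 0 → h i < h j) :
    ∑ σ : Equiv.Perm K, ∏ i, ((if i = σ i then 1 else 0) + A i (σ i)) ≤ 2 ^ F.card := by
  induction hn : (Finset.univ \ F).card generalizing K with
  | zero =>
    have hF : F = Finset.univ := by
      rw [Finset.card_eq_zero, Finset.sdiff_eq_empty_iff_subset] at hn
      exact Finset.univ_subset_iff.mp hn
    refine (sum_perm_le_prod_sum (fun i j => (if i = j then 1 else 0) + A i j)
      fun i j => ?_).trans ?_
    · split_ifs <;> linarith [hA i j]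
    · rw [hF, ← Finset.prod_const]
      refine Finset.prod_le_prod (fun i _ => Finset.sum_nonneg fun j _ => ?_) fun i _ => ?_
      · split_ifs <;> linarith [hA i j]
      · simp only [Finset.sum_add_distrib]
        simp
        linarith [hrow i]
  | succ n ih =>
    obtain ⟨k, hk⟩ : (Finset.univ \ F).Nonempty := by
      rw [← Finset.card_pos]; omega
    have hkF : k ∉ F := (Finset.mem_sdiff.mp hk).2
    have hAkk : A k k = 0 := by
      by_contra hne
      exact lt_irrefl _ (hacyc k k hkF hkF hne)
    let e : Option {x // x ≠ k} ≃ K := Equiv.optionSubtypeNe k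
    have he : ∀ x : {x // x ≠ k}, e (some x) = x := fun x => by simp [e]
    have he0 : e none = k := by simp [e]
    -- The matrix left after the elimination of `k`, whose weights are those of paths through `k`.
    let A' : {x // x ≠ k} → {x // x ≠ k} → ℝ := fun i j => A i j + A i k * A k j
    let F' : Finset {x // x ≠ k} := F.subtype (· ≠ k)
    have hcard : F'.card = F.card := by
      rw [Finset.card_subtype, Finset.filter_true_of_mem]
      rintro x hx rfl
      exact hkF hx
    have key := ih A' (fun i j => add_nonneg (hA _ _) (mul_nonneg (hA _ _) (hA _ _))) ?_ F'
      (fun x => h x) ?_ ?_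
    · rw [hcard] at key
      refine le_trans ?_ key
      have := sum_perm_option_le
        (fun i j => (if e i = e j then 1 else 0) + A (e i) (e j)) ?_ ?_
      · refine le_trans (le_of_eq ?_) (this.trans (le_of_eq ?_))
        · rw [← Equiv.sum_comp e.permCongr]
          refine Finset.sum_congr rfl fun σ _ => ?_
          rw [← Equiv.prod_comp e]
          simp [Equiv.permCongr_apply]
        · refine Finset.sum_congr rfl fun σ _ => Finset.prod_congr rfl fun i _ => ?_
          simp only [he, he0, A']
          rw [if_neg i.2, if_neg (Ne.symm (σ i).2)]
          simp only [Subtype.ext_iff]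
          ring
      · intro i j
        split_ifs <;> linarith [hA (e i) (e j)]
      · simp [he0, hAkk]
    · intro i
      have hsum : ∀ f : K → ℝ, ∑ j, f j = f k + ∑ j : {x // x ≠ k}, f j := by
        intro f
        rw [← Equiv.sum_comp e, Fintype.sum_option, he0]
        simp only [he]
      have h1 := hrow i
      have h2 := hrow k
      rw [hsum] at h1 h2
      rw [hAkk] at h2
      simp only [A', Finset.sum_add_distrib, ← Finset.mul_sum]
      nlinarith [hA i k]
    · intro i j hi hj hne
      have hi' : (i : K) ∉ F := fun h => hi (by simpa [F'] using h)
      have hj' : (j : K) ∉ F := fun h => hj (by simpa [F'] using h)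
      by_cases h0 : A i j = 0
      · have h1 : A i k * A k j ≠ 0 := fun h => hne (by simp [A', h0, h])
        exact (hacyc _ _ hi' hkF (left_ne_zero_of_mul h1)).trans
          (hacyc _ _ hkF hj' (right_ne_zero_of_mul h1))
      · exact hacyc _ _ hi' hj' h0
    · have h1 := Finset.card_sdiff_add_card_eq_card (Finset.subset_univ F)
      have h2 := Finset.card_sdiff_add_card_eq_card (Finset.subset_univ F')
      have h3 : Fintype.card K = Fintype.card {x // x ≠ k} + 1 := by
        rw [← Fintype.card_congr e, Fintype.card_option]
      simp only [Finset.card_univ] at h1 h2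
      omega

/-! ### Powers of words and primitive cycles -/

section Words

variable {α : Type*}

/-- The periodic sequence obtained by repeating the word `l`. -/
def wordSeq (l : List α) : ℕ → Option α := fun i => l[i % l.length]?

/-- A word is primitive if it is non-empty and not a proper power. -/
def IsPrimitive (l : List α) : Prop :=
  l ≠ [] ∧ ∀ (m : List α) (n : ℕ), l = (List.replicate n m).flatten → n = 1

lemma length_flatten_replicate (n : ℕ) (l : List α) :
    (List.replicate n l).flatten.length = n * l.length := by simp

lemma getElem?_flatten_replicate (n : ℕ) (l : List α) (i : ℕ) (hi : i < n * l.length) :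
    (List.replicate n l).flatten[i]? = l[i % l.length]? := by
  induction n generalizing i with
  | zero => simp at hi
  | succ n ih =>
    rw [List.replicate_succ, List.flatten_cons]
    by_cases h : i < l.length
    · rw [List.getElem?_append_left h, Nat.mod_eq_of_lt h]
    · rw [not_lt] at h
      rw [List.getElem?_append_right h, ih _ (by rw [Nat.succ_mul] at hi; omega),
        ← Nat.mod_eq_sub_mod h]

lemma wordSeq_flatten_replicate (n : ℕ) (hn : n ≠ 0) (l : List α) :
    wordSeq (List.replicate n l).flatten = wordSeq l := by
  rcases eq_or_ne l [] with rfl | hl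
  · simp
  · funext i
    have h0 : 0 < n * l.length := Nat.mul_pos (Nat.pos_of_ne_zero hn) (List.length_pos_iff.mpr hl)
    unfold wordSeq
    rw [length_flatten_replicate, getElem?_flatten_replicate _ _ _ (Nat.mod_lt _ h0),
      Nat.mod_mul_left_mod]

lemma eq_of_wordSeq_eq {l m : List α} (h : wordSeq l = wordSeq m) (hlen : l.length = m.length) :
    l = m := by
  apply List.ext_getElem?
  intro i
  by_cases hi : i < l.length
  · have := congrFun h i
    unfold wordSeq at this
    rwa [Nat.mod_eq_of_lt hi, Nat.mod_eq_of_lt (hlen ▸ hi)] at this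
  · rw [List.getElem?_eq_none (by omega), List.getElem?_eq_none (by omega)]

lemma wordSeq_add_length (l : List α) (i : ℕ) : wordSeq l (i + l.length) = wordSeq l i := by
  simp [wordSeq]

lemma wordSeq_rotate (l : List α) (n i : ℕ) : wordSeq (l.rotate n) i = wordSeq l (i + n) := by
  rcases eq_or_ne l [] with rfl | hl
  · simp [wordSeq]
  · unfold wordSeq
    rw [List.length_rotate, List.getElem?_rotate (Nat.mod_lt _ (List.length_pos_iff.mpr hl)),
      Nat.mod_add_mod]

lemma iterate_shift {β : Type*} (x : ℕ → β) (n : ℕ) :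
    (fun (y : ℕ → β) i => y (i + 1))^[n] x = fun i => x (i + n) := by
  induction n generalizing x with
  | zero => rfl
  | succ n ih =>
    rw [Function.iterate_succ_apply, ih]
    funext i
    rw [add_assoc]

/-- The periods of a sequence are closed under greatest common divisors. -/
lemma period_gcd {β : Type*} {x : ℕ → β} {a b : ℕ} (ha : ∀ i, x (i + a) = x i)
    (hb : ∀ i, x (i + b) = x i) (i : ℕ) : x (i + a.gcd b) = x i := by
  have h1 : Function.IsPeriodicPt (fun (y : ℕ → β) i => y (i + 1)) a x := by
    rw [Function.IsPeriodicPt, Function.IsFixedPt, iterate_shift]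
    exact funext ha
  have h2 : Function.IsPeriodicPt (fun (y : ℕ → β) i => y (i + 1)) b x := by
    rw [Function.IsPeriodicPt, Function.IsFixedPt, iterate_shift]
    exact funext hb
  have h3 := h1.gcd h2
  rw [Function.IsPeriodicPt, Function.IsFixedPt, iterate_shift] at h3
  exact congrFun h3 i

/-- All periods of the sequence of a primitive word are multiples of the length of the word: if `g`
is the greatest common divisor of a period and the length, the word is a power of its first `g`
letters. -/
lemma IsPrimitive.dvd_of_period {l : List α} (hl : IsPrimitive l) {d : ℕ}
    (hd : ∀ i, wordSeq l (i + d) = wordSeq l i) : l.length ∣ d := by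
  have hpos := List.length_pos_iff.mpr hl.1
  obtain ⟨k, hk⟩ := Nat.gcd_dvd_left l.length d
  have hg : 0 < l.length.gcd d := Nat.gcd_pos_of_pos_left _ hpos
  have hper : ∀ i, wordSeq l (i + l.length.gcd d) = wordSeq l i :=
    period_gcd (wordSeq_add_length l) hd
  have hk0 : k ≠ 0 := by rintro rfl; simp at hk; exact hl.1 hk
  have hle : l.length.gcd d ≤ l.length := Nat.gcd_le_left _ hpos
  have hlen : (l.take (l.length.gcd d)).length = l.length.gcd d := by simp [hle]
  have hpow : l = (List.replicate k (l.take (l.length.gcd d))).flatten := by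
    apply eq_of_wordSeq_eq
    · rw [wordSeq_flatten_replicate _ hk0]
      funext i
      have hmul : ∀ m j, wordSeq l (j + l.length.gcd d * m) = wordSeq l j := by
        intro m
        induction m with
        | zero => intro j; rfl
        | succ m ih => intro j; rw [Nat.mul_succ, ← add_assoc, hper, ih]
      have h1 : wordSeq l i = wordSeq l (i % l.length.gcd d) := by
        conv_lhs => rw [← Nat.mod_add_div i (l.length.gcd d)]
        exact hmul _ _
      have h2 : i % l.length.gcd d < l.length.gcd d := Nat.mod_lt _ hg
      rw [h1]
      unfold wordSeq
      rw [hlen, Nat.mod_eq_of_lt (h2.trans_le hle), List.getElem?_take_of_lt h2]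
    · rw [length_flatten_replicate, hlen, mul_comm]
      exact hk
  have := hl.2 _ _ hpow
  rw [this, mul_one] at hk
  rw [hk]
  exact Nat.gcd_dvd_right _ _

lemma flatten_replicate_rotate (n : ℕ) (l : List α) (i : ℕ) :
    ((List.replicate n l).flatten).rotate i = (List.replicate n (l.rotate i)).flatten := by
  rcases eq_or_ne n 0 with rfl | hn
  · simp
  · apply eq_of_wordSeq_eq
    · funext j
      rw [wordSeq_rotate, wordSeq_flatten_replicate _ hn, wordSeq_flatten_replicate _ hn,
        wordSeq_rotate]
    · simp

lemma flatten_replicate_mul (a b : ℕ) (l : List α) :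
    (List.replicate a (List.replicate b l).flatten).flatten =
      (List.replicate (a * b) l).flatten := by
  rcases eq_or_ne a 0 with rfl | ha
  · simp
  rcases eq_or_ne b 0 with rfl | hb
  · simp
  apply eq_of_wordSeq_eq
  · rw [wordSeq_flatten_replicate _ ha, wordSeq_flatten_replicate _ hb,
      wordSeq_flatten_replicate _ (Nat.mul_ne_zero ha hb)]
  · simp [mul_assoc]

lemma exists_primitive_root (l : List α) (hl : l ≠ []) :
    ∃ (m : List α) (n : ℕ), IsPrimitive m ∧ n ≠ 0 ∧ l = (List.replicate n m).flatten := by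
  induction hn : l.length using Nat.strong_induction_on generalizing l with
  | _ N ih =>
    by_cases hp : IsPrimitive l
    · exact ⟨l, 1, hp, one_ne_zero, by simp⟩
    · rw [IsPrimitive, not_and] at hp
      have hp' := hp hl
      push Not at hp'
      obtain ⟨m, n, hmn, hn1⟩ := hp'
      have hn0 : n ≠ 0 := by rintro rfl; simp at hmn; exact hl hmn
      have hm : m ≠ [] := by rintro rfl; simp at hmn; exact hl hmn
      have hlen := congrArg List.length hmn
      rw [length_flatten_replicate] at hlen
      have hmpos := List.length_pos_iff.mpr hm
      have hlt : m.length < N := by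
        have : 2 ≤ n := by omega
        nlinarith
      obtain ⟨m', n', h1, h2, h3⟩ := ih _ hlt m hm rfl
      exact ⟨m', n * n', h1, Nat.mul_ne_zero hn0 h2, by rw [hmn, h3, flatten_replicate_mul]⟩

lemma primitive_root_unique {l m : List α} (hl : IsPrimitive l) (hm : IsPrimitive m) {a b : ℕ}
    (ha : a ≠ 0) (hb : b ≠ 0)
    (h : (List.replicate a l).flatten = (List.replicate b m).flatten) : l = m ∧ a = b := by
  have hs : wordSeq l = wordSeq m := by
    rw [← wordSeq_flatten_replicate a ha l, h, wordSeq_flatten_replicate b hb]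
  have h1 : l.length ∣ m.length := hl.dvd_of_period fun i => by rw [hs, wordSeq_add_length]
  have h2 : m.length ∣ l.length := hm.dvd_of_period fun i => by rw [← hs, wordSeq_add_length]
  have hlen := Nat.dvd_antisymm h1 h2
  have hlm := eq_of_wordSeq_eq hs hlen
  refine ⟨hlm, ?_⟩
  have := congrArg List.length h
  rw [length_flatten_replicate, length_flatten_replicate, hlen] at this
  exact Nat.eq_of_mul_eq_mul_right (List.length_pos_iff.mpr hm.1) this

lemma IsPrimitive.rotate {l : List α} (hl : IsPrimitive l) (n : ℕ) : IsPrimitive (l.rotate n) := by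
  refine ⟨fun h => hl.1 (by simpa using h), fun m k hk => ?_⟩
  obtain ⟨j, hj⟩ : l ~r l.rotate n := ⟨n, rfl⟩
  obtain ⟨i, hi⟩ := (show l.rotate n ~r l from List.IsRotated.symm ⟨n, rfl⟩)
  rw [hk, flatten_replicate_rotate] at hi
  exact hl.2 _ _ hi.symm

lemma IsPrimitive.rotate_injOn {l : List α} (hl : IsPrimitive l) {i j : ℕ} (hi : i < l.length)
    (hj : j < l.length) (h : l.rotate i = l.rotate j) : i = j := by
  wlog hij : i ≤ j generalizing i j
  · exact (this hj hi h.symm (by omega)).symm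
  obtain ⟨d, rfl⟩ := Nat.exists_eq_add_of_le hij
  rw [add_comm i d, ← List.rotate_rotate, List.rotate_eq_rotate] at h
  have := hl.dvd_of_period (d := d) fun k => by rw [← wordSeq_rotate, ← h]
  have := Nat.eq_zero_of_dvd_of_lt this (by omega)
  omega

/-- A cycle (a word up to rotation) is primitive if it is not empty and not a proper power. -/
def IsPrimitiveCycle (c : Cycle α) : Prop :=
  c ≠ Cycle.nil ∧ ∀ (l : List α) (n : ℕ), c = ((List.replicate n l).flatten : List _) → n = 1

lemma isPrimitiveCycle_coe {l : List α} : IsPrimitiveCycle (l : Cycle α) ↔ IsPrimitive l := by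
  constructor
  · rintro ⟨h1, h2⟩
    exact ⟨fun h => h1 (by simp [h]), fun m n h => h2 m n (by rw [← h])⟩
  · intro h
    refine ⟨by rw [Ne, Cycle.coe_eq_nil]; exact h.1, fun m n hmn => ?_⟩
    obtain ⟨i, hi⟩ := Cycle.coe_eq_coe.mp hmn
    exact (h.rotate i).2 m n hi

/-- Every non-empty word is a power of a primitive word in a unique way. -/
noncomputable def primitivePowEquiv (α : Type*) :
    {l : List α // IsPrimitive l} × ℕ ≃ {l : List α // l ≠ []} :=
  Equiv.ofBijective
    (fun p => ⟨(List.replicate (p.2 + 1) p.1.1).flatten, by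
      have := p.1.2.1
      simpa using this⟩) <| by
    constructor
    · rintro ⟨⟨l, hl⟩, a⟩ ⟨⟨m, hm⟩, b⟩ h
      have := primitive_root_unique hl hm a.succ_ne_zero b.succ_ne_zero (Subtype.ext_iff.mp h)
      simp_all
    · rintro ⟨l, hl⟩
      obtain ⟨m, n, hm, hn, rfl⟩ := exists_primitive_root l hl
      obtain ⟨k, rfl⟩ := Nat.exists_eq_succ_of_ne_zero hn
      exact ⟨⟨⟨m, hm⟩, k⟩, rfl⟩

/-- The primitive words representing a primitive cycle are the rotations of one of them. -/
noncomputable def rotationEquiv {l : List α} (hl : IsPrimitive l) :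
    Fin l.length ≃ {m : {m : List α // IsPrimitive m} // (m.1 : Cycle α) = l} :=
  Equiv.ofBijective
    (fun i => ⟨⟨l.rotate i, hl.rotate i⟩, Cycle.coe_eq_coe.mpr (List.IsRotated.symm ⟨i, rfl⟩)⟩)
    <| by
    constructor
    · intro i j h
      have : l.rotate i = l.rotate j := congrArg (fun x => x.1.1) h
      exact Fin.ext (hl.rotate_injOn i.2 j.2 this)
    · rintro ⟨⟨m, hm⟩, h⟩
      obtain ⟨n, hn, rfl⟩ := List.isRotated_iff_mod.mp (Cycle.coe_eq_coe.mp h).symm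
      rcases hn.lt_or_eq with hn | rfl
      · exact ⟨⟨n, hn⟩, rfl⟩
      · exact ⟨⟨0, List.length_pos_iff.mpr hl.1⟩, by simp⟩

/-- The logarithm of an Euler product over primitive cycles, as a sum over all non-empty words:
a primitive cycle of length `n` has `n` distinct rotations, and a word is a power of a primitive
word in a unique way. -/
theorem hasSum_neg_log_primitiveCycle (f : List α → ℂ)
    (hsum : Summable fun l : {l : List α // l ≠ []} => f l / l.1.length)
    (hlt : ∀ l, l ≠ [] → ‖f l‖ < 1)
    (hrot : ∀ l n, f (l.rotate n) = f l)
    (hpow : ∀ l n, n ≠ 0 → f (List.replicate n l).flatten = f l ^ n)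
    (F : Cycle α → ℂ) (hF : ∀ l : List α, F l = f l) :
    HasSum (fun c : {c : Cycle α // IsPrimitiveCycle c} => -Complex.log (1 - F c))
      (∑' l : {l : List α // l ≠ []}, f l / l.1.length) := by
  have h1 := ((primitivePowEquiv α).hasSum_iff
    (f := fun l : {l : List α // l ≠ []} => f l / l.1.length)).mpr hsum.hasSum
  -- The powers of a primitive word contribute the Taylor series of the logarithm.
  have h2 : HasSum (fun l : {l : List α // IsPrimitive l} => -Complex.log (1 - f l) / l.1.length)
      (∑' l : {l : List α // l ≠ []}, f l / l.1.length) := by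
    refine h1.prod_fiberwise fun l => ?_
    have := (Complex.hasSum_taylorSeries_neg_log' (hlt l.1 l.2.1)).div_const (l.1.length : ℂ)
    refine HasSum.congr_fun this fun n => ?_
    have hval : ((primitivePowEquiv α (l, n)).1 : List α) = (List.replicate (n + 1) l.1).flatten :=
      rfl
    simp only [Function.comp_apply, hval, length_flatten_replicate, hpow _ _ n.succ_ne_zero]
    push_cast
    rw [div_div]
  -- The primitive words are grouped by their cycles.
  have h3 := ((Equiv.sigmaFiberEquiv (fun l : {l : List α // IsPrimitive l} =>
    (⟨(l.1 : Cycle α), isPrimitiveCycle_coe.mpr l.2⟩ :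
      {c : Cycle α // IsPrimitiveCycle c}))).hasSum_iff).mpr h2
  refine h3.sigma fun c => ?_
  obtain ⟨c, hc⟩ := c
  induction c using Quotient.inductionOn with | _ l =>
  have hl : IsPrimitive l := isPrimitiveCycle_coe.mp hc
  let e : Fin l.length ≃ {m : {m : List α // IsPrimitive m} //
      (⟨(m.1 : Cycle α), isPrimitiveCycle_coe.mpr m.2⟩ : {c : Cycle α // IsPrimitiveCycle c})
        = ⟨Quotient.mk _ l, hc⟩} :=
    (rotationEquiv hl).trans (Equiv.subtypeEquivRight fun m => by
      rw [Subtype.ext_iff]; rfl)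
  refine (e.hasSum_iff).mp ?_
  have hval : ∀ i, ((e i).1 : List α) = l.rotate i := fun i => rfl
  have hlen : (l.length : ℂ) ≠ 0 :=
    Nat.cast_ne_zero.mpr (List.length_pos_iff.mpr hl.1).ne'
  have hF' : F (Quotient.mk _ l) = f l := hF l
  have hfin := hasSum_fintype (fun _ : Fin l.length => -Complex.log (1 - f l) / l.length)
  rw [Finset.sum_const, Finset.card_univ, Fintype.card_fin, nsmul_eq_mul,
    mul_div_cancel₀ _ hlen] at hfin
  rw [hF']
  refine HasSum.congr_fun hfin fun i => ?_
  simp only [Function.comp_apply, Equiv.sigmaFiberEquiv_apply]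
  rw [hval, hrot, List.length_rotate]

end Words

/-! ### The logarithm of a determinant as a series of traces -/

section DetExp

open scoped Matrix.Norms.Operator

variable {K : Type*} [Fintype K] [DecidableEq K]

/-- Jacobi's formula for the derivative of `det (1 - z M)`, where `B = (1 - z M)⁻¹`. -/
lemma hasDerivAt_det_one_sub_smul (M B : Matrix K K ℂ) (z : ℂ) (hB : (1 - z • M) * B = 1) :
    HasDerivAt (fun w => (1 - w • M).det) (-(B * M).trace * (1 - z • M).det) z := by
  have hfac : ∀ w, (1 - w • M).det = (1 - z • M).det * (1 + (w - z) • (-(B * M))).det := by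
    intro w
    rw [← Matrix.det_mul]
    congr 1
    rw [mul_add, mul_one, mul_smul_comm, mul_neg, ← mul_assoc, hB, one_mul, sub_smul]
    simp only [smul_neg]
    abel
  set q := (Matrix.det (1 + (Polynomial.X : Polynomial ℂ) • (-(B * M)).map Polynomial.C)).divX.divX
  have hq : ∀ w, (1 - w • M).det = (1 - z • M).det *
      (1 + (-(B * M)).trace * (w - z) + q.eval (w - z) * (w - z) ^ 2) := fun w => by
    rw [hfac, Matrix.det_one_add_smul]
  have h1 : HasDerivAt (fun w : ℂ => w - z) 1 z := (hasDerivAt_id z).sub_const z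
  have h2 : HasDerivAt (fun w : ℂ => q.eval (w - z)) (q.derivative.eval (z - z) * 1) z :=
    HasDerivAt.comp z (q.hasDerivAt _) h1
  have h3 := (((h1.const_mul (-(B * M)).trace).const_add 1).add (h2.mul (h1.pow 2))).const_mul
    (1 - z • M).det
  refine (h3.congr_of_eventuallyEq (Eventually.of_forall fun w => ?_)).congr_deriv ?_
  · rw [hq]; rfl
  · simp [Matrix.trace_neg]; ring

lemma norm_trace_le (M : Matrix K K ℂ) : ‖M.trace‖ ≤ Fintype.card K * ‖M‖ := by
  rw [Matrix.trace]
  refine (norm_sum_le _ _).trans ?_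
  refine (Finset.sum_le_card_nsmul _ _ ‖M‖ fun i _ => ?_).trans_eq (by simp [nsmul_eq_mul])
  rw [Matrix.linfty_opNorm_def, ← coe_nnnorm, NNReal.coe_le_coe, Matrix.diag_apply]
  refine le_trans ?_ (Finset.le_sup (f := fun i => ∑ j, ‖M i j‖₊) (Finset.mem_univ i))
  exact Finset.single_le_sum (f := fun j => ‖M i j‖₊) (fun _ _ => zero_le) (Finset.mem_univ i)

/-- `det (1 - M) = exp (- ∑ tr (M ^ n) / n)` if all row sums of `M` are at most `r < 1`: the product
of `det (1 - z M)` and `exp (∑ tr (M ^ n) z ^ n / n)` has derivative zero on a disc that contains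
`1`. -/
theorem det_one_sub_eq_exp (M : Matrix K K ℂ) {r : ℝ} (hr0 : 0 ≤ r) (hr : r < 1)
    (hrow : ∀ i, ∑ j, ‖M i j‖ ≤ r) :
    (1 - M).det = Complex.exp (-∑' n : ℕ, (M ^ (n + 1)).trace / (n + 1 : ℂ)) := by
  have hM : ‖M‖ ≤ r := by
    rw [Matrix.linfty_opNorm_def]
    have : (Finset.univ.sup fun i => ∑ j, ‖M i j‖₊) ≤ ⟨r, hr0⟩ := by
      refine Finset.sup_le fun i _ => ?_
      refine NNReal.coe_le_coe.mp ?_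
      push_cast
      exact hrow i
    exact_mod_cast this
  have hpow : ∀ n, ‖M ^ (n + 1)‖ ≤ r ^ (n + 1) := fun n =>
    (norm_pow_le' M n.succ_pos).trans (pow_le_pow_left₀ (norm_nonneg _) hM _)
  obtain ⟨R, hR1, hR⟩ : ∃ R : ℝ, 1 < R ∧ R * r < 1 := by
    refine ⟨2 / (1 + r), ?_, ?_⟩
    · rw [lt_div_iff₀ (by linarith)]; linarith
    · rw [div_mul_eq_mul_div, div_lt_one (by linarith)]; linarith
  let S : ℂ → ℂ := fun z => ∑' n : ℕ, (M ^ (n + 1)).trace / (n + 1 : ℂ) * z ^ (n + 1)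
  have hsmall : ∀ z ∈ Metric.ball (0 : ℂ) R, ‖z • M‖ < 1 := by
    intro z hz
    rw [mem_ball_zero_iff] at hz
    rw [norm_smul]
    nlinarith [norm_nonneg z, norm_nonneg M]
  have hS : ∀ z ∈ Metric.ball (0 : ℂ) R,
      HasDerivAt S (∑' n : ℕ, (M ^ (n + 1)).trace * z ^ n) z := by
    intro z hz
    refine hasDerivAt_tsum_of_isPreconnected (t := Metric.ball (0 : ℂ) R)
      (u := fun n => Fintype.card K * r * (R * r) ^ n) (y₀ := 0)
      (g := fun (n : ℕ) (z : ℂ) => (M ^ (n + 1)).trace / (n + 1 : ℂ) * z ^ (n + 1))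
      (g' := fun n z => (M ^ (n + 1)).trace * z ^ n) ?_ Metric.isOpen_ball
      (convex_ball _ _).isPreconnected ?_ ?_ ?_ ?_ hz
    · exact (summable_geometric_of_lt_one (by positivity) hR).mul_left _
    · intro n w _
      have hn : (n + 1 : ℂ) ≠ 0 := Nat.cast_add_one_ne_zero n
      refine ((hasDerivAt_pow (n + 1) w).const_mul _).congr_deriv ?_
      push_cast
      field_simp
    · intro n w hw
      rw [mem_ball_zero_iff] at hw
      rw [norm_mul, norm_pow]
      calc ‖(M ^ (n + 1)).trace‖ * ‖w‖ ^ n ≤ (Fintype.card K * r ^ (n + 1)) * R ^ n := by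
            gcongr
            exact (norm_trace_le _).trans (by gcongr; exact hpow n)
        _ = _ := by rw [mul_pow]; ring
    · exact Metric.mem_ball_self (by linarith)
    · simp [summable_zero]
  have hdet : ∀ z ∈ Metric.ball (0 : ℂ) R, HasDerivAt (fun w => (1 - w • M).det)
      (-(∑' n : ℕ, (M ^ (n + 1)).trace * z ^ n) * (1 - z • M).det) z := by
    intro z hz
    have hgeo := hsmall z hz
    have hB := mul_neg_geom_series (z • M) hgeo
    have hsum : HasSum (fun n => (z • M) ^ n) (∑' n, (z • M) ^ n) :=
      (summable_geometric_of_norm_lt_one hgeo).hasSum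
    have := (hsum.mul_right M).map (Matrix.traceAddMonoidHom K ℂ) continuous_id.matrix_trace
    convert hasDerivAt_det_one_sub_smul M _ z hB using 3
    have h := this.tsum_eq
    rw [Matrix.traceAddMonoidHom_apply] at h
    refine Eq.trans ?_ h
    refine tsum_congr fun n => ?_
    change _ = ((z • M) ^ n * M).trace
    rw [smul_pow, smul_mul_assoc, ← pow_succ, Matrix.trace_smul, smul_eq_mul, mul_comm]
  have hconst : ∀ z ∈ Metric.ball (0 : ℂ) R,
      HasDerivAt (fun w => (1 - w • M).det * Complex.exp (S w)) 0 z := by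
    intro z hz
    refine ((hdet z hz).mul (hS z hz).cexp).congr_deriv ?_
    ring
  have h0 : (0 : ℂ) ∈ Metric.ball (0 : ℂ) R := Metric.mem_ball_self (by linarith)
  have h1 : (1 : ℂ) ∈ Metric.ball (0 : ℂ) R := by simpa using hR1
  have heq := (convex_ball (0 : ℂ) R).is_const_of_fderivWithin_eq_zero (𝕜 := ℂ)
    (f := fun w => (1 - w • M).det * Complex.exp (S w))
    (fun z hz => (hconst z hz).differentiableAt.differentiableWithinAt) ?_ h1 h0
  · have hS0 : S 0 = 0 := by simp [S]
    have hS1 : S 1 = ∑' n : ℕ, (M ^ (n + 1)).trace / (n + 1 : ℂ) := by simp [S]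
    simp only [one_smul, zero_smul, sub_zero, Matrix.det_one, hS0, hS1, Complex.exp_zero,
      mul_one] at heq
    rw [Complex.exp_neg]
    exact eq_inv_of_mul_eq_one_left heq
  · intro z hz
    rw [fderivWithin_of_isOpen Metric.isOpen_ball hz]
    simpa using (hconst z hz).hasFDerivAt.fderiv

end DetExp

/-! ### Weights of paths and closed paths -/

section Weights

variable {α R : Type*}

/-- The weight of the path from `x` to `y` with intermediate points `m`, for the matrix `A`. -/
def pathWt [CommSemiring R] (A : α → α → R) : α → List α → α → R
  | x, [], y => A x y
  | x, z :: m, y => A x z * pathWt A z m y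

/-- The weight of the closed path through the points of the word `l`. -/
def cycWt [CommSemiring R] (A : α → α → R) (l : List α) : R :=
  (List.zipWith A l (l.rotate 1)).prod

section CommSemiring

variable [CommSemiring R] (A : α → α → R)

lemma prod_zipWith_append_singleton (x y : α) (m : List α) :
    (List.zipWith A (x :: m) (m ++ [y])).prod = pathWt A x m y := by
  induction m generalizing x with
  | nil => simp [pathWt]
  | cons z m ih =>
    rw [List.cons_append, List.zipWith_cons_cons, List.prod_cons, ih]
    rfl

lemma cycWt_cons (x : α) (m : List α) : cycWt A (x :: m) = pathWt A x m x := by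
  rw [cycWt, List.rotate_cons_succ, List.rotate_zero, prod_zipWith_append_singleton]

lemma cycWt_rotate (l : List α) (n : ℕ) : cycWt A (l.rotate n) = cycWt A l := by
  unfold cycWt
  rw [List.rotate_rotate, Nat.add_comm, ← List.rotate_rotate,
    ← List.zipWith_rotate_distrib _ _ _ _ (by simp)]
  exact (List.rotate_perm _ _).prod_eq

lemma pathWt_append_cons (x y z : α) (m m' : List α) :
    pathWt A x (m ++ z :: m') y = pathWt A x m z * pathWt A z m' y := by
  induction m generalizing x with
  | nil => rfl
  | cons w m ih => simp only [List.cons_append, pathWt, ih, mul_assoc]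

lemma cycWt_pow (l : List α) (n : ℕ) (hn : n ≠ 0) :
    cycWt A (List.replicate n l).flatten = cycWt A l ^ n := by
  rcases l with _ | ⟨x, m⟩
  · simp [cycWt]
  · obtain ⟨k, rfl⟩ := Nat.exists_eq_succ_of_ne_zero hn
    rw [List.replicate_succ, List.flatten_cons, List.cons_append, cycWt_cons, cycWt_cons]
    clear hn
    induction k with
    | zero => simp
    | succ k ih =>
      rw [List.replicate_succ, List.flatten_cons, List.cons_append, pathWt_append_cons, ih,
        ← pow_succ']

lemma pathWt_mul_left (u : R) (x y : α) (m : List α) :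
    pathWt (fun i j => u * A i j) x m y = u ^ (m.length + 1) * pathWt A x m y := by
  induction m generalizing x with
  | nil => simp [pathWt]
  | cons z m ih =>
    rw [pathWt, pathWt, ih, List.length_cons]
    ring

lemma cycWt_mul_left (u : R) (l : List α) :
    cycWt (fun i j => u * A i j) l = u ^ l.length * cycWt A l := by
  rcases l with _ | ⟨x, m⟩
  · simp [cycWt]
  · rw [cycWt_cons, cycWt_cons, pathWt_mul_left, List.length_cons]

lemma cycWt_map {β : Type*} (g : β → α) (l : List β) :
    cycWt A (l.map g) = cycWt (fun i j => A (g i) (g j)) l := by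
  unfold cycWt
  rw [← List.map_rotate, List.zipWith_map]

/-- Outside `F` the rank `h` increases along all paths of non-zero weight. -/
lemma lt_of_pathWt_ne_zero (F : Set α) (h : α → ℚ)
    (hacyc : ∀ i j, i ∉ F → j ∉ F → A i j ≠ 0 → h i < h j) {x y : α} {m : List α} (hx : x ∉ F)
    (hy : y ∉ F) (hm : ∀ z ∈ m, z ∉ F) (hne : pathWt A x m y ≠ 0) : h x < h y := by
  induction m generalizing x with
  | nil => exact hacyc _ _ hx hy hne
  | cons z m ih =>
    rw [pathWt] at hne
    have hz := hm z (by simp)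
    exact (hacyc _ _ hx hz (left_ne_zero_of_mul hne)).trans
      (ih hz (fun w hw => hm w (by simp [hw])) (right_ne_zero_of_mul hne))

lemma exists_mem_of_cycWt_ne_zero (F : Set α) (h : α → ℚ)
    (hacyc : ∀ i j, i ∉ F → j ∉ F → A i j ≠ 0 → h i < h j) {l : List α} (hl : l ≠ [])
    (hne : cycWt A l ≠ 0) : ∃ x ∈ l, x ∈ F := by
  by_contra! hcon
  rcases l with _ | ⟨x, m⟩
  · exact hl rfl
  · rw [cycWt_cons] at hne
    exact lt_irrefl _ (lt_of_pathWt_ne_zero A F h hacyc (hcon x (by simp)) (hcon x (by simp))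
      (fun z hz => hcon z (by simp [hz])) hne)

end CommSemiring

/-- Words of length `n + 1` are pairs of a letter and a word of length `n`. -/
def consLengthEquiv (α : Type*) (n : ℕ) :
    α × {m : List α // m.length = n} ≃ {l : List α // l.length = n + 1} where
  toFun p := ⟨p.1 :: p.2.1, by simp [p.2.2]⟩
  invFun l := ⟨l.1.head (List.ne_nil_of_length_eq_add_one l.2), l.1.tail, by simp [l.2]⟩
  left_inv p := rfl
  right_inv l := Subtype.ext (List.cons_head_tail _)

/-- Non-empty words, sorted by length. -/
def sigmaLengthEquiv (α : Type*) :
    (Σ n : ℕ, {l : List α // l.length = n + 1}) ≃ {l : List α // l ≠ []} where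
  toFun p := ⟨p.2.1, List.ne_nil_of_length_eq_add_one p.2.2⟩
  invFun l := ⟨l.1.length - 1, l.1, by have := List.length_pos_iff.mpr l.2; omega⟩
  left_inv := by
    rintro ⟨n, l, hl⟩
    obtain rfl : n = l.length - 1 := by omega
    rfl
  right_inv l := rfl

lemma pow_succ_apply_eq_sum {K : Type*} [Fintype K] [DecidableEq K] [CommSemiring R]
    (M : Matrix K K R) (n : ℕ) (x y : K) :
    (M ^ (n + 1)) x y = ∑ m : List.Vector K n, pathWt (fun i j => M i j) x m.1 y := by
  induction n generalizing x with
  | zero =>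
    rw [zero_add, pow_one, Fintype.sum_eq_single List.Vector.nil fun m hm =>
      absurd (List.Vector.eq_nil m) hm]
    rfl
  | succ n ih =>
    rw [pow_succ', Matrix.mul_apply,
      ← Equiv.sum_comp (show K × List.Vector K n ≃ List.Vector K (n + 1) from consLengthEquiv K n),
      Fintype.sum_prod_type]
    refine Finset.sum_congr rfl fun z _ => ?_
    rw [ih, Finset.mul_sum]
    rfl

lemma trace_pow_eq_sum {K : Type*} [Fintype K] [DecidableEq K] [CommSemiring R]
    (M : Matrix K K R) (n : ℕ) :
    (M ^ (n + 1)).trace = ∑ l : List.Vector K (n + 1), cycWt (fun i j => M i j) l.1 := by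
  rw [← Equiv.sum_comp (show K × List.Vector K n ≃ List.Vector K (n + 1) from consLengthEquiv K n),
      Fintype.sum_prod_type, Matrix.trace]
  refine Finset.sum_congr rfl fun z _ => ?_
  rw [Matrix.diag_apply, pow_succ_apply_eq_sum]
  refine Finset.sum_congr rfl fun m _ => ?_
  exact (cycWt_cons _ _ _).symm

open scoped ENNReal in
lemma tsum_length_succ (f : List α → ℝ≥0∞) (n : ℕ) :
    ∑' l : {l : List α // l.length = n + 1}, f l.1 =
      ∑' (x : α) (m : {m : List α // m.length = n}), f (x :: m.1) := by
  rw [← (consLengthEquiv α n).tsum_eq]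
  exact ENNReal.tsum_prod (f := fun (x : α) (m : {m : List α // m.length = n}) => f (x :: m.1))

open scoped ENNReal in
lemma tsum_pathWt_le (N : α → α → ℝ≥0∞) (C : ℝ≥0∞) (hN : ∀ x, ∑' y, N x y ≤ C) (n : ℕ) (x y : α) :
    ∑' m : {m : List α // m.length = n}, pathWt N x m.1 y ≤ C ^ (n + 1) := by
  induction n generalizing x with
  | zero =>
    rw [tsum_eq_single (⟨[], rfl⟩ : {m : List α // m.length = 0}) fun m hm =>
      absurd (Subtype.ext (List.eq_nil_of_length_eq_zero m.2)) hm]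
    rw [pathWt, zero_add, pow_one]
    exact (ENNReal.le_tsum y).trans (hN x)
  | succ n ih =>
    rw [tsum_length_succ (fun m => pathWt N x m y)]
    calc ∑' (z : α) (m : {m : List α // m.length = n}), N x z * pathWt N z m.1 y
        ≤ ∑' z, N x z * C ^ (n + 1) := by
          refine ENNReal.tsum_le_tsum fun z => ?_
          rw [ENNReal.tsum_mul_left]
          exact mul_le_mul_right (ih z) _
      _ ≤ C ^ (n + 1 + 1) := by
          rw [ENNReal.tsum_mul_right, pow_succ' C (n + 1)]
          exact mul_le_mul_left (hN x) _

open scoped ENNReal in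
/-- If all closed paths of non-zero weight meet the finite set `F`, the total weight of the closed
paths of length `n` is at most `n |F| C ^ n`, where `C` bounds the row sums. -/
lemma tsum_cycWt_le (N : α → α → ℝ≥0∞) (C : ℝ≥0∞) (hN : ∀ x, ∑' y, N x y ≤ C) (F : Finset α)
    (h : α → ℚ) (hacyc : ∀ i j, i ∉ F → j ∉ F → N i j ≠ 0 → h i < h j) (n : ℕ) :
    ∑' l : {l : List α // l.length = n + 1}, cycWt N l.1 ≤ (n + 1) * (F.card * C ^ (n + 1)) := by
  classical
  -- The weight of the closed paths whose first point lies in `F`: each closed path of non-zero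
  -- weight has a rotation of this kind.
  let g : List α → ℝ≥0∞ := fun l => if ∃ x ∈ F, l.head? = some x then cycWt N l else 0
  have hg : ∑' l : {l : List α // l.length = n + 1}, g l.1 ≤ F.card * C ^ (n + 1) := by
    rw [tsum_length_succ]
    calc ∑' (x : α) (m : {m : List α // m.length = n}), g (x :: m.1)
        = ∑' x, if x ∈ F then ∑' (m : {m : List α // m.length = n}), pathWt N x m.1 x else 0 := by
          refine tsum_congr fun x => ?_
          by_cases hx : x ∈ F
          · simp [g, hx, cycWt_cons]
          · simp [g, hx]
      _ ≤ ∑' x, if x ∈ F then C ^ (n + 1) else 0 := by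
          refine ENNReal.tsum_le_tsum fun x => ?_
          split_ifs
          · exact tsum_pathWt_le N C hN n x x
          · exact le_rfl
      _ = F.card * C ^ (n + 1) := by
          rw [tsum_eq_sum (s := F) fun x hx => if_neg hx]
          rw [Finset.sum_congr rfl fun x hx => if_pos hx]
          simp
  have hle : ∀ l : {l : List α // l.length = n + 1},
      cycWt N l.1 ≤ ∑ i ∈ Finset.range (n + 1), g (l.1.rotate i) := by
    rintro ⟨l, hl⟩
    by_cases h0 : cycWt N l = 0
    · simp [h0]
    · obtain ⟨x, hxl, hxF⟩ := exists_mem_of_cycWt_ne_zero N (F : Set α) h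
        (by simpa using hacyc) (List.ne_nil_of_length_eq_add_one hl) h0
      obtain ⟨i, hi, rfl⟩ := List.getElem_of_mem hxl
      refine le_trans (le_of_eq ?_) (Finset.single_le_sum (f := fun i => g (l.rotate i))
        (fun _ _ => zero_le) (Finset.mem_range.mpr (hl ▸ hi)))
      have : ∃ x ∈ F, (l.rotate i).head? = some x := by
        refine ⟨l[i], by simpa using hxF, ?_⟩
        rw [List.head?_rotate hi, List.getElem?_eq_getElem hi]
      simp only [g, this, if_true, cycWt_rotate]
  calc ∑' l : {l : List α // l.length = n + 1}, cycWt N l.1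
      ≤ ∑' l : {l : List α // l.length = n + 1}, ∑ i ∈ Finset.range (n + 1), g (l.1.rotate i) :=
        ENNReal.tsum_le_tsum hle
    _ = ∑ i ∈ Finset.range (n + 1), ∑' l : {l : List α // l.length = n + 1}, g (l.1.rotate i) :=
        Summable.tsum_finsetSum fun _ _ => ENNReal.summable
    _ ≤ ∑ i ∈ Finset.range (n + 1), F.card * C ^ (n + 1) := by
        refine Finset.sum_le_sum fun i _ => le_trans ?_ hg
        let e : {l : List α // l.length = n + 1} → {l : List α // l.length = n + 1} :=
          fun l => ⟨l.1.rotate i, by simp [l.2]⟩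
        exact ENNReal.tsum_comp_le_tsum_of_injective (f := e)
          (fun a b hab => Subtype.ext (List.rotate_injective i (Subtype.ext_iff.mp hab)))
          (fun l => g l.1)
    _ = (n + 1) * (F.card * C ^ (n + 1)) := by simp

end Weights

/-! ### Determinants and Euler products of matrices with few closed paths -/

/-- The row sums of the matrix `A` are at most `r`, and outside the finite set `F` its non-zero
coefficients increase the rank function `h`, so that all closed paths of `A` meet `F`. -/
structure HasFewCycles {α : Type*} (A : α → α → ℂ) (r : ℝ) (F : Finset α) (h : α → ℚ) : Prop where
  row : ∀ i (s : Finset α), ∑ j ∈ s, ‖A i j‖ ≤ r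
  acyc : ∀ i j, i ∉ F → j ∉ F → A i j ≠ 0 → h i < h j

namespace HasFewCycles

variable {α : Type*} {A : α → α → ℂ} {r : ℝ} {F : Finset α} {h : α → ℚ}

lemma norm_le (H : HasFewCycles A r F h) (i j : α) : ‖A i j‖ ≤ r := by
  simpa using H.row i {j}

lemma norm_pathWt_le (H : HasFewCycles A r F h) (x y : α) (m : List α) :
    ‖pathWt A x m y‖ ≤ r ^ (m.length + 1) := by
  induction m generalizing x with
  | nil => simpa [pathWt] using H.norm_le x y
  | cons z m ih =>
    rw [pathWt, norm_mul, List.length_cons, pow_succ']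
    exact mul_le_mul (H.norm_le x z) (ih z) (norm_nonneg _) ((norm_nonneg _).trans (H.norm_le x z))

lemma norm_cycWt_lt_one (H : HasFewCycles A r F h) (hr0 : 0 ≤ r) (hr : r < 1) {l : List α}
    (hl : l ≠ []) : ‖cycWt A l‖ < 1 := by
  rcases l with _ | ⟨x, m⟩
  · exact absurd rfl hl
  · rw [cycWt_cons]
    exact (H.norm_pathWt_le x x m).trans_lt (pow_lt_one₀ hr0 hr (Nat.succ_ne_zero _))

lemma enorm_cycWt (A : α → α → ℂ) (l : List α) : ‖cycWt A l‖ₑ = cycWt (fun i j => ‖A i j‖ₑ) l := by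
  rcases l with _ | ⟨x, m⟩
  · simp [cycWt]
  · rw [cycWt_cons, cycWt_cons]
    suffices ∀ x y, ‖pathWt A x m y‖ₑ = pathWt (fun i j => ‖A i j‖ₑ) x m y from this x x
    induction m with
    | nil => intro x y; rfl
    | cons z m ih => intro x y; rw [pathWt, pathWt, enorm_mul, ih]

theorem summable_cycWt (H : HasFewCycles A r F h) (hr0 : 0 ≤ r) (hr : r < 1) :
    Summable fun l : {l : List α // l ≠ []} => ‖cycWt A l.1‖ := by
  have hrow : ∀ x, ∑' y, ‖A x y‖ₑ ≤ ENNReal.ofReal r := by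
    intro x
    refine ENNReal.summable.tsum_le_of_sum_le fun s => ?_
    refine le_trans (le_of_eq ?_) (ENNReal.ofReal_le_ofReal (H.row x s))
    rw [ENNReal.ofReal_sum_of_nonneg fun _ _ => norm_nonneg _]
    exact Finset.sum_congr rfl fun y _ => (ofReal_norm _).symm
  have hle : ∑' l : {l : List α // l ≠ []}, ‖cycWt A l.1‖ₑ ≤
      ∑' n : ℕ, ENNReal.ofReal ((n + 1) * (F.card * r ^ (n + 1))) := by
    rw [← (sigmaLengthEquiv α).tsum_eq, ENNReal.tsum_sigma']
    refine ENNReal.tsum_le_tsum fun n => ?_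
    have := tsum_cycWt_le (fun i j => ‖A i j‖ₑ) _ hrow F h
      (fun i j hi hj hne => H.acyc i j hi hj (by simpa using hne)) n
    refine le_trans (le_of_eq (tsum_congr fun l => enorm_cycWt A l.1)) (this.trans (le_of_eq ?_))
    rw [ENNReal.ofReal_mul (by positivity), ENNReal.ofReal_mul (by positivity),
      ENNReal.ofReal_pow hr0, ENNReal.ofReal_natCast]
    congr 1
    exact_mod_cast (ENNReal.ofReal_natCast (n + 1)).symm
  have hsum : Summable fun n : ℕ => ((n : ℝ) + 1) * (F.card * r ^ (n + 1)) := by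
    have h1 := summable_pow_mul_geometric_of_norm_lt_one (R := ℝ) 1 (r := r)
      (by rwa [Real.norm_of_nonneg hr0])
    have h2 := (((summable_nat_add_iff 1).mpr h1).mul_left (F.card : ℝ))
    refine h2.congr fun n => ?_
    push_cast
    ring
  have hfin : ∑' l : {l : List α // l ≠ []}, ‖cycWt A l.1‖ₑ ≠ ⊤ :=
    ne_top_of_le_ne_top hsum.tsum_ofReal_ne_top hle
  have := ENNReal.summable_toReal hfin
  simpa using this

/-- The weights of all closed paths, each divided by its length, are absolutely summable. -/
lemma summable_cycWt_div (H : HasFewCycles A r F h) (hr0 : 0 ≤ r) (hr : r < 1) :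
    Summable fun l : {l : List α // l ≠ []} => ‖cycWt A l.1 / l.1.length‖ := by
  refine (H.summable_cycWt hr0 hr).of_nonneg_of_le (fun _ => norm_nonneg _) fun l => ?_
  rw [norm_div, RCLike.norm_natCast]
  have : (1 : ℝ) ≤ l.1.length := by exact_mod_cast List.length_pos_iff.mpr l.2
  exact div_le_self (norm_nonneg _) this

open Classical in
/-- A finite minor of `1 - A` is the exponential of a sum over the closed paths inside the finite
set. -/
theorem det_eq_exp (H : HasFewCycles A r F h) (hr0 : 0 ≤ r) (hr : r < 1) (E : Finset α) :
    Matrix.det (1 - Matrix.of fun i j : E => A i j) =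
      Complex.exp (-∑' l : {l : List α // l ≠ []},
        if ∀ x ∈ l.1, x ∈ E then cycWt A l.1 / l.1.length else 0) := by
  rw [det_one_sub_eq_exp _ hr0 hr]
  swap
  · intro i
    refine le_trans (le_of_eq ?_) (H.row i E)
    exact Finset.sum_coe_sort E fun j => ‖A i j‖
  congr 2
  have hs : Summable fun l : {l : List α // l ≠ []} =>
      if ∀ x ∈ l.1, x ∈ E then cycWt A l.1 / l.1.length else 0 := by
    refine (H.summable_cycWt_div hr0 hr).of_norm_bounded fun l => ?_
    split_ifs
    · exact le_rfl
    · rw [norm_zero]; exact norm_nonneg _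
  rw [← (sigmaLengthEquiv α).tsum_eq]
  refine Eq.trans ?_ ((sigmaLengthEquiv α).summable_iff.mpr hs).tsum_sigma.symm
  refine tsum_congr fun n => ?_
  -- The words of length `n + 1` with letters in `E`, as words with letters in `α`.
  let g : List.Vector E (n + 1) → {l : List α // l.length = n + 1} :=
    fun l => ⟨l.1.map Subtype.val, by rw [List.length_map]; exact l.2⟩
  have hg : Function.Injective g := fun a b hab =>
    Subtype.ext (List.map_injective_iff.mpr Subtype.val_injective (Subtype.ext_iff.mp hab))
  have hsupp : (Function.support fun l : {l : List α // l.length = n + 1} =>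
      if ∀ x ∈ l.1, x ∈ E then cycWt A l.1 / l.1.length else 0) ⊆ Set.range g := by
    intro l hl
    have hmem : ∀ x ∈ l.1, x ∈ E := by
      by_contra hcon
      exact hl (if_neg hcon)
    refine ⟨⟨l.1.attach.map fun x => ⟨x.1, hmem _ x.2⟩, by simp [l.2]⟩, Subtype.ext ?_⟩
    simp [g]
  have := hg.tsum_eq hsupp
  refine Eq.trans ?_ this
  rw [tsum_fintype, trace_pow_eq_sum, Finset.sum_div]
  refine Finset.sum_congr rfl fun l _ => ?_
  have hmem : ∀ x ∈ (g l).1, x ∈ E := by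
    intro x hx
    obtain ⟨y, -, rfl⟩ := List.mem_map.mp hx
    exact y.2
  rw [if_pos hmem, (g l).2, cycWt_map]
  push_cast
  rfl

open Classical in
/-- The net of finite minors of `1 - A` converges, by dominated convergence for the sums over
closed paths. -/
theorem tendsto_det (H : HasFewCycles A r F h) (hr0 : 0 ≤ r) (hr : r < 1) :
    Tendsto (fun E : Finset α => Matrix.det (1 - Matrix.of fun i j : E => A i j))
      atTop (𝓝 (Complex.exp (-∑' l : {l : List α // l ≠ []}, cycWt A l.1 / l.1.length))) := by
  have := tendsto_tsum_of_dominated_convergence (𝓕 := (atTop : Filter (Finset α)))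
    (f := fun E (l : {l : List α // l ≠ []}) =>
      if ∀ x ∈ l.1, x ∈ E then cycWt A l.1 / l.1.length else 0)
    (g := fun l => cycWt A l.1 / l.1.length) (H.summable_cycWt_div hr0 hr) ?_ ?_
  · refine (this.neg.cexp).congr fun E => ?_
    rw [← H.det_eq_exp hr0 hr E]
  · intro l
    refine tendsto_const_nhds.congr' ?_
    filter_upwards [eventually_ge_atTop l.1.toFinset] with E hE
    rw [if_pos fun x hx => hE (List.mem_toFinset.mpr hx)]
  · refine Eventually.of_forall fun E l => ?_
    split_ifs
    · exact le_rfl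
    · rw [norm_zero]; exact norm_nonneg _

/-- The Euler product over the primitive cycles is the inverse of the limit of the finite minors of
`1 - A`. -/
theorem hasProd_euler (H : HasFewCycles A r F h) (hr0 : 0 ≤ r) (hr : r < 1) (w : Cycle α → ℂ)
    (hw : ∀ l : List α, w l = cycWt A l) :
    HasProd (fun c : {c : Cycle α // IsPrimitiveCycle c} => (1 - w c)⁻¹)
      (Complex.exp (∑' l : {l : List α // l ≠ []}, cycWt A l.1 / l.1.length)) := by
  have h1 := hasSum_neg_log_primitiveCycle (cycWt A) (H.summable_cycWt_div hr0 hr).of_norm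
    (fun l hl => H.norm_cycWt_lt_one hr0 hr hl) (cycWt_rotate A) (fun l n hn => cycWt_pow A l n hn)
    w hw
  refine HasProd.congr_fun h1.cexp fun c => ?_
  obtain ⟨c, hc⟩ := c
  induction c using Quotient.inductionOn with | _ l =>
  have hl : l ≠ [] := (isPrimitiveCycle_coe.mp hc).1
  have hlt : ‖w (l : Cycle α)‖ < 1 := by
    rw [hw]
    exact H.norm_cycWt_lt_one hr0 hr hl
  have hne : 1 - w (l : Cycle α) ≠ 0 := by
    intro h0
    rw [sub_eq_zero] at h0
    rw [← h0] at hlt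
    simp at hlt
  rw [Function.comp_apply, Complex.exp_neg]
  exact (congrArg Inv.inv (Complex.exp_log hne)).symm

/-- The sum over all finite permutations of the absolute values of the products of coefficients
of `1 - A` converges: its finite partial sums are bounded by permanents of finite matrices, to which
`sum_perm_one_add_le` applies. -/
theorem summable_finitePerm (H : HasFewCycles A r F h) (hr : r ≤ 1)
    (B : (α →₀ ℂ) →ₗ[ℂ] (α → ℂ)) (hB : ∀ i j, coeff B i j = Finsupp.single i 1 j - A i j) :
    Summable (fun σ : FinitePerm α => ‖∏' i, coeff B i (σ.1 i)‖) := by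
  classical
  refine summable_of_sum_le (c := 2 ^ F.card) (fun _ => norm_nonneg _) fun S => ?_
  -- A finite set which contains the supports of all permutations in `S`.
  let E : Finset α := F ∪ S.biUnion fun σ => σ.2.toFinset
  have hfix : ∀ σ ∈ S, ∀ i, i ∉ E → σ.1 i = i := by
    intro σ hσ i hi
    by_contra hne
    refine hi (Finset.mem_union_right _ (Finset.mem_biUnion.mpr ⟨σ, hσ, ?_⟩))
    simpa using hne
  have hdiag : ∀ i, i ∉ E → A i i = 0 := by
    intro i hi
    have hiF : i ∉ F := fun h => hi (Finset.mem_union_left _ h)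
    by_contra hne
    exact lt_irrefl _ (H.acyc i i hiF hiF hne)
  have hmem : ∀ σ ∈ S, ∀ i, σ.1 i ∈ E ↔ i ∈ E := by
    intro σ hσ i
    refine ⟨fun hi => ?_, fun hi => ?_⟩
    rotate_left
    · by_contra hcon
      have := σ.1.injective (hfix σ hσ _ hcon)
      rw [this] at hcon
      exact hcon hi
    · by_contra hcon
      rw [hfix σ hσ i hcon] at hi
      exact hcon hi
  let φ : S → Equiv.Perm E := fun σ => σ.1.1.subtypePerm (hmem σ.1 σ.2)
  have hφ : Function.Injective φ := by
    intro σ τ hστ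
    refine Subtype.ext (Subtype.ext (Equiv.ext fun i => ?_))
    by_cases hi : i ∈ E
    · have := congrArg (fun p : Equiv.Perm E => (p ⟨i, hi⟩ : α)) hστ
      simpa [φ] using this
    · rw [hfix σ.1 σ.2 i hi, hfix τ.1 τ.2 i hi]
  have hterm : ∀ σ : S, ‖∏' i, coeff B i (σ.1.1 i)‖ ≤
      ∏ i : E, ((if i = φ σ i then 1 else 0) + ‖A i (φ σ i)‖) := by
    intro σ
    rw [tprod_eq_prod (s := E), ← Finset.prod_coe_sort, norm_prod]
    · refine Finset.prod_le_prod (fun _ _ => norm_nonneg _) fun i _ => ?_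
      rw [hB]
      refine (norm_sub_le _ _).trans ?_
      have : ((i : α) = σ.1.1 i) ↔ i = φ σ i := by rw [Subtype.ext_iff]; rfl
      simp only [Finsupp.single_apply, this]
      refine add_le_add (le_of_eq ?_) le_rfl
      split_ifs <;> simp
    · intro i hi
      rw [hfix σ.1 σ.2 i hi, hB, hdiag i hi]
      simp
  calc ∑ σ ∈ S, ‖∏' i, coeff B i (σ.1 i)‖ = ∑ σ : S, ‖∏' i, coeff B i (σ.1.1 i)‖ :=
        (Finset.sum_coe_sort S fun σ => ‖∏' i, coeff B i (σ.1 i)‖).symm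
    _ ≤ ∑ σ : S, ∏ i : E, ((if i = φ σ i then 1 else 0) + ‖A i (φ σ i)‖) :=
        Finset.sum_le_sum fun σ _ => hterm σ
    _ = ∑ τ ∈ Finset.univ.map ⟨φ, hφ⟩, ∏ i : E, ((if i = τ i then 1 else 0) + ‖A i (τ i)‖) := by
        rw [Finset.sum_map]; rfl
    _ ≤ ∑ τ : Equiv.Perm E, ∏ i : E, ((if i = τ i then 1 else 0) + ‖A i (τ i)‖) := by
        refine Finset.sum_le_sum_of_subset_of_nonneg (Finset.subset_univ _) fun τ _ _ => ?_
        refine Finset.prod_nonneg fun i _ => add_nonneg ?_ (norm_nonneg _)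
        split_ifs <;> norm_num
    _ ≤ 2 ^ (F.subtype (· ∈ E)).card := by
        refine sum_perm_one_add_le (fun i j : E => ‖A i j‖) (fun _ _ => norm_nonneg _)
          (fun i => ?_) _ (fun i => h i) fun i j hi hj hne => ?_
        · rw [Finset.sum_coe_sort E fun j => ‖A i j‖]
          exact (H.row i E).trans hr
        · refine H.acyc i j (fun h => hi ?_) (fun h => hj ?_) (by simpa using hne) <;>
            simpa using h
    _ ≤ 2 ^ F.card := by
        refine pow_le_pow_right₀ (by norm_num) ?_
        rw [Finset.card_subtype]
        exact Finset.card_filter_le _ _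

theorem isStrongDetClass (H : HasFewCycles A r F h) (hr : r < 1)
    (B : (α →₀ ℂ) →ₗ[ℂ] (α → ℂ)) (hB : ∀ i j, coeff B i j = Finsupp.single i 1 j - A i j) :
    IsStrongDetClass B := by
  refine ⟨fun i h0 => ?_, ?_, H.summable_finitePerm hr.le B hB⟩
  · have := H.norm_le i i
    rw [hB, Finsupp.single_eq_same, sub_eq_zero] at h0
    rw [← h0, norm_one] at this
    linarith
  · refine summable_of_hasFiniteSupport (F.finite_toSet.subset fun i hi => ?_)
    by_contra hiF
    have h0 : A i i = 0 := by
      by_contra hne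
      exact lt_irrefl _ (H.acyc i i hiF hiF hne)
    rw [Function.mem_support, hB, h0] at hi
    simp at hi

end HasFewCycles

/-! ### The determinant of a matrix with finitely many cusps -/

section Schur

variable {K R J : Type*} [Fintype K] [Fintype R] [DecidableEq K] [DecidableEq R]

/-- The Schur complement formula, with a solution `X` of `D X = C` in place of `D⁻¹ C`. -/
lemma det_fromBlocks_of_mul_eq (A : Matrix K K ℂ) (B : Matrix K R ℂ) (C : Matrix R K ℂ)
    (D : Matrix R R ℂ) (X : Matrix R K ℂ) (hD : D.det = 1) (hX : D * X = C) :
    (Matrix.fromBlocks A B C D).det = (A - B * X).det := by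
  have h1 : Matrix.fromBlocks A B C D * Matrix.fromBlocks 1 0 (-X) 1 =
      Matrix.fromBlocks (A - B * X) B 0 D := by
    rw [Matrix.fromBlocks_multiply]
    simp [hX, sub_eq_add_neg]
  have h2 := congrArg Matrix.det h1
  rw [Matrix.det_mul, Matrix.det_fromBlocks_zero₁₂, Matrix.det_fromBlocks_zero₂₁, hD] at h2
  simpa using h2

/-- A matrix whose non-zero coefficients increase a rank function is strictly triangular. -/
lemma det_one_sub_of_rank (N : Matrix R R ℂ) (b : R → ℚ) (h : ∀ i j, N i j ≠ 0 → b i < b j) :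
    (1 - N).det = 1 := by
  have h0 : ∀ i j, b j ≤ b i → N i j = 0 := fun i j hij => by
    by_contra hne
    exact absurd (h i j hne) (not_lt.mpr hij)
  have hT : Matrix.BlockTriangular (1 - N) b := by
    intro i j hij
    have hne : i ≠ j := by rintro rfl; exact lt_irrefl _ hij
    rw [Matrix.sub_apply, Matrix.one_apply_ne hne, h0 i j hij.le, sub_zero]
  rw [hT.det]
  refine Finset.prod_eq_one fun a _ => ?_
  have : (1 - N).toSquareBlock b a = 1 := by
    ext i j
    rw [Matrix.toSquareBlock_def, Matrix.of_apply, Matrix.sub_apply,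
      h0 _ _ (by rw [i.2, j.2]), sub_zero, Matrix.one_apply, Matrix.one_apply]
    simp only [Subtype.ext_iff]
  rw [this, Matrix.det_one]

/-- The determinant of a finite rank perturbation depends on the coefficients `g i` of the rank one
terms in a multiaffine way: it is the determinant of a matrix in which each `g i` occurs in exactly
one place. -/
lemma exists_polynomial_det_perturbation [Fintype J] [DecidableEq J]
    (A : Matrix K K (Polynomial ℂ)) (a : K → J → Polynomial ℂ) (b : J → K → Polynomial ℂ) :
    ∃ p : Finset J → Polynomial ℂ, ∀ (u : ℂ) (g : J → ℂ),
      Matrix.det (Matrix.of fun x y =>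
        (A x y).eval u + ∑ i, (a x i).eval u * g i * (b i y).eval u) =
        ∑ S, (p S).eval u * ∏ i ∈ S, g i := by
  -- The matrix `M` below with all `g i` replaced by `1`, and the set `T σ` of those `i` for which
  -- the product of the coefficients belonging to the permutation `σ` contains `g i`.
  let N : Matrix (K ⊕ (J ⊕ J)) (K ⊕ (J ⊕ J)) (Polynomial ℂ) :=
    Matrix.fromBlocks A (Matrix.fromCols (Matrix.of a) 0) (Matrix.fromRows 0 (Matrix.of b))
      (Matrix.fromBlocks 1 1 0 1)
  let T : Equiv.Perm (K ⊕ (J ⊕ J)) → Finset J := fun σ =>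
    Finset.univ.filter fun i => σ (Sum.inr (Sum.inl i)) = Sum.inr (Sum.inr i)
  refine ⟨fun S => ∑ σ : Equiv.Perm (K ⊕ (J ⊕ J)),
    if T σ = S then ((σ.sign : ℤ) : Polynomial ℂ) * ∏ k, N k (σ k) else 0, fun u g => ?_⟩
  let M : Matrix (K ⊕ (J ⊕ J)) (K ⊕ (J ⊕ J)) ℂ :=
    Matrix.fromBlocks (Matrix.of fun x y => (A x y).eval u)
      (Matrix.fromCols (Matrix.of fun x i => (a x i).eval u) 0)
      (Matrix.fromRows 0 (Matrix.of fun i y => (b i y).eval u))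
      (Matrix.fromBlocks 1 (Matrix.diagonal g) 0 1)
  have hM : M.det = Matrix.det (Matrix.of fun x y =>
      (A x y).eval u + ∑ i, (a x i).eval u * g i * (b i y).eval u) := by
    rw [det_fromBlocks_of_mul_eq _ _ _ _ (Matrix.fromRows
      (-(Matrix.diagonal g * Matrix.of fun i y => (b i y).eval u))
      (Matrix.of fun i y => (b i y).eval u))]
    · congr 1
      ext x y
      simp [Matrix.fromCols_mul_fromRows, Matrix.mul_apply, Matrix.diagonal_apply, mul_assoc]
    · rw [Matrix.det_fromBlocks_zero₂₁]
      simp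
    · rw [Matrix.fromBlocks_mul_fromRows]
      simp
  have hent : ∀ σ : Equiv.Perm (K ⊕ (J ⊕ J)), ∏ k, M k (σ k) =
      (∏ k, N k (σ k)).eval u * ∏ i ∈ T σ, g i := by
    intro σ
    rw [Polynomial.eval_prod, Finset.prod_filter]
    simp only [Fintype.prod_sum_type]
    have h1 : ∀ x : K, M (Sum.inl x) (σ (Sum.inl x)) = (N (Sum.inl x) (σ (Sum.inl x))).eval u := by
      intro x
      rcases σ (Sum.inl x) with y | j | j <;> simp [M, N]
    have h2 : ∀ i : J, M (Sum.inr (Sum.inl i)) (σ (Sum.inr (Sum.inl i))) =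
        (N (Sum.inr (Sum.inl i)) (σ (Sum.inr (Sum.inl i)))).eval u *
          if σ (Sum.inr (Sum.inl i)) = Sum.inr (Sum.inr i) then g i else 1 := by
      intro i
      rcases σ (Sum.inr (Sum.inl i)) with y | j | j
      · simp [M, N]
      · by_cases hij : i = j <;> simp [M, N, hij]
      · by_cases hij : i = j
        · subst hij; simp [M, N]
        · simp [M, N, hij]
    have h3 : ∀ i : J, M (Sum.inr (Sum.inr i)) (σ (Sum.inr (Sum.inr i))) =
        (N (Sum.inr (Sum.inr i)) (σ (Sum.inr (Sum.inr i)))).eval u := by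
      intro i
      rcases σ (Sum.inr (Sum.inr i)) with y | j | j
      · simp [M, N]
      · simp [M, N]
      · by_cases hij : i = j <;> simp [M, N, hij]
    simp only [h1, h2, h3, Finset.prod_mul_distrib]
    ring
  rw [← hM, ← Matrix.det_transpose, Matrix.det_apply']
  simp only [Matrix.transpose_apply, hent, Polynomial.eval_finsetSum, Finset.sum_mul]
  rw [Finset.sum_comm]
  refine Finset.sum_congr rfl fun σ _ => ?_
  rw [Finset.sum_eq_single (T σ)]
  · simp [mul_assoc]
  · intro S _ hS
    rw [if_neg (Ne.symm hS)]
    simp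
  · simp

/-- The minor of `1 - A` belonging to the image of an injective map `φ`. -/
lemma det_one_sub_image {α : Type*} [DecidableEq α] (A : α → α → ℂ) (φ : K → α)
    (hφ : Function.Injective φ) :
    Matrix.det (1 - Matrix.of fun i j : (Finset.univ.image φ : Finset α) => A i j) =
      Matrix.det (1 - Matrix.of fun i j : K => A (φ i) (φ j)) := by
  let e : K ≃ (Finset.univ.image φ : Finset α) := Equiv.ofBijective
    (fun k => ⟨φ k, Finset.mem_image_of_mem _ (Finset.mem_univ k)⟩)
    ⟨fun a b hab => hφ (Subtype.ext_iff.mp hab), fun ⟨x, hx⟩ => by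
      obtain ⟨k, -, rfl⟩ := Finset.mem_image.mp hx
      exact ⟨k, rfl⟩⟩
  rw [← Matrix.det_submatrix_equiv_self e]
  congr 1
  ext i j
  simp only [Matrix.submatrix_apply, Matrix.sub_apply, Matrix.of_apply, Matrix.one_apply,
    e.injective.eq_iff]
  rfl

end Schur

/-- The shape of the edge operator of a graph which is the union of a finite part `F` and finitely
many cusps: the `i`-th cusp consists of the ascending edges `e i n` and the descending edges
`f i n`, a path which enters it through `e i 0` has to ascend, to turn once and to descend until
it leaves it through `f i 0`. The edges `e i n` and `f i n` are reverse to each other, and the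
terminus of `e i n`, at which the path turns or from which it descends along `f i n`, has valency
`q i n + 1`. -/
structure CuspMatrix {α : Type*} (T : α → α → ℂ) {J : Type*} (F : Finset α) (e f : J → ℕ → α)
    (q : J → ℕ → ℂ) : Prop where
  e_inj : ∀ {i j n m}, e i n = e j m → i = j ∧ n = m
  f_inj : ∀ {i j n m}, f i n = f j m → i = j ∧ n = m
  e_ne_f : ∀ i j n m, e i n ≠ f j m
  e_notMem : ∀ i n, e i n ∉ F
  f_notMem : ∀ i n, f i n ∉ F
  cover : ∀ x, x ∈ F ∨ (∃ i n, x = e i n) ∨ ∃ i n, x = f i n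
  T_ee : ∀ i n, T (e i n) (e i (n + 1)) = 1
  T_ef : ∀ i n, T (e i n) (f i n) = q i n - 1
  T_ff : ∀ i n, T (f i (n + 1)) (f i n) = q i n
  of_e : ∀ i n y, T (e i n) y ≠ 0 → y = e i (n + 1) ∨ y = f i n
  of_f : ∀ i n y, T (f i (n + 1)) y ≠ 0 → y = f i n
  of_f_zero : ∀ i y, T (f i 0) y ≠ 0 → y ∈ F
  of_mem : ∀ x ∈ F, ∀ y, T x y ≠ 0 → y ∈ F ∨ ∃ i, y = e i 0

namespace CuspMatrix

variable {α : Type*} {T : α → α → ℂ} {J : Type*} {F : Finset α} {e f : J → ℕ → α} {q : J → ℕ → ℂ}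

/-- A rank function for the edges of the cusps: it increases from an edge to the next one. -/
lemma exists_rank (H : CuspMatrix T F e f q) :
    ∃ h : α → ℚ, (∀ i n, h (e i n) = -1 / (n + 1)) ∧ ∀ i n, h (f i n) = 1 / (n + 1) := by
  classical
  refine ⟨fun x => if hx : ∃ p : J × ℕ, x = e p.1 p.2 then -1 / (hx.choose.2 + 1) else
    if hx : ∃ p : J × ℕ, x = f p.1 p.2 then 1 / (hx.choose.2 + 1) else 0, fun i n => ?_,
    fun i n => ?_⟩
  · have hx : ∃ p : J × ℕ, e i n = e p.1 p.2 := ⟨(i, n), rfl⟩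
    simp only [dif_pos hx]
    rw [← (H.e_inj hx.choose_spec).2]
  · have hx : ∃ p : J × ℕ, f i n = f p.1 p.2 := ⟨(i, n), rfl⟩
    have hx' : ¬ ∃ p : J × ℕ, f i n = e p.1 p.2 := by
      rintro ⟨p, hp⟩
      exact H.e_ne_f _ _ _ _ hp.symm
    simp only [dif_neg hx', dif_pos hx]
    rw [← (H.f_inj hx.choose_spec).2]

lemma rank_lt (H : CuspMatrix T F e f q) {h : α → ℚ} (he : ∀ i n, h (e i n) = -1 / (n + 1))
    (hf : ∀ i n, h (f i n) = 1 / (n + 1)) (x y : α) (hx : x ∉ F) (hy : y ∉ F) (hT : T x y ≠ 0) :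
    h x < h y := by
  rcases H.cover x with hx' | ⟨i, n, rfl⟩ | ⟨i, n, rfl⟩
  · exact absurd hx' hx
  · rcases H.of_e i n y hT with rfl | rfl
    · rw [he, he, neg_div, neg_div, neg_lt_neg_iff]
      push_cast
      exact one_div_lt_one_div_of_lt (by positivity) (by linarith)
    · rw [he, hf, neg_div]
      have : (0 : ℚ) < 1 / (n + 1) := by positivity
      linarith
  · rcases n with _ | n
    · exact absurd (H.of_f_zero i y hT) hy
    · obtain rfl := H.of_f i n y hT
      rw [hf, hf]
      push_cast
      exact one_div_lt_one_div_of_lt (by positivity) (by linarith)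

lemma sum_norm_le_of_support (T : α → α → ℂ) (x : α) (E : Finset α)
    (hE : ∀ y, T x y ≠ 0 → y ∈ E) (s : Finset α) : ∑ y ∈ s, ‖T x y‖ ≤ ∑ y ∈ E, ‖T x y‖ := by
  classical
  calc ∑ y ∈ s, ‖T x y‖ = ∑ y ∈ s.filter (· ∈ E), ‖T x y‖ := by
        refine (Finset.sum_filter_of_ne fun y _ hy => hE y ?_).symm
        simpa using hy
    _ ≤ ∑ y ∈ E, ‖T x y‖ := by
        refine Finset.sum_le_sum_of_subset_of_nonneg (fun y hy => ?_) fun _ _ _ => norm_nonneg _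
        exact (Finset.mem_filter.mp hy).2

/-- The operator of a graph with cusps of bounded valency has bounded row sums. -/
lemma exists_row_bound [Finite J] (H : CuspMatrix T F e f q) {Q : ℝ} (hQ : ∀ i n, ‖q i n‖ ≤ Q) :
    ∃ C : ℝ, 0 < C ∧ ∀ x (s : Finset α), ∑ y ∈ s, ‖T x y‖ ≤ C := by
  classical
  cases nonempty_fintype J
  let E : Finset α := F ∪ Finset.univ.image fun i => e i 0
  -- The rows of edges inside the cusps are bounded by `2 + |Q|`, the two sums bound the rows of the
  -- edges of the finite part and of the edges which leave a cusp.
  refine ⟨2 + |Q| + ∑ x ∈ F, ∑ y ∈ E, ‖T x y‖ + ∑ i, ∑ y ∈ F, ‖T (f i 0) y‖, by positivity,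
    fun x s => ?_⟩
  have hS : 0 ≤ ∑ x ∈ F, ∑ y ∈ E, ‖T x y‖ := by positivity
  have hS' : 0 ≤ ∑ i, ∑ y ∈ F, ‖T (f i 0) y‖ := by positivity
  have hQ' : ∀ i n, ‖q i n‖ ≤ |Q| := fun i n => (hQ i n).trans (le_abs_self Q)
  rcases H.cover x with hx | ⟨i, n, rfl⟩ | ⟨i, n, rfl⟩
  · have h1 := sum_norm_le_of_support T x E (fun y hy => by
      rcases H.of_mem x hx y hy with h | ⟨i, rfl⟩
      · exact Finset.mem_union_left _ h
      · exact Finset.mem_union_right _ (Finset.mem_image_of_mem _ (Finset.mem_univ i))) s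
    have h2 := Finset.single_le_sum (f := fun x => ∑ y ∈ E, ‖T x y‖)
      (fun _ _ => Finset.sum_nonneg fun _ _ => norm_nonneg _) hx
    linarith [abs_nonneg Q]
  · have h1 := sum_norm_le_of_support T (e i n) {e i (n + 1), f i n} (fun y hy => by
      simpa using H.of_e i n y hy) s
    rw [Finset.sum_pair (H.e_ne_f _ _ _ _), H.T_ee, H.T_ef, norm_one] at h1
    have h2 := norm_sub_le (q i n) 1
    rw [norm_one] at h2
    linarith [hQ' i n]
  · rcases n with _ | n
    · have h1 := sum_norm_le_of_support T (f i 0) F (H.of_f_zero i) s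
      have h2 := Finset.single_le_sum (f := fun i => ∑ y ∈ F, ‖T (f i 0) y‖)
        (fun _ _ => Finset.sum_nonneg fun _ _ => norm_nonneg _) (Finset.mem_univ i)
      linarith [abs_nonneg Q]
    · have h1 := sum_norm_le_of_support T (f i (n + 1)) {f i n} (fun y hy => by
        simpa using H.of_f i n y hy) s
      rw [Finset.sum_singleton, H.T_ff] at h1
      linarith [hQ' i n]

/-- All closed paths meet the finite part, as a path which stays in a cusp has increasing rank. -/
theorem exists_hasFewCycles [Finite J] (H : CuspMatrix T F e f q) {Q : ℝ}
    (hQ : ∀ i n, ‖q i n‖ ≤ Q) : ∃ (C : ℝ) (h : α → ℚ), 0 < C ∧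
      ∀ u : ℂ, HasFewCycles (fun i j => u * T i j) (‖u‖ * C) F h := by
  obtain ⟨C, hC, hrow⟩ := H.exists_row_bound hQ
  obtain ⟨h, he, hf⟩ := H.exists_rank
  refine ⟨C, h, hC, fun u => ⟨fun i s => ?_, fun i j hi hj hne => ?_⟩⟩
  · simp only [norm_mul, ← Finset.mul_sum]
    exact mul_le_mul_of_nonneg_left (hrow i s) (norm_nonneg _)
  · exact H.rank_lt he hf i j hi hj (right_ne_zero_of_mul hne)

/-- The finite part together with the first `L` levels of all cusps. -/
def level (F : Finset α) (e f : J → ℕ → α) (L : ℕ) :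
    F ⊕ ((J × Fin L) ⊕ (J × Fin L)) → α :=
  Sum.elim Subtype.val (Sum.elim (fun p => e p.1 p.2) fun p => f p.1 p.2)

lemma level_injective (H : CuspMatrix T F e f q) (L : ℕ) :
    Function.Injective (level F e f L) := by
  rintro (x | ⟨i, n⟩ | ⟨i, n⟩) (y | ⟨j, m⟩ | ⟨j, m⟩) hxy <;>
    simp only [level, Sum.elim_inl, Sum.elim_inr] at hxy
  · rw [Subtype.ext hxy]
  · exact absurd (hxy ▸ x.2) (H.e_notMem _ _)
  · exact absurd (hxy ▸ x.2) (H.f_notMem _ _)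
  · exact absurd (hxy ▸ y.2) (H.e_notMem _ _)
  · obtain ⟨rfl, h⟩ := H.e_inj hxy
    rw [Fin.ext h]
  · exact absurd hxy (H.e_ne_f _ _ _ _)
  · exact absurd (hxy ▸ y.2) (H.f_notMem _ _)
  · exact absurd hxy.symm (H.e_ne_f _ _ _ _)
  · obtain ⟨rfl, h⟩ := H.f_inj hxy
    rw [Fin.ext h]

lemma tendsto_level [DecidableEq α] [Fintype J] (H : CuspMatrix T F e f q) :
    Tendsto (fun L => (Finset.univ.image (level F e f L) : Finset α)) atTop atTop := by
  refine tendsto_atTop_finset_of_monotone (fun L L' hL x hx => ?_) fun x => ?_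
  · obtain ⟨k, -, rfl⟩ := Finset.mem_image.mp hx
    refine Finset.mem_image.mpr ⟨Sum.map id (Sum.map (Prod.map id (Fin.castLE hL))
      (Prod.map id (Fin.castLE hL))) k, Finset.mem_univ _, ?_⟩
    rcases k with y | ⟨i, n⟩ | ⟨i, n⟩ <;> rfl
  · rcases H.cover x with hx | ⟨i, n, rfl⟩ | ⟨i, n, rfl⟩
    · exact ⟨0, Finset.mem_image.mpr ⟨Sum.inl ⟨x, hx⟩, Finset.mem_univ _, rfl⟩⟩
    · exact ⟨n + 1, Finset.mem_image.mpr
        ⟨Sum.inr (Sum.inl (i, Fin.last n)), Finset.mem_univ _, rfl⟩⟩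
    · exact ⟨n + 1, Finset.mem_image.mpr
        ⟨Sum.inr (Sum.inr (i, Fin.last n)), Finset.mem_univ _, rfl⟩⟩

/-! The following lemmas compute the products of the rows of `T` with vectors that are supported on
the ascending or on the descending edges of the first `L` levels. -/

lemma sum_e_e [Fintype J] (H : CuspMatrix T F e f q) {L : ℕ} (i : J) (n : ℕ) (g : J × Fin L → ℂ) :
    ∑ p : J × Fin L, T (e i n) (e p.1 p.2) * g p =
      if h : n + 1 < L then g (i, ⟨n + 1, h⟩) else 0 := by
  have hz : ∀ p : J × Fin L, T (e i n) (e p.1 p.2) ≠ 0 → p.1 = i ∧ (p.2 : ℕ) = n + 1 := by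
    intro p hp
    rcases H.of_e i n _ hp with h | h
    · exact H.e_inj h
    · exact absurd h (H.e_ne_f _ _ _ _)
  split_ifs with h
  · rw [Finset.sum_eq_single (i, ⟨n + 1, h⟩)]
    · simp [H.T_ee]
    · intro p _ hp
      by_contra hne
      obtain ⟨h1, h2⟩ := hz p (left_ne_zero_of_mul hne)
      exact hp (Prod.ext h1 (Fin.ext h2))
    · simp
  · refine Finset.sum_eq_zero fun p _ => ?_
    by_contra hne
    obtain ⟨-, h2⟩ := hz p (left_ne_zero_of_mul hne)
    exact h (h2 ▸ p.2.2)

lemma sum_e_f [Fintype J] (H : CuspMatrix T F e f q) {L : ℕ} (i : J) (n : Fin L)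
    (g : J × Fin L → ℂ) :
    ∑ p : J × Fin L, T (e i n) (f p.1 p.2) * g p = (q i n - 1) * g (i, n) := by
  rw [Finset.sum_eq_single (i, n), H.T_ef]
  · intro p _ hp
    by_contra hne
    rcases H.of_e i n _ (left_ne_zero_of_mul hne) with h | h
    · exact H.e_ne_f _ _ _ _ h.symm
    · obtain ⟨h1, h2⟩ := H.f_inj h
      exact hp (Prod.ext h1 (Fin.ext h2))
  · simp

lemma sum_f_e [Fintype J] (H : CuspMatrix T F e f q) {L : ℕ} (i : J) (n : ℕ) (g : J × Fin L → ℂ) :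
    ∑ p : J × Fin L, T (f i n) (e p.1 p.2) * g p = 0 := by
  refine Finset.sum_eq_zero fun p _ => ?_
  by_contra hne
  rcases n with _ | n
  · exact H.e_notMem _ _ (H.of_f_zero i _ (left_ne_zero_of_mul hne))
  · exact H.e_ne_f _ _ _ _ (H.of_f i n _ (left_ne_zero_of_mul hne))

lemma sum_f_f_zero [Fintype J] (H : CuspMatrix T F e f q) {L : ℕ} (i : J) (g : J × Fin L → ℂ) :
    ∑ p : J × Fin L, T (f i 0) (f p.1 p.2) * g p = 0 := by
  refine Finset.sum_eq_zero fun p _ => ?_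
  by_contra hne
  exact H.f_notMem _ _ (H.of_f_zero i _ (left_ne_zero_of_mul hne))

lemma sum_f_f_succ [Fintype J] (H : CuspMatrix T F e f q) {L : ℕ} (i : J) (n : ℕ) (hn : n < L)
    (g : J × Fin L → ℂ) :
    ∑ p : J × Fin L, T (f i (n + 1)) (f p.1 p.2) * g p = q i n * g (i, ⟨n, hn⟩) := by
  rw [Finset.sum_eq_single (i, ⟨n, hn⟩), H.T_ff]
  · intro p _ hp
    by_contra hne
    obtain ⟨h1, h2⟩ := H.f_inj (H.of_f i n _ (left_ne_zero_of_mul hne))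
    exact hp (Prod.ext h1 (Fin.ext h2))
  · simp

lemma sum_mem_e [Fintype J] (H : CuspMatrix T F e f q) {L : ℕ} (x : α) (hx : x ∈ F)
    (g : J × Fin (L + 1) → ℂ) :
    ∑ p : J × Fin (L + 1), T x (e p.1 p.2) * g p = ∑ i, T x (e i 0) * g (i, 0) := by
  rw [Fintype.sum_prod_type]
  refine Finset.sum_congr rfl fun i _ => ?_
  rw [Finset.sum_eq_single 0]
  · rfl
  · intro n _ hn
    by_contra hne
    rcases H.of_mem x hx _ (left_ne_zero_of_mul hne) with h | ⟨j, h⟩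
    · exact H.e_notMem _ _ h
    · exact hn (Fin.ext (H.e_inj h).2)
  · simp

lemma sum_mem_f [Fintype J] (H : CuspMatrix T F e f q) {L : ℕ} (x : α) (hx : x ∈ F)
    (g : J × Fin L → ℂ) :
    ∑ p : J × Fin L, T x (f p.1 p.2) * g p = 0 := by
  refine Finset.sum_eq_zero fun p _ => ?_
  by_contra hne
  rcases H.of_mem x hx _ (left_ne_zero_of_mul hne) with h | ⟨j, h⟩
  · exact H.f_notMem _ _ h
  · exact H.e_ne_f _ _ _ _ h.symm

open Classical in
/-- Elimination of the first `L + 1` levels of all cusps. The sum over `j` is, up to sign, the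
weight of the paths from `e i 0` to `f i 0` inside the cusp, sorted by the level `j` at which they
turn. -/
lemma det_level [Fintype J] (H : CuspMatrix T F e f q) (u : ℂ) (L : ℕ) :
    Matrix.det (1 - Matrix.of fun k l => u * T (level F e f (L + 1) k) (level F e f (L + 1) l)) =
      Matrix.det (Matrix.of fun x y : F => (1 : Matrix F F ℂ) x y - u * T x y +
        ∑ i, (u * T x (e i 0)) * (∑ j ∈ Finset.range (L + 1), (∏ l ∈ Finset.range j, q i l) *
          (1 - q i j) * u ^ (2 * j + 1)) * (u * T (f i 0) y)) := by
  let φ := level F e f (L + 1)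
  -- The products `P i n * u ^ n` are the weights of the descending paths from `f i n` to `f i 0`,
  -- and `-Z i n` is the weight of the paths from `e i n` to `f i 0`.
  let P : J → ℕ → ℂ := fun i n => ∏ l ∈ Finset.range n, q i l
  let Z : J → ℕ → ℂ := fun i n =>
    ∑ j ∈ Finset.Ico n (L + 1), u ^ (j - n) * (u * (1 - q i j) * (P i j * u ^ j))
  have hZ : ∀ i n, n < L + 1 → Z i n = u * Z i (n + 1) + u * (1 - q i n) * (P i n * u ^ n) := by
    intro i n hn
    simp only [Z]
    rw [Finset.sum_eq_sum_Ico_succ_bot hn, Finset.mul_sum, Nat.sub_self, pow_zero, one_mul,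
      add_comm]
    congr 1
    refine Finset.sum_congr rfl fun j hj => ?_
    have : j - n = (j - (n + 1)) + 1 := by have := (Finset.mem_Ico.mp hj).1; omega
    rw [this, pow_succ']
    ring
  have hZtop : ∀ i, Z i (L + 1) = 0 := fun i => by simp [Z]
  let X : Matrix ((J × Fin (L + 1)) ⊕ (J × Fin (L + 1))) F ℂ := Matrix.of fun k y =>
    Sum.elim (fun p : J × Fin (L + 1) => Z p.1 p.2 * (u * T (f p.1 0) y))
      (fun p : J × Fin (L + 1) => -(P p.1 p.2 * u ^ (p.2 : ℕ)) * (u * T (f p.1 0) y)) k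
  have hblock : (1 - Matrix.of fun k l => u * T (φ k) (φ l)) = Matrix.fromBlocks
      (1 - Matrix.of fun x y : F => u * T x y)
      (-Matrix.of fun (x : F) k => u * T x (φ (Sum.inr k)))
      (-Matrix.of fun k (y : F) => u * T (φ (Sum.inr k)) y)
      (1 - Matrix.of fun k l => u * T (φ (Sum.inr k)) (φ (Sum.inr l))) := by
    ext (k | k) (l | l)
    · simp [φ, level, Matrix.one_apply]
    · simp [φ, level]
    · simp [φ, level]
    · simp [φ, level, Matrix.one_apply]
  change Matrix.det (1 - Matrix.of fun k l => u * T (φ k) (φ l)) = _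
  rw [hblock, det_fromBlocks_of_mul_eq _ _ _ _ X]
  · congr 1
    ext x y
    rw [Matrix.sub_apply, Matrix.sub_apply, Matrix.neg_mul, Matrix.neg_apply, sub_neg_eq_add,
      Matrix.mul_apply, Fintype.sum_sum_type]
    have h1 := H.sum_mem_e (L := L) x x.2 fun p => Z p.1 p.2 * (u * T (f p.1 0) y)
    have h2 := H.sum_mem_f (L := L + 1) x x.2
      fun p => -(P p.1 p.2 * u ^ (p.2 : ℕ)) * (u * T (f p.1 0) y)
    simp only [Matrix.of_apply, X, φ, level, Sum.elim_inl, Sum.elim_inr, mul_assoc u,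
      ← Finset.mul_sum]
    simp only [mul_assoc] at h1 h2 ⊢
    rw [h1, h2, mul_zero, add_zero]
    congr 1
    congr 1
    refine Finset.sum_congr rfl fun i _ => ?_
    have : Z i ((0 : Fin (L + 1)) : ℕ) = ∑ j ∈ Finset.range (L + 1), P i j * ((1 - q i j) *
        u ^ (2 * j + 1)) := by
      simp only [Z, Fin.val_zero, Finset.range_eq_Ico, Nat.sub_zero]
      refine Finset.sum_congr rfl fun j _ => ?_
      ring
    rw [this]
  · obtain ⟨h, he, hf⟩ := H.exists_rank
    refine det_one_sub_of_rank _ (fun k => h (φ (Sum.inr k))) fun k l hkl => ?_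
    have hmem : ∀ k, φ (Sum.inr k) ∉ F := by
      rintro (p | p)
      · exact H.e_notMem _ _
      · exact H.f_notMem _ _
    exact H.rank_lt he hf _ _ (hmem k) (hmem l) (right_ne_zero_of_mul hkl)
  · ext k y
    rw [Matrix.sub_mul, Matrix.one_mul, Matrix.sub_apply, Matrix.mul_apply, Fintype.sum_sum_type]
    rcases k with ⟨i, n⟩ | ⟨i, n⟩
    · have h1 := H.sum_e_e (L := L + 1) i n fun p => Z p.1 p.2 * (u * T (f p.1 0) y)
      have h2 := H.sum_e_f (L := L + 1) i n
        fun p => -(P p.1 p.2 * u ^ (p.2 : ℕ)) * (u * T (f p.1 0) y)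
      have h0 : T (e i n) y = 0 := by
        by_contra hne
        rcases H.of_e i n y hne with h | h
        · exact H.e_notMem _ _ (h ▸ y.2)
        · exact H.f_notMem _ _ (h ▸ y.2)
      simp only [Matrix.of_apply, Matrix.neg_apply, X, φ, level, Sum.elim_inl, Sum.elim_inr,
        mul_assoc u, ← Finset.mul_sum]
      rw [h1, h2, h0, hZ i n n.2]
      have h3 : (if h : (n : ℕ) + 1 < L + 1 then Z i ((⟨n + 1, h⟩ : Fin (L + 1)) : ℕ) *
          (u * T (f i 0) y) else 0) = Z i (n + 1) * (u * T (f i 0) y) := by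
        split_ifs with h
        · rfl
        · have : (n : ℕ) + 1 = L + 1 := by have := n.2; omega
          rw [this, hZtop, zero_mul]
      simp only [h3]
      ring
    · have h1 := H.sum_f_e (L := L + 1) i n fun p => Z p.1 p.2 * (u * T (f p.1 0) y)
      simp only [Matrix.of_apply, Matrix.neg_apply, X, φ, level, Sum.elim_inl, Sum.elim_inr,
        mul_assoc u, ← Finset.mul_sum]
      rw [h1]
      obtain ⟨n, hn⟩ := n
      rcases n with _ | n
      · have h2 := H.sum_f_f_zero (L := L + 1) i
          fun p => -(P p.1 p.2 * u ^ (p.2 : ℕ)) * (u * T (f p.1 0) y)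
        simp only [h2, P]
        simp
      · have h2 := H.sum_f_f_succ (L := L + 1) i n (by omega)
          fun p => -(P p.1 p.2 * u ^ (p.2 : ℕ)) * (u * T (f p.1 0) y)
        have h0 : T (f i (n + 1)) y = 0 := by
          by_contra hne
          exact H.f_notMem _ _ (H.of_f i n y hne ▸ y.2)
        simp only [h2, h0, P, Finset.prod_range_succ]
        ring

open Classical in
/-- The limit of the finite minors is a multiaffine function of the contributions of the cusps: it
is the limit along the exhaustion by the sets `level`, for which the cusps can be eliminated. -/
theorem exists_polynomial [Fintype J] (H : CuspMatrix T F e f q) :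
    ∃ p : Finset J → Polynomial ℂ, ∀ (u d : ℂ) (D : J → ℂ),
      Tendsto (fun E : Finset α =>
        Matrix.det (1 - Matrix.of fun i j : E => u * T i j)) atTop (𝓝 d) →
      (∀ i, HasSum (fun j => (∏ l ∈ Finset.range j, q i l) * (1 - q i j) * u ^ (2 * j + 1))
        (D i)) →
      d = ∑ S, (p S).eval u * ∏ i ∈ S, D i := by
  classical
  obtain ⟨p, hp⟩ := exists_polynomial_det_perturbation (K := F) (J := J)
    (Matrix.of fun x y =>
      Polynomial.C ((1 : Matrix F F ℂ) x y) - Polynomial.X * Polynomial.C (T x y))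
    (fun x i => Polynomial.X * Polynomial.C (T x (e i 0)))
    (fun i y => Polynomial.X * Polynomial.C (T (f i 0) y))
  refine ⟨p, fun u d D hd hD => ?_⟩
  rw [← hp u D]
  have h1 := (hd.comp H.tendsto_level).comp (tendsto_add_atTop_nat 1)
  refine tendsto_nhds_unique h1 ?_
  have h2 : ∀ L : ℕ, ((fun E : Finset α => Matrix.det (1 - Matrix.of fun i j : E => u * T i j)) ∘
      (fun L => (Finset.univ.image (level F e f L) : Finset α)) ∘ fun L => L + 1) L =
      Matrix.det (Matrix.of fun x y : F => (1 : Matrix F F ℂ) x y - u * T x y +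
        ∑ i, (u * T x (e i 0)) * (∑ j ∈ Finset.range (L + 1), (∏ l ∈ Finset.range j, q i l) *
          (1 - q i j) * u ^ (2 * j + 1)) * (u * T (f i 0) y)) := by
    intro L
    rw [← H.det_level u L]
    exact det_one_sub_image (fun i j => u * T i j) _ (H.level_injective (L + 1))
  refine Tendsto.congr (fun L => (h2 L).symm) ?_
  refine ((continuous_id.matrix_det).tendsto _).comp ?_
  refine tendsto_pi_nhds.mpr fun x => tendsto_pi_nhds.mpr fun y => ?_
  simp only [Matrix.of_apply, Polynomial.eval_sub, Polynomial.eval_mul, Polynomial.eval_C,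
    Polynomial.eval_X]
  refine tendsto_const_nhds.add (tendsto_finsetSum _ fun i _ => ?_)
  refine Tendsto.mul_const _ (Tendsto.const_mul _ ?_)
  exact (hD i).tendsto_sum_nat.comp (tendsto_add_atTop_nat 1)

end CuspMatrix

/-! ### Rays in a tree and the parent map of an end -/

section Rays

variable {V : Type*} {Y : SimpleGraph V}

/-- In a tree, a vertex other than `z` has only one neighbor which is closer to `z`. -/
lemma closer_neighbor_unique (hY : Y.IsTree) {z x y y' : V} (h : Y.Adj y x) (h' : Y.Adj y' x)
    (hd : Y.dist z x = Y.dist z y + 1) (hd' : Y.dist z x = Y.dist z y' + 1) : y = y' := by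
  obtain ⟨p, hp⟩ := hY.connected.exists_walk_length_eq_dist z y
  obtain ⟨p', hp'⟩ := hY.connected.exists_walk_length_eq_dist z y'
  have h1 : (p.concat h).IsPath :=
    SimpleGraph.Walk.isPath_of_length_eq_dist _ (by rw [SimpleGraph.Walk.length_concat]; omega)
  have h2 : (p'.concat h').IsPath :=
    SimpleGraph.Walk.isPath_of_length_eq_dist _ (by rw [SimpleGraph.Walk.length_concat]; omega)
  have := (hY.existsUnique_path z x).unique h1 h2
  have h3 := congrArg SimpleGraph.Walk.penultimate this
  simpa using h3

/-- The ray obtained by deleting the first `k` edges of a ray. -/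
def Ray.drop (s : Ray Y) (k : ℕ) : Ray Y where
  vert n := s.vert (n + k)
  adj n := by rw [show n + 1 + k = n + k + 1 by ring]; exact s.adj _
  reduced n := by rw [show n + 2 + k = n + k + 2 by ring]; exact s.reduced _

/-- The ray obtained by putting a vertex in front of a ray. -/
def Ray.cons (x : V) (s : Ray Y) (hadj : Y.Adj x (s.vert 0)) (hne : x ≠ s.vert 1) : Ray Y where
  vert n := Nat.casesOn n x s.vert
  adj n := by cases n with
    | zero => exact hadj
    | succ n => exact s.adj n
  reduced n := by cases n with
    | zero => exact hne
    | succ n => exact s.reduced n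

lemma toEnd_eq_iff {r s : Ray Y} :
    r.toEnd = s.toEnd ↔ ∃ a b : ℕ, ∀ n, r.vert (a + n) = s.vert (b + n) :=
  Quotient.eq (r := raySetoid Y)

lemma Ray.toEnd_drop (s : Ray Y) (k : ℕ) : (s.drop k).toEnd = s.toEnd :=
  toEnd_eq_iff.mpr ⟨0, k, fun n => by simp [Ray.drop, add_comm]⟩

lemma Ray.toEnd_cons (x : V) (s : Ray Y) (hadj : Y.Adj x (s.vert 0)) (hne : x ≠ s.vert 1) :
    (s.cons x hadj hne).toEnd = s.toEnd :=
  toEnd_eq_iff.mpr ⟨1, 0, fun n => by rw [add_comm 1 n, zero_add]; rfl⟩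

lemma Ray.dist_vert (hY : Y.IsTree) (s : Ray Y) (n : ℕ) : Y.dist (s.vert 0) (s.vert n) = n := by
  suffices Y.dist (s.vert 0) (s.vert n) = n ∧ Y.dist (s.vert 0) (s.vert (n + 1)) = n + 1 from this.1
  induction n with
  | zero => exact ⟨SimpleGraph.dist_self, SimpleGraph.dist_eq_one_iff_adj.mpr (s.adj 0)⟩
  | succ n ih =>
    refine ⟨ih.2, ?_⟩
    rcases hY.dist_eq_dist_add_one_of_adj (s.vert 0) (s.adj (n + 1)) with h | h
    · exact absurd (closer_neighbor_unique hY (s.adj n) (s.adj (n + 1)).symm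
        (by rw [ih.1, ih.2]) h) (s.reduced n)
    · rw [h, ih.2]

lemma Ray.vert_injective (hY : Y.IsTree) (s : Ray Y) : Function.Injective s.vert := by
  intro i j hij
  wlog h : i ≤ j generalizing i j
  · exact (this hij.symm (by omega)).symm
  obtain ⟨d, rfl⟩ := Nat.exists_eq_add_of_le h
  have := (s.drop i).dist_vert hY d
  simp only [Ray.drop, zero_add] at this
  rw [add_comm d i, ← hij, SimpleGraph.dist_self] at this
  omega

/-- There is only one ray from a given vertex to a given end. -/
lemma Ray.vert_eq_of_toEnd_eq (hY : Y.IsTree) {s t : Ray Y} (h0 : s.vert 0 = t.vert 0)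
    (h : s.toEnd = t.toEnd) (n : ℕ) : s.vert n = t.vert n := by
  obtain ⟨a, b, hab⟩ := toEnd_eq_iff.mp h
  obtain rfl : a = b := by
    have h1 := s.dist_vert hY a
    have h2 := t.dist_vert hY b
    have h3 := hab 0
    simp only [add_zero] at h3
    rw [← h1, ← h2, h0, h3]
  have hback : ∀ k, k ≤ a → s.vert (a - k) = t.vert (a - k) := by
    intro k
    induction k with
    | zero => intro _; simpa using hab 0
    | succ k ih =>
      intro hk
      have h1 := ih (by omega)
      have h2 : a - k = (a - (k + 1)) + 1 := by omega
      rw [h2] at h1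
      refine closer_neighbor_unique hY (z := s.vert 0) (s.adj (a - (k + 1)))
        (h1 ▸ t.adj (a - (k + 1))) ?_ ?_
      · rw [s.dist_vert hY, s.dist_vert hY]
      · rw [s.dist_vert hY, h0, t.dist_vert hY]
  rcases le_total n a with hn | hn
  · have := hback (a - n) (by omega)
    rwa [Nat.sub_sub_self hn] at this
  · have := hab (n - a)
    rwa [Nat.add_sub_cancel' hn] at this

/-- A ray in `c` is carried along a walk, by deleting or adding one edge at each step. -/
lemma exists_ray (hY : Y.IsTree) (c : Boundary Y) (x : V) :
    ∃ s : Ray Y, s.toEnd = c ∧ s.vert 0 = x := by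
  induction c using Quotient.inductionOn with | _ r =>
  obtain ⟨w⟩ := hY.connected (r.vert 0) x
  suffices ∀ {y z : V} (w : Y.Walk y z), (∃ s : Ray Y, s.toEnd = r.toEnd ∧ s.vert 0 = y) →
      ∃ s : Ray Y, s.toEnd = r.toEnd ∧ s.vert 0 = z from this w ⟨r, rfl, rfl⟩
  intro y z w
  induction w with
  | nil => exact id
  | @cons y y' z h w ih =>
    rintro ⟨s, hs, hy⟩
    refine ih ?_
    by_cases h1 : y' = s.vert 1
    · exact ⟨s.drop 1, by rw [Ray.toEnd_drop, hs], h1.symm⟩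
    · exact ⟨s.cons y' (hy ▸ h.symm) h1, by rw [Ray.toEnd_cons, hs], rfl⟩

variable (hY : Y.IsTree) (c : Boundary Y)

/-- The parent of `x` with respect to the end `c`: the next vertex on the way from `x` to `c`. -/
noncomputable def parent (x : V) : V := (exists_ray hY c x).choose.vert 1

lemma Ray.vert_succ {s : Ray Y} (hs : s.toEnd = c) (n : ℕ) :
    s.vert (n + 1) = parent hY c (s.vert n) := by
  obtain ⟨h1, h2⟩ := (exists_ray hY c (s.vert n)).choose_spec
  have := Ray.vert_eq_of_toEnd_eq hY (s := s.drop n)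
    (t := (exists_ray hY c (s.vert n)).choose) (by rw [h2]; simp [Ray.drop])
    (by rw [Ray.toEnd_drop, hs, h1]) 1
  rw [add_comm]
  exact this

lemma Ray.vert_eq_iterate {s : Ray Y} (hs : s.toEnd = c) (n : ℕ) :
    s.vert n = (parent hY c)^[n] (s.vert 0) := by
  induction n with
  | zero => rfl
  | succ n ih => rw [Function.iterate_succ_apply', ← ih, Ray.vert_succ hY c hs]

lemma adj_parent (x : V) : Y.Adj x (parent hY c x) := by
  obtain ⟨s, hs, rfl⟩ := exists_ray hY c x
  rw [← Ray.vert_succ hY c hs]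
  exact s.adj 0

lemma parent_of_adj {x y : V} (h : Y.Adj x y) (hne : y ≠ parent hY c x) : parent hY c y = x := by
  obtain ⟨s, hs, rfl⟩ := exists_ray hY c x
  rw [← Ray.vert_succ hY c hs] at hne
  exact (Ray.vert_succ hY c (s := s.cons y h.symm hne) (by rw [Ray.toEnd_cons, hs]) 0).symm

lemma exists_iterate_parent_eq (x y : V) :
    ∃ a b : ℕ, (parent hY c)^[a] x = (parent hY c)^[b] y := by
  obtain ⟨s, hs, rfl⟩ := exists_ray hY c x
  obtain ⟨t, ht, rfl⟩ := exists_ray hY c y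
  obtain ⟨a, b, hab⟩ := toEnd_eq_iff.mp (hs.trans ht.symm)
  refine ⟨a, b, ?_⟩
  rw [← Ray.vert_eq_iterate hY c hs, ← Ray.vert_eq_iterate hY c ht]
  exact hab 0

lemma iterate_parent_injective (x : V) : Function.Injective fun n => (parent hY c)^[n] x := by
  obtain ⟨s, hs, rfl⟩ := exists_ray hY c x
  intro i j hij
  simp only [← Ray.vert_eq_iterate hY c hs] at hij
  exact s.vert_injective hY hij

/-- The height (Busemann function) of a vertex with respect to the end `c`, normalized to be `0`
at `o`. It grows by one with each step towards `c`. -/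
noncomputable def hgt (o x : V) : ℤ :=
  (exists_iterate_parent_eq hY c x o).choose_spec.choose -
    (exists_iterate_parent_eq hY c x o).choose

variable (o : V)

lemma hgt_eq {x : V} {a b : ℕ} (h : (parent hY c)^[a] x = (parent hY c)^[b] o) :
    hgt hY c o x = b - a := by
  unfold hgt
  have h' := (exists_iterate_parent_eq hY c x o).choose_spec.choose_spec
  set a' := (exists_iterate_parent_eq hY c x o).choose
  set b' := (exists_iterate_parent_eq hY c x o).choose_spec.choose
  have h1 : (parent hY c)^[a' + b] o = (parent hY c)^[a + b'] o := by
    rw [Function.iterate_add_apply, ← h, Function.iterate_add_apply _ a, ← h',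
      ← Function.iterate_add_apply, ← Function.iterate_add_apply, add_comm]
  have := iterate_parent_injective hY c o h1
  omega

lemma hgt_parent (x : V) : hgt hY c o (parent hY c x) = hgt hY c o x + 1 := by
  obtain ⟨a, b, h⟩ := exists_iterate_parent_eq hY c x o
  rw [hgt_eq hY c o h, hgt_eq hY c o (x := parent hY c x) (a := a) (b := b + 1)]
  · push_cast; ring
  · rw [Function.iterate_succ_apply', ← h, ← Function.iterate_succ_apply,
      Function.iterate_succ_apply']

lemma hgt_iterate (n : ℕ) (x : V) : hgt hY c o ((parent hY c)^[n] x) = hgt hY c o x + n := by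
  induction n with
  | zero => simp
  | succ n ih => rw [Function.iterate_succ_apply', hgt_parent, ih]; push_cast; ring

lemma hgt_eq_iff {x y : V} :
    hgt hY c o x = hgt hY c o y ↔ ∃ n, (parent hY c)^[n] x = (parent hY c)^[n] y := by
  constructor
  · intro h
    obtain ⟨a, b, hx⟩ := exists_iterate_parent_eq hY c x o
    obtain ⟨a', b', hy⟩ := exists_iterate_parent_eq hY c y o
    rw [hgt_eq hY c o hx, hgt_eq hY c o hy] at h
    refine ⟨b' + a, ?_⟩
    have : b' + a = b + a' := by omega
    rw [Function.iterate_add_apply, hx, this, Function.iterate_add_apply, hy,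
      ← Function.iterate_add_apply, ← Function.iterate_add_apply, add_comm]
  · rintro ⟨n, hn⟩
    have h1 := hgt_iterate hY c o n x
    have h2 := hgt_iterate hY c o n y
    rw [hn] at h1
    omega

/-- The horocycles are the level sets of the height. -/
lemma sameHorocycle_iff {x y : V} : SameHorocycle c x y ↔ hgt hY c o x = hgt hY c o y := by
  rw [hgt_eq_iff]
  constructor
  · rintro ⟨r, s, hr, hs, rfl, rfl, n, hn⟩
    exact ⟨n, by rw [← Ray.vert_eq_iterate hY c hr, ← Ray.vert_eq_iterate hY c hs, hn]⟩
  · rintro ⟨n, hn⟩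
    obtain ⟨r, hr, rfl⟩ := exists_ray hY c x
    obtain ⟨s, hs, rfl⟩ := exists_ray hY c y
    exact ⟨r, s, hr, hs, rfl, rfl, n, by
      rw [Ray.vert_eq_iterate hY c hr, Ray.vert_eq_iterate hY c hs, hn]⟩

lemma parent_map_of_stabP {g : Y ≃g Y} (hg : g ∈ stabP c) (x : V) :
    g (parent hY c x) = parent hY c (g x) := by
  obtain ⟨s, hs, rfl⟩ := exists_ray hY c x
  have h1 : (s.map g).toEnd = c := by
    have : Boundary.map g s.toEnd = c := by rw [hs]; exact hg
    exact this
  have h2 := Ray.vert_succ hY c h1 0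
  rw [← Ray.vert_succ hY c hs 0]
  exact h2

lemma iterate_parent_map_of_stabP {g : Y ≃g Y} (hg : g ∈ stabP c) (n : ℕ) (x : V) :
    g ((parent hY c)^[n] x) = (parent hY c)^[n] (g x) := by
  induction n with
  | zero => rfl
  | succ n ih =>
    rw [Function.iterate_succ_apply', Function.iterate_succ_apply', parent_map_of_stabP hY c hg, ih]

lemma mem_stabP_of_eventually {r : Ray Y} (hr : r.toEnd = c) {g : Y ≃g Y} {a b : ℕ}
    (h : ∀ n, g (r.vert (a + n)) = r.vert (b + n)) : g ∈ stabP c := by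
  subst hr
  exact toEnd_eq_iff.mpr ⟨a, b, h⟩

lemma hgt_map_of_stabN {g : Y ≃g Y} (hg : g ∈ stabN c) (x : V) :
    hgt hY c o (g x) = hgt hY c o x := by
  obtain ⟨hP, x₀, hx₀⟩ := hg
  have h0 : hgt hY c o (g x₀) = hgt hY c o x₀ := by
    have h1 : x₀ ∈ horocycle c x₀ := (sameHorocycle_iff hY c o).mpr rfl
    have h2 : g x₀ ∈ horocycle c x₀ := hx₀ ▸ Set.mem_image_of_mem g h1
    exact ((sameHorocycle_iff hY c o).mp h2).symm
  obtain ⟨a, b, hab⟩ := exists_iterate_parent_eq hY c x x₀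
  have h1 := hgt_iterate hY c o a x
  have h2 := hgt_iterate hY c o b x₀
  have h3 := hgt_iterate hY c o a (g x)
  have h4 := hgt_iterate hY c o b (g x₀)
  rw [← iterate_parent_map_of_stabP hY c hP] at h3 h4
  rw [hab] at h1 h3
  omega

end Rays

/-! ### Cusps of a tree lattice -/

section Cusp

variable {V : Type*} {Y : SimpleGraph V} {Γ : Type*} [Group Γ] {ρ : Γ →* (Y ≃g Y)}

lemma projV_eq_iff {x y : V} : projV ρ x = projV ρ y ↔ ∃ g : Γ, ρ g y = x :=
  Quotient.eq.trans orbit_iff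

lemma projE_eq_iff {d d' : Y.Dart} : projE ρ d = projE ρ d' ↔ ∃ g : Γ, ρ g • d' = d :=
  Quotient.eq.trans orbit_iff

lemma map_mul_apply (g h : Γ) (x : V) : ρ (g * h) x = ρ g (ρ h x) := by
  rw [map_mul]; rfl

lemma map_inv_apply_eq {g : Γ} {x y : V} (h : ρ g x = y) : ρ g⁻¹ y = x := by
  rw [← h, ← map_mul_apply, inv_mul_cancel, map_one]
  rfl

lemma finite_vertex_stabilizer (hfin : ∀ x, (Y.neighborSet x).Finite)
    (hstab : ∀ e : Y.Dart, Finite {g : Γ // ρ g • e = e}) {x y : V} (hxy : Y.Adj x y) :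
    {g : Γ | ρ g x = x}.Finite := by
  refine Set.Finite.of_finite_fibers (fun g => ρ g y) ((hfin x).subset ?_) ?_
  · rintro _ ⟨g, hg, rfl⟩
    have := (ρ g).map_rel_iff.mpr hxy
    rw [hg] at this
    exact this
  · rintro _ ⟨g₀, hg₀, rfl⟩
    have h1 : {g : Γ | ρ g • (⟨(x, y), hxy⟩ : Y.Dart) = ⟨(x, y), hxy⟩}.Finite := hstab _
    refine (h1.image fun g => g₀ * g).subset ?_
    rintro g ⟨hg, hg'⟩
    refine ⟨g₀⁻¹ * g, ?_, by simp⟩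
    refine SimpleGraph.Dart.ext _ _ (Prod.ext ?_ ?_)
    · change ρ (g₀⁻¹ * g) x = x
      rw [map_mul_apply, hg]
      exact map_inv_apply_eq hg₀
    · change ρ (g₀⁻¹ * g) y = y
      rw [map_mul_apply]
      exact map_inv_apply_eq hg'.symm

/-- The part of the cusp condition that concerns the action on a horocycle: there is a height
such that `Γ ∩ N_c` acts transitively on the vertices of that height. -/
lemma IsCusp.exists_height (hY : Y.IsTree) {c : Boundary Y} (hc : IsCusp ρ c) (o : V) :
    ∃ x₀ : V, ∀ x y, hgt hY c o x = hgt hY c o x₀ → hgt hY c o y = hgt hY c o x₀ →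
      ∃ g : Γ, ρ g ∈ stabN c ∧ ρ g x = y := by
  obtain ⟨x₀, h⟩ := hc.2
  exact ⟨x₀, fun x y hx hy => h x ((sameHorocycle_iff hY c o).mpr hx.symm) y
    ((sameHorocycle_iff hY c o).mpr hy.symm)⟩

lemma IsCusp.stabN_of_stabP {c : Boundary Y} (hc : IsCusp ρ c) {g : Γ} (hg : ρ g ∈ stabP c) :
    ρ g ∈ stabN c := (hc.1 g).mp hg

/-- A ray whose first edge leads away from the end `c` never turns back. -/
lemma Ray.parent_succ (hY : Y.IsTree) (c : Boundary Y) (s : Ray Y)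
    (h : s.vert 1 ≠ parent hY c (s.vert 0)) (j : ℕ) :
    parent hY c (s.vert (j + 1)) = s.vert j := by
  induction j with
  | zero => exact parent_of_adj hY c (s.adj 0) h
  | succ j ih =>
    refine parent_of_adj hY c (s.adj (j + 1)) fun hne => ?_
    rw [ih] at hne
    exact s.reduced j hne.symm

lemma iterate_parent_of_descending (hY : Y.IsTree) (c : Boundary Y) {s : ℕ → V} {k : ℕ}
    (h : ∀ j < k, parent hY c (s (j + 1)) = s j) (j : ℕ) (hj : j ≤ k) :
    (parent hY c)^[j] (s j) = s 0 := by
  induction j with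
  | zero => rfl
  | succ j ih => rw [Function.iterate_succ_apply, h j (by omega), ih (by omega)]

/-- If infinitely many vertices of a ray in `c` lie in one orbit, the orders of the stabilizers of
the vertices of the ray in `Γ ∩ N_c` are bounded. These stabilizers increase along the ray and their
union is `Γ ∩ N_c`, hence from some vertex on they are all of `Γ ∩ N_c`. -/
lemma exists_fixed_of_infinite_fiber (hY : Y.IsTree) (hfin : ∀ x, (Y.neighborSet x).Finite)
    (hstab : ∀ e : Y.Dart, Finite {g : Γ // ρ g • e = e}) {c : Boundary Y} {r : Ray Y}
    (hr : r.toEnd = c) {a : VX ρ} (hinf : {n | projV ρ (r.vert n) = a}.Infinite) :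
    ∃ N, ∀ g : Γ, ρ g ∈ stabN c → ∀ n, N ≤ n → ρ g (r.vert n) = r.vert n := by
  let S : ℕ → Set Γ := fun n => {g | ρ g (r.vert n) = r.vert n}
  have hS : ∀ n, (S n).Finite := fun n => finite_vertex_stabilizer hfin hstab (r.adj n)
  let G : ℕ → Set Γ := fun n => {g | ρ g ∈ stabN c ∧ ρ g (r.vert n) = r.vert n}
  have hGS : ∀ n, G n ⊆ S n := fun n g hg => hg.2
  have hGfin : ∀ n, (G n).Finite := fun n => (hS n).subset (hGS n)
  have hGmono : Monotone G := by
    refine monotone_nat_of_le_succ fun n g hg => ⟨hg.1, ?_⟩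
    rw [Ray.vert_succ hY c hr, parent_map_of_stabP hY c hg.1.1, hg.2]
  obtain ⟨n₀, hn₀⟩ := hinf.nonempty
  -- The stabilizers in `Γ` of the vertices in one orbit are conjugate.
  have hbound : ∀ n, (G n).ncard ≤ (S n₀).ncard := by
    intro n
    obtain ⟨m, hm, hnm⟩ := hinf.exists_gt n
    obtain ⟨g, hg⟩ := projV_eq_iff.mp (hm.trans (Eq.symm hn₀))
    refine (Set.ncard_le_ncard ((hGmono hnm.le).trans (hGS m)) (hS m)).trans ?_
    refine Set.ncard_le_ncard_of_injOn (fun h => g⁻¹ * h * g) ?_ ?_ (hS n₀)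
    · intro h hh
      change ρ (g⁻¹ * h * g) (r.vert n₀) = r.vert n₀
      rw [map_mul_apply, map_mul_apply, hg, hh]
      exact map_inv_apply_eq hg
    · intro h _ h' _ hhh
      simpa using hhh
  obtain ⟨n₂, hn₂⟩ : ∃ n₂, ∀ n, (G n).ncard ≤ (G n₂).ncard := by
    have hbdd : BddAbove (Set.range fun n => (G n).ncard) :=
      ⟨_, by rintro _ ⟨n, rfl⟩; exact hbound n⟩
    obtain ⟨n₂, h⟩ := Nat.sSup_mem (Set.range_nonempty fun n => (G n).ncard) hbdd
    refine ⟨n₂, fun n => ?_⟩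
    simp only at h
    rw [h]
    exact le_csSup hbdd ⟨n, rfl⟩
  refine ⟨n₂, fun g hg n hn => ?_⟩
  have h0 := hgt_map_of_stabN hY c (r.vert 0) hg (r.vert 0)
  obtain ⟨k, hk⟩ := (hgt_eq_iff hY c (r.vert 0)).mp h0
  rw [← iterate_parent_map_of_stabP hY c hg.1, ← Ray.vert_eq_iterate hY c hr] at hk
  have h1 : g ∈ G (max k n₂) := hGmono (le_max_left k n₂) ⟨hg, hk⟩
  have h2 : G n₂ = G (max k n₂) := Set.eq_of_subset_of_ncard_le (hGmono (le_max_right k n₂))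
    (hn₂ _) (hGfin _)
  rw [← h2] at h1
  exact (hGmono hn h1).2

/-- Each orbit contains only finitely many vertices of a ray which represents a cusp. Otherwise `Γ ∩
N_c` would fix all but finitely many vertices of the ray and, acting transitively on a horocycle,
leave no room for other infinite branches at them. An element of `Γ` which maps such a vertex to
another one would then either shift the ray, which is impossible as it would be in `P_c` but not in
`N_c`, or reverse it; but the product of two elements which reverse the ray shifts it. -/
theorem finite_fiber_of_isCusp (hY : Y.IsTree) (hfin : ∀ x, (Y.neighborSet x).Finite)
    (hstab : ∀ e : Y.Dart, Finite {g : Γ // ρ g • e = e}) {r : Ray Y} (hc : IsCusp ρ r.toEnd)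
    (a : VX ρ) : {n | projV ρ (r.vert n) = a}.Finite := by
  by_contra hinf
  rw [← Set.Infinite] at hinf
  obtain ⟨c, hr⟩ : ∃ c, r.toEnd = c := ⟨_, rfl⟩
  rw [hr] at hc
  obtain ⟨N, hN⟩ := exists_fixed_of_infinite_fiber hY hfin hstab hr hinf
  set o := r.vert 0 with ho
  have hv : ∀ n, hgt hY c o (r.vert n) = n := fun n => by
    rw [Ray.vert_eq_iterate hY c hr, hgt_iterate, hgt_eq hY c o (a := 0) (b := 0) rfl]
    simp
  obtain ⟨x₀, hx₀⟩ := hc.exists_height hY o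
  obtain ⟨k, b, hkb⟩ := exists_iterate_parent_eq hY c x₀ o
  have hx₀h := hgt_eq hY c o hkb
  have hx₀v : ∀ n, (parent hY c)^[n + k] x₀ = r.vert (b + n) := fun n => by
    rw [Function.iterate_add_apply, hkb, Ray.vert_eq_iterate hY c hr, add_comm b n,
      Function.iterate_add_apply]
  set M := max N b
  -- Above the height `M` only the vertices of the ray have descendants of the height of `x₀`.
  have eq_vert_of_descendant : ∀ (n : ℕ) (j : ℕ) (y : V), M ≤ n → hgt hY c o y = hgt hY c o x₀ →
      hgt hY c o ((parent hY c)^[j] y) = n → (parent hY c)^[j] y = r.vert n := by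
    intro n j y hn hy hjn
    obtain ⟨g, hg, rfl⟩ := hx₀ x₀ y rfl hy
    rw [← iterate_parent_map_of_stabP hY c hg.1]
    rw [hgt_iterate, hy, hx₀h] at hjn
    have hb : b ≤ n := (le_max_right N b).trans hn
    have hj : j = (n - b) + k := by omega
    rw [hj, hx₀v, Nat.add_sub_cancel' hb]
    exact hN g hg n ((le_max_left N b).trans hn)
  -- Above the height `M` all rays which start on the ray `r` run along it in one direction.
  have next_vert : ∀ (s : Ray Y) (m : ℕ), M < m → s.vert 0 = r.vert m →
      s.vert 1 = r.vert (m + 1) ∨ s.vert 1 = r.vert (m - 1) := by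
    intro s m hm hs
    by_cases h1 : s.vert 1 = r.vert (m + 1)
    · exact Or.inl h1
    · right
      rw [Ray.vert_succ hY c hr, ← hs] at h1
      have hdesc := s.parent_succ hY c h1
      obtain ⟨j, hj⟩ : ∃ j : ℕ, (m : ℤ) = hgt hY c o x₀ + j + 1 := by
        have hb : b ≤ M := le_max_right N b
        exact ⟨m - 1 - b + k, by rw [hx₀h]; omega⟩
      have hit : (parent hY c)^[j] (s.vert (j + 1)) = s.vert 1 :=
        iterate_parent_of_descending hY c (s := fun i => s.vert (i + 1)) (k := j)
          (fun i _ => hdesc (i + 1)) j le_rfl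
      have h1m : hgt hY c o (s.vert 1) = m - 1 := by
        have := hgt_parent hY c o (s.vert 1)
        rw [hdesc 0, hs, hv] at this
        omega
      have := eq_vert_of_descendant (m - 1) j (s.vert (j + 1)) (by omega) ?_
        (by rw [hit, h1m]; omega)
      · rw [← this, hit]
      · have h2 := hgt_iterate hY c o j (s.vert (j + 1))
        rw [hit, h1m] at h2
        omega
  have hne2 : ∀ i, r.vert i ≠ r.vert (i + 2) := r.reduced
  -- No element of `Γ` shifts the ray.
  have no_shift : ∀ (g : Γ) (n m : ℕ), M < n → M < m → ρ g (r.vert n) = r.vert m →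
      ρ g (r.vert (n + 1)) = r.vert (m + 1) → n = m := by
    intro g n m hn hm h0 h1
    have hall : ∀ j, ρ g (r.vert (n + j)) = r.vert (m + j) ∧
        ρ g (r.vert (n + j + 1)) = r.vert (m + j + 1) := by
      intro j
      induction j with
      | zero => exact ⟨h0, h1⟩
      | succ j ih =>
        refine ⟨ih.2, ?_⟩
        rcases next_vert ((r.drop (n + j + 1)).map (ρ g)) (m + j + 1) (by omega) (by
          change ρ g (r.vert (0 + (n + j + 1))) = _
          rw [zero_add]; exact ih.2) with h | h
        · change ρ g (r.vert (1 + (n + j + 1))) = _ at h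
          rw [add_comm 1] at h
          exact h
        · change ρ g (r.vert (1 + (n + j + 1))) = r.vert (m + j) at h
          rw [← ih.1, add_comm 1] at h
          exact absurd ((ρ g).injective h).symm (hne2 _)
    have hN' := hc.stabN_of_stabP (mem_stabP_of_eventually c hr fun j => (hall j).1)
    have := hgt_map_of_stabN hY c o hN' (r.vert n)
    rw [h0, hv, hv] at this
    omega
  have step : ∀ (g : Γ) (n m : ℕ), M < m → ρ g (r.vert n) = r.vert m →
      ρ g (r.vert (n + 1)) = r.vert (m + 1) ∨ ρ g (r.vert (n + 1)) = r.vert (m - 1) := by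
    intro g n m hm h0
    have := next_vert ((r.drop n).map (ρ g)) m hm (by
      change ρ g (r.vert (0 + n)) = _
      rw [zero_add]; exact h0)
    change ρ g (r.vert (1 + n)) = _ ∨ ρ g (r.vert (1 + n)) = _ at this
    rwa [add_comm 1] at this
  obtain ⟨n, hn, hMn⟩ := hinf.exists_gt M
  obtain ⟨m, hm, hnm⟩ := hinf.exists_gt n
  obtain ⟨p, hp, hmp⟩ := hinf.exists_gt m
  obtain ⟨g, hg⟩ := projV_eq_iff.mp (hm.trans (Eq.symm hn))
  obtain ⟨g', hg'⟩ := projV_eq_iff.mp (hp.trans (Eq.symm hm))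
  have e1 : ρ g (r.vert (n + 1)) = r.vert (m - 1) :=
    (step g n m (by omega) hg).resolve_left fun h =>
      absurd (no_shift g n m hMn (by omega) hg h) (by omega)
  have e2 : ρ g' (r.vert (m + 1)) = r.vert (p - 1) :=
    (step g' m p (by omega) hg').resolve_left fun h =>
      absurd (no_shift g' m p (by omega) (by omega) hg' h) (by omega)
  have hgg : ρ (g' * g) (r.vert n) = r.vert p := by rw [map_mul_apply, hg, hg']
  have e3 : ρ (g' * g) (r.vert (n + 1)) = r.vert (p - 1) :=
    (step _ n p (by omega) hgg).resolve_left fun h =>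
      absurd (no_shift _ n p hMn (by omega) hgg h) (by omega)
  rw [map_mul_apply, e1, ← e2] at e3
  have := (ρ g').injective e3
  have h2 := hne2 (m - 1)
  rw [show m - 1 + 2 = m + 1 by omega] at h2
  exact h2 this

end Cusp

/-! ### The action of the lattice far out in a cusp -/

section Branches

variable {V : Type*} {Y : SimpleGraph V} {Γ : Type*} [Group Γ] {ρ : Γ →* (Y ≃g Y)}

/-- Every reduced path that starts with the edge from `x` to `z` has less than `k` edges. Paths are
given by the first `k + 1` terms of a sequence of vertices. -/
def BranchBounded (Y : SimpleGraph V) (x z : V) (k : ℕ) : Prop :=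
  ¬ ∃ s : ℕ → V, s 0 = x ∧ s 1 = z ∧ (∀ i < k, Y.Adj (s i) (s (i + 1))) ∧
    ∀ i, i + 1 < k → s i ≠ s (i + 2)

lemma BranchBounded.mono {x z : V} {k k' : ℕ} (h : BranchBounded Y x z k) (hk : k ≤ k') :
    BranchBounded Y x z k' := by
  rintro ⟨s, h0, h1, h2, h3⟩
  exact h ⟨s, h0, h1, fun i hi => h2 i (by omega), fun i hi => h3 i (by omega)⟩

lemma BranchBounded.map {x z : V} {k : ℕ} (h : BranchBounded Y x z k) (g : Y ≃g Y) :
    BranchBounded Y (g x) (g z) k := by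
  rintro ⟨s, h0, h1, h2, h3⟩
  refine h ⟨fun i => g.symm (s i), by simp [h0], by simp [h1],
    fun i hi => g.symm.map_rel_iff.mpr (h2 i hi), fun i hi => ?_⟩
  simpa using h3 i hi

lemma exists_walk_iterate_parent (hY : Y.IsTree) (c : Boundary Y) (x : V) (i : ℕ) :
    ∃ w : Y.Walk x ((parent hY c)^[i] x), w.length = i := by
  induction i generalizing x with
  | zero => exact ⟨SimpleGraph.Walk.nil, rfl⟩
  | succ i ih =>
    obtain ⟨w, hw⟩ := ih (parent hY c x)
    exact ⟨SimpleGraph.Walk.cons (adj_parent hY c x) w, congrArg (· + 1) hw⟩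

/-- In a uniform tree the lengths of the finite branches are bounded. -/
lemma exists_uniform_branch_bound (hunif : IsUniform Y) :
    ∃ K, ∀ x z k, Y.Adj x z → BranchBounded Y x z k → BranchBounded Y x z K := by
  classical
  have hfin : Finite (MulAction.orbitRel.Quotient (Y ≃g Y) Y.Dart) := hunif.2
  cases nonempty_fintype (MulAction.orbitRel.Quotient (Y ≃g Y) Y.Dart)
  have : ∀ q : MulAction.orbitRel.Quotient (Y ≃g Y) Y.Dart, ∃ K, ∀ k,
      BranchBounded Y q.out.fst q.out.snd k → BranchBounded Y q.out.fst q.out.snd K := by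
    intro q
    by_cases h : ∃ k, BranchBounded Y q.out.fst q.out.snd k
    · obtain ⟨K, hK⟩ := h
      exact ⟨K, fun _ _ => hK⟩
    · exact ⟨0, fun k hk => absurd ⟨k, hk⟩ h⟩
  choose B hB using this
  refine ⟨Finset.univ.sup B, fun x z k hxz hk => ?_⟩
  let d : Y.Dart := ⟨(x, z), hxz⟩
  let q : MulAction.orbitRel.Quotient (Y ≃g Y) Y.Dart := Quotient.mk _ d
  obtain ⟨g, hg⟩ : ∃ g : Y ≃g Y, g • d = q.out := by
    have : (MulAction.orbitRel (Y ≃g Y) Y.Dart) q.out d := Quotient.mk_out d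
    rw [MulAction.orbitRel_apply, MulAction.mem_orbit_iff] at this
    exact this
  have h1 : q.out.fst = g x := by rw [← hg]; rfl
  have h2 : q.out.snd = g z := by rw [← hg]; rfl
  have h3 := hB q k (by rw [h1, h2]; exact hk.map g)
  have h4 := (h3.mono (Finset.le_sup (Finset.mem_univ q))).map g.symm
  rw [h1, h2] at h4
  simpa using h4

/-- Only finitely many orbits of vertices lie at bounded distance from finitely many orbits. -/
lemma finite_orbits_of_walk (hfin : ∀ x, (Y.neighborSet x).Finite) {A : Set (VX ρ)} (hA : A.Finite)
    (K : ℕ) : {a : VX ρ | ∃ x y, ∃ w : Y.Walk x y, w.length ≤ K ∧ projV ρ x ∈ A ∧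
      projV ρ y = a}.Finite := by
  induction K with
  | zero =>
    refine hA.subset ?_
    rintro _ ⟨x, y, w, hw, hx, rfl⟩
    rw [← SimpleGraph.Walk.eq_of_length_eq_zero (Nat.le_zero.mp hw)]
    exact hx
  | succ K ih =>
    refine ((ih.biUnion fun a _ => ((hfin a.out).image (projV ρ))).union hA).subset ?_
    rintro _ ⟨x, y, w, hw, hx, rfl⟩
    induction w using SimpleGraph.Walk.concatRec with
    | Hnil => exact Or.inr hx
    | @Hconcat u v w p h _ =>
      left
      rw [SimpleGraph.Walk.length_concat] at hw
      refine Set.mem_biUnion (x := projV ρ v) ⟨u, v, p, by omega, hx, rfl⟩ ?_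
      obtain ⟨g, hg⟩ := projV_eq_iff.mp (Quotient.out_eq (projV ρ v) :
        projV ρ (Quotient.out (projV ρ v)) = projV ρ v)
      refine ⟨ρ g w, ?_, projV_eq_iff.mpr ⟨g, rfl⟩⟩
      rw [← hg]
      exact (ρ g).map_rel_iff.mpr h

/-- From the `N`-th vertex on, the stabilizer in `Γ` of a vertex of the ray acts transitively on
its neighbors other than the next vertex of the ray. -/
def TransitiveFrom (ρ : Γ →* (Y ≃g Y)) (r : Ray Y) (N : ℕ) : Prop :=
  ∀ n, N ≤ n → ∀ z z', Y.Adj (r.vert n) z → z ≠ r.vert (n + 1) → Y.Adj (r.vert n) z' →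
    z' ≠ r.vert (n + 1) → ∃ g : Γ, ρ g (r.vert n) = r.vert n ∧ ρ g z = z'

/-- Since `Γ ∩ N_c` acts transitively on a horocycle, two children of a vertex of the ray are
equivalent if both have descendants on that horocycle. A child without such descendants has a leaf
of the tree below it, at a bounded distance by uniformity; this happens for finitely many vertices
of the ray only, as the leaves lie in finitely many orbits. -/
theorem exists_transitiveFrom (hY : Y.IsTree) (hfin : ∀ x, (Y.neighborSet x).Finite)
    (hunif : IsUniform Y) (hstab : ∀ e : Y.Dart, Finite {g : Γ // ρ g • e = e}) {r : Ray Y}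
    (hc : IsCusp ρ r.toEnd)
    (hleaf : {a : VX ρ | ∃ y, projV ρ y = a ∧ (Y.neighborSet y).Subsingleton}.Finite) :
    ∃ N, TransitiveFrom ρ r N := by
  have hfiber := finite_fiber_of_isCusp hY hfin hstab hc
  obtain ⟨c, hr⟩ : ∃ c, r.toEnd = c := ⟨_, rfl⟩
  rw [hr] at hc
  set o := r.vert 0 with ho
  have hv : ∀ n, hgt hY c o (r.vert n) = n := fun n => by
    rw [Ray.vert_eq_iterate hY c hr, hgt_iterate, hgt_eq hY c o (a := 0) (b := 0) rfl]
    simp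
  obtain ⟨x₀, hx₀⟩ := hc.exists_height hY o
  obtain ⟨K, hK⟩ := exists_uniform_branch_bound hunif
  -- From `n₀` on, the children of the vertices of the ray are not below the height of `x₀`.
  obtain ⟨n₀, hn₀⟩ : ∃ n₀ : ℕ, ∀ n : ℕ, n₀ ≤ n → ∃ j : ℕ, (n : ℤ) = hgt hY c o x₀ + j + 1 :=
    ⟨(hgt hY c o x₀ + 1).toNat, fun n hn => ⟨(n - (hgt hY c o x₀ + 1)).toNat, by omega⟩⟩
  -- The indices of those vertices of the ray which have a child without descendants of the height
  -- of `x₀`.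
  let Bad : Set ℕ := {n | n₀ ≤ n ∧ ∃ z, parent hY c z = r.vert n ∧
    ¬ ∃ (y : V) (j : ℕ), hgt hY c o y = hgt hY c o x₀ ∧ (parent hY c)^[j] y = z}
  have hBad : Bad.Finite := by
    have hfinO := finite_orbits_of_walk hfin hleaf (K + 1)
    refine (hfinO.biUnion fun a _ => hfiber a).subset ?_
    rintro n ⟨hn, z, hz, hno⟩
    refine Set.mem_biUnion (x := projV ρ (r.vert n)) ?_ rfl
    obtain ⟨j₀, hj₀⟩ := hn₀ n hn
    have hzh : hgt hY c o z = n - 1 := by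
      have := hgt_parent hY c o z
      rw [hz, hv] at this
      omega
    have hadj : Y.Adj (r.vert n) z := by
      rw [← hz]; exact (adj_parent hY c z).symm
    -- A reduced path starting with `z` descends, hence cannot reach the height of `x₀`.
    have hbd : BranchBounded Y (r.vert n) z (j₀ + 1) := by
      rintro ⟨s, h0, h1, h2, h3⟩
      have hdesc : ∀ i < j₀ + 1, parent hY c (s (i + 1)) = s i := by
        intro i
        induction i with
        | zero => intro _; rw [h1, h0, hz]
        | succ i ih =>
          intro hi
          refine parent_of_adj hY c (h2 (i + 1) hi) fun hne => ?_
          rw [ih (by omega)] at hne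
          exact h3 i hi hne.symm
      have hit := iterate_parent_of_descending hY c (s := fun i => s (i + 1)) (k := j₀)
        (fun i hi => hdesc (i + 1) (by omega)) j₀ le_rfl
      simp only [zero_add, h1] at hit
      refine hno ⟨s (j₀ + 1), j₀, ?_, hit⟩
      have := hgt_iterate hY c o j₀ (s (j₀ + 1))
      rw [hit, hzh] at this
      omega
    have hbK := hK _ _ _ hadj hbd
    have hdepth : ∀ (j : ℕ) (y : V), (parent hY c)^[j] y = z → j < K := by
      intro j y hy
      by_contra hj
      refine hbK.mono (show K ≤ j + 1 by omega)
        ⟨fun i => (parent hY c)^[j + 1 - i] y, ?_, ?_, ?_, ?_⟩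
      · simp only [Nat.sub_zero]
        rw [Function.iterate_succ_apply', hy, hz]
      · simpa using hy
      · intro i hi
        have : j + 1 - i = (j + 1 - (i + 1)) + 1 := by omega
        simp only [this, Function.iterate_succ_apply']
        exact (adj_parent hY c _).symm
      · intro i hi heq
        have := iterate_parent_injective hY c y heq
        omega
    -- A lowest descendant of `z` is a leaf of the tree.
    obtain ⟨j, hj, hmax⟩ : ∃ j, (∃ y, (parent hY c)^[j] y = z) ∧
        ¬ ∃ y, (parent hY c)^[j + 1] y = z := by
      by_contra! hcon
      have : ∀ j, ∃ y, (parent hY c)^[j] y = z := by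
        intro j
        induction j with
        | zero => exact ⟨z, rfl⟩
        | succ j ih => exact hcon j ih
      obtain ⟨y, hy⟩ := this K
      exact lt_irrefl _ (hdepth K y hy)
    obtain ⟨y, hy⟩ := hj
    have hyleaf : (Y.neighborSet y).Subsingleton := by
      have : ∀ w, Y.Adj y w → w = parent hY c y := by
        intro w hw
        by_contra hne
        refine hmax ⟨w, ?_⟩
        rw [Function.iterate_succ_apply, parent_of_adj hY c hw hne, hy]
      intro w hw w' hw'
      rw [this w hw, this w' hw']
    have hlen : ∃ w : Y.Walk y (r.vert n), w.length = j + 1 := by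
      have h := exists_walk_iterate_parent hY c y (j + 1)
      rwa [Function.iterate_succ_apply', hy, hz] at h
    obtain ⟨w', hw'⟩ := hlen
    exact ⟨y, r.vert n, w', by have := hdepth j y hy; omega, ⟨y, rfl, hyleaf⟩, rfl⟩
  obtain ⟨N₁, hN₁⟩ := hBad.bddAbove
  refine ⟨max n₀ (N₁ + 1), fun n hn z z' hz hzne hz' hzne' => ?_⟩
  have hnb : n ∉ Bad := fun h => by
    have := hN₁ h
    have := (le_max_right n₀ (N₁ + 1)).trans hn
    omega
  rw [Ray.vert_succ hY c hr] at hzne hzne'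
  have hpz := parent_of_adj hY c hz hzne
  have hpz' := parent_of_adj hY c hz' hzne'
  have hdes : ∀ z, parent hY c z = r.vert n →
      ∃ (y : V) (j : ℕ), hgt hY c o y = hgt hY c o x₀ ∧ (parent hY c)^[j] y = z := by
    intro z hz
    by_contra hcon
    exact hnb ⟨(le_max_left _ _).trans hn, z, hz, hcon⟩
  obtain ⟨y, j, hy, rfl⟩ := hdes z hpz
  obtain ⟨y', j', hy', rfl⟩ := hdes z' hpz'
  have hjj : j = j' := by
    have h1 := hgt_parent hY c o ((parent hY c)^[j] y)
    have h2 := hgt_parent hY c o ((parent hY c)^[j'] y')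
    rw [hpz, hgt_iterate, hy] at h1
    rw [hpz', hgt_iterate, hy'] at h2
    omega
  subst hjj
  obtain ⟨g, hg, rfl⟩ := hx₀ y y' hy hy'
  refine ⟨g, ?_, iterate_parent_map_of_stabP hY c hg.1 j y⟩
  conv_lhs => rw [← hpz]
  rw [parent_map_of_stabP hY c hg.1, iterate_parent_map_of_stabP hY c hg.1, hpz']

/-- If an element of `Γ` maps an edge of the ray `r` to a reversed edge of the ray `s`, then the
images of the two rays in the quotient run along each other in opposite directions. -/
lemma exists_reflected {r s : Ray Y} {N : ℕ} (hs : TransitiveFrom ρ s N) {a b : ℕ} (hb : N ≤ b)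
    {g : Γ} (h0 : ρ g (r.vert a) = s.vert b) (h1 : ρ g (r.vert (a + 1)) ≠ s.vert (b + 1)) :
    ∃ g' : Γ, ρ g' (r.vert (a + (b - N))) = s.vert N := by
  rcases Nat.eq_or_lt_of_le hb with rfl | hlt
  · exact ⟨g, by simpa using h0⟩
  have hstep : ∀ j, j + 1 + N ≤ b → ∃ γ : Γ, ρ γ (r.vert (a + j)) = s.vert (b - j) ∧
      ρ γ (r.vert (a + j + 1)) = s.vert (b - j - 1) := by
    intro j
    induction j with
    | zero =>
      intro _
      have hadj := (ρ g).map_rel_iff.mpr (r.adj a)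
      rw [h0] at hadj
      have hprev := s.adj (b - 1)
      rw [Nat.sub_add_cancel (by omega)] at hprev
      have hne := s.reduced (b - 1)
      rw [show b - 1 + 2 = b + 1 by omega] at hne
      obtain ⟨δ, hδ, hδ'⟩ := hs b hb _ _ hadj h1 hprev.symm hne
      exact ⟨δ * g, by rw [map_mul_apply]; simpa [h0] using hδ,
        by rw [map_mul_apply]; simpa using hδ'⟩
    | succ j ih =>
      intro hj
      obtain ⟨γ, hγ0, hγ1⟩ := ih (by omega)
      have hadj := (ρ γ).map_rel_iff.mpr (r.adj (a + j + 1))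
      rw [hγ1] at hadj
      have hprev := s.adj (b - j - 1 - 1)
      rw [Nat.sub_add_cancel (by omega)] at hprev
      have hne := s.reduced (b - j - 1 - 1)
      rw [show b - j - 1 - 1 + 2 = b - j - 1 + 1 by omega] at hne
      have hne1 : ρ γ (r.vert (a + j + 1 + 1)) ≠ s.vert (b - j - 1 + 1) := by
        rw [Nat.sub_add_cancel (by omega), ← hγ0]
        exact fun h => r.reduced (a + j) ((ρ γ).injective h).symm
      obtain ⟨δ, hδ, hδ'⟩ := hs (b - j - 1) (by omega) _ _ hadj hne1 hprev.symm hne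
      refine ⟨δ * γ, ?_, ?_⟩
      · rw [map_mul_apply, ← add_assoc, hγ1, hδ]
        congr 1
      · rw [map_mul_apply, ← add_assoc, hδ']
        congr 1
  obtain ⟨γ, -, hγ⟩ := hstep (b - N - 1) (by omega)
  refine ⟨γ, ?_⟩
  rw [show a + (b - N) = a + (b - N - 1) + 1 by omega, hγ]
  congr 1
  omega

/-- If only vertices below `M` of the ray `r` are equivalent to the `N`-th vertex of `s`, then every
element of `Γ` that maps a vertex of `r` beyond `M` to a vertex of `s` beyond `N` maps the
rest of `r` to the rest of `s`. -/
lemma map_vert_of_map_vert {r s : Ray Y} {N M : ℕ} (hs : TransitiveFrom ρ s N)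
    (hM : ∀ n, M ≤ n → ∀ g : Γ, ρ g (r.vert n) ≠ s.vert N) {a b : ℕ} (ha : M ≤ a) (hb : N ≤ b)
    {g : Γ} (h0 : ρ g (r.vert a) = s.vert b) (t : ℕ) :
    ρ g (r.vert (a + t)) = s.vert (b + t) := by
  induction t with
  | zero => exact h0
  | succ t ih =>
    by_contra hne
    obtain ⟨g', hg'⟩ := exists_reflected hs (show N ≤ b + t by omega) ih hne
    exact hM _ (by omega) g' hg'

/-- The shape of the cusps of a cuspidal lattice: beyond some index, an element of `Γ` that maps
a vertex of one of the rays to a vertex of one of the rays maps the rest of the first ray to the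
rest of the second one. -/
theorem exists_cusp_index (hY : Y.IsTree) (hfin : ∀ x, (Y.neighborSet x).Finite)
    (hunif : IsUniform Y) (hstab : ∀ e : Y.Dart, Finite {g : Γ // ρ g • e = e}) {m : ℕ}
    {r : Fin m → Ray Y} (hr : IsCuspDecomposition ρ r) :
    ∃ M, (∀ i, TransitiveFrom ρ (r i) M) ∧
      (∀ i j a b, M ≤ a → M ≤ b → ∀ g : Γ, ρ g ((r i).vert a) = (r j).vert b →
        ∀ t, ρ g ((r i).vert (a + t)) = (r j).vert (b + t)) ∧
      ∀ i a b, M ≤ a → M ≤ b → ∀ g : Γ, ρ g ((r i).vert a) = (r i).vert b → a = b := by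
  -- Interior vertices of rays are not leaves, so that the leaves lie in the finite part of the
  -- quotient, up to the origins of the rays.
  have hleaf : {a : VX ρ | ∃ y, projV ρ y = a ∧ (Y.neighborSet y).Subsingleton}.Finite := by
    refine (hr.2.1.union (Set.finite_range fun i => projV ρ ((r i).vert 0))).subset ?_
    rintro _ ⟨y, rfl, hy⟩
    by_contra hcon
    rw [Set.mem_union, not_or] at hcon
    obtain ⟨h1, h2⟩ := hcon
    simp only [Set.mem_ofPred_eq, not_forall, not_not] at h1
    obtain ⟨i, n, hin⟩ := h1
    rcases n with _ | n
    · exact h2 ⟨i, hin.symm⟩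
    · obtain ⟨g, hg⟩ := projV_eq_iff.mp hin
      have e1 := (ρ g).map_rel_iff.mpr ((r i).adj n)
      have e2 := (ρ g).map_rel_iff.mpr ((r i).adj (n + 1))
      rw [hg] at e1 e2
      exact (r i).reduced n ((ρ g).injective (hy e1.symm e2))
  have hfiber : ∀ i a, {n | projV ρ ((r i).vert n) = a}.Finite := fun i =>
    finite_fiber_of_isCusp hY hfin hstab (hr.1 i).1
  choose N hN using fun i => exists_transitiveFrom hY hfin hunif hstab (hr.1 i).1 hleaf
  have hB : ∀ i j, ∃ B, ∀ n, B ≤ n → ∀ g : Γ, ρ g ((r i).vert n) ≠ (r j).vert (N j) := by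
    intro i j
    obtain ⟨B, hB⟩ := (hfiber i (projV ρ ((r j).vert (N j)))).bddAbove
    refine ⟨B + 1, fun n hn g hg => ?_⟩
    have : n ≤ B := hB (projV_eq_iff.mpr ⟨g⁻¹, map_inv_apply_eq hg⟩)
    omega
  choose B hB using hB
  let M := Finset.univ.sup N + Finset.univ.sup fun i => Finset.univ.sup (B i)
  have hNM : ∀ i, N i ≤ M := fun i =>
    (Finset.le_sup (Finset.mem_univ i)).trans (Nat.le_add_right _ _)
  have hBM : ∀ i j, B i j ≤ M := fun i j =>
    ((Finset.le_sup (f := B i) (Finset.mem_univ j)).trans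
      (Finset.le_sup (f := fun i => Finset.univ.sup (B i)) (Finset.mem_univ i))).trans
      (Nat.le_add_left _ _)
  have hmap : ∀ i j a b, M ≤ a → M ≤ b → ∀ g : Γ, ρ g ((r i).vert a) = (r j).vert b →
      ∀ t, ρ g ((r i).vert (a + t)) = (r j).vert (b + t) := fun i j a b ha hb g hg t =>
    map_vert_of_map_vert (hN j) (hB i j) ((hBM i j).trans ha) ((hNM j).trans hb) hg t
  refine ⟨M, fun i n hn => hN i n ((hNM i).trans hn), hmap, ?_⟩
  intro i a b ha hb g hg
  by_contra hne
  wlog hab : a < b generalizing a b g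
  · exact this b a hb ha g⁻¹ (map_inv_apply_eq hg) (Ne.symm hne) (by omega)
  obtain ⟨d, rfl⟩ := Nat.exists_eq_add_of_lt hab
  -- The images of the vertices in the quotient would be periodic along the ray.
  have hper : ∀ k, projV ρ ((r i).vert (a + k * (d + 1))) = projV ρ ((r i).vert a) := by
    intro k
    induction k with
    | zero => simp
    | succ k ih =>
      rw [← ih]
      refine projV_eq_iff.mpr ⟨g, ?_⟩
      rw [hmap i i a _ ha hb g hg]
      congr 1
      ring
  refine (Set.infinite_of_injective_forall_mem (f := fun k => a + k * (d + 1)) ?_ hper)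
    (hfiber i _)
  intro k k' hkk
  simpa using hkk

end Branches

/-! ### The edge operator of a cuspidal lattice -/

section EdgeOperator

variable {V : Type*} {Y : SimpleGraph V} {Γ : Type*} [Group Γ] {ρ : Γ →* (Y ≃g Y)}

open Classical in
/-- The matrix of the edge operator `T`. -/
noncomputable def edgeCoeff (ρ : Γ →* (Y ≃g Y)) (e e' : OE ρ) : ℂ :=
  if origin e' = terminus e then wt₂ e e' else 0

lemma coeff_oneSub (u : ℂ) (e e' : OE ρ) :
    coeff (oneSub ρ u) e e' = Finsupp.single e 1 e' - u * edgeCoeff ρ e e' := by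
  simp [coeff, oneSub, edgeOp, edgeCoeff]

lemma edgeCoeff_ne_zero {e e' : OE ρ} (h : edgeCoeff ρ e e' ≠ 0) :
    origin e' = terminus e ∧ wt₂ e e' ≠ 0 := by
  unfold edgeCoeff at h
  split_ifs at h with h1
  · exact ⟨h1, h⟩
  · exact absurd rfl h

lemma edgeCoeff_of_ne_rev {e e' : OE ρ} (h : origin e' = terminus e) (hne : e' ≠ rev e) :
    edgeCoeff ρ e e' = wt e' := by
  rw [edgeCoeff, if_pos h, wt₂, if_neg hne]

lemma edgeCoeff_of_eq_rev {e e' : OE ρ} (h : origin e' = terminus e) (hrev : e' = rev e) :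
    edgeCoeff ρ e e' = wt e' - 1 := by
  rw [edgeCoeff, if_pos h, wt₂, if_pos hrev]

lemma exists_projE (e : OE ρ) : ∃ d, projE ρ d = e := ⟨e.out, Quotient.out_eq e⟩

lemma rev_rev (e : OE ρ) : rev (rev e) = e := by
  obtain ⟨d, rfl⟩ := exists_projE e
  rfl

lemma origin_rev (e : OE ρ) : origin (rev e) = terminus e := by
  obtain ⟨d, rfl⟩ := exists_projE e
  rfl

lemma projE_eq_of {d d' : Y.Dart} (g : Γ) (h1 : ρ g d'.fst = d.fst) (h2 : ρ g d'.snd = d.snd) :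
    projE ρ d = projE ρ d' :=
  projE_eq_iff.mpr ⟨g, SimpleGraph.Dart.ext _ _ (Prod.ext h1 h2)⟩

/-- Far out in a cusp, the image in the quotient of a vertex of the ray is the origin of exactly two
edges. -/
lemma eq_of_origin_eq {r : Ray Y} {M b : ℕ} (hT : TransitiveFrom ρ r M) (hb : M ≤ b + 1) {e : OE ρ}
    (he : origin e = projV ρ (r.vert (b + 1))) :
    e = projE ρ (r.edge (b + 1)) ∨ e = projE ρ (r.edge b).symm := by
  obtain ⟨d, rfl⟩ := exists_projE e
  obtain ⟨g, hg⟩ := projV_eq_iff.mp he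
  have hg' : ρ g⁻¹ d.fst = r.vert (b + 1) := map_inv_apply_eq hg
  have hadj := (ρ g⁻¹).map_rel_iff.mpr d.adj
  rw [hg'] at hadj
  by_cases h : ρ g⁻¹ d.snd = r.vert (b + 2)
  · left
    exact (projE_eq_of g⁻¹ hg' h).symm
  · right
    obtain ⟨δ, h1, h2⟩ := hT (b + 1) hb _ _ hadj h (r.adj b).symm (r.reduced b)
    refine (projE_eq_of (δ * g⁻¹) ?_ ?_).symm
    · rw [map_mul_apply, hg']
      exact h1
    · rw [map_mul_apply]
      exact h2

/-- The stabilizer of a vertex far out in a cusp fixes the edge towards the cusp. -/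
lemma wt_ascending {r : Ray Y} {a : ℕ}
    (hfix : ∀ g : Γ, ρ g (r.vert a) = r.vert a → ρ g (r.vert (a + 1)) = r.vert (a + 1)) :
    wt (projE ρ (r.edge a)) = 1 := by
  change (originOrbit ρ (r.edge a)).ncard = 1
  rw [Set.ncard_eq_one]
  refine ⟨r.edge a, Set.eq_singleton_iff_unique_mem.mpr ⟨⟨1, by simp, by simp⟩, ?_⟩⟩
  rintro _ ⟨g, hg, rfl⟩
  exact SimpleGraph.Dart.ext _ _ (Prod.ext hg (hfix g hg))

/-- The stabilizer of a vertex far out in a cusp permutes all edges but the one towards the cusp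
transitively. -/
lemma wt_descending (hfin : ∀ x, (Y.neighborSet x).Finite) {r : Ray Y} {M a : ℕ}
    (hT : TransitiveFrom ρ r M) (ha : M ≤ a + 1)
    (hfix : ∀ g : Γ, ρ g (r.vert (a + 1)) = r.vert (a + 1) →
      ρ g (r.vert (a + 2)) = r.vert (a + 2)) :
    (wt (projE ρ (r.edge a).symm) : ℂ) = val Y (r.vert (a + 1)) - 1 := by
  have h1 : wt (projE ρ (r.edge a).symm) + 1 = val Y (r.vert (a + 1)) := by
    change (originOrbit ρ (r.edge a).symm).ncard + 1 = (Y.neighborSet (r.vert (a + 1))).ncard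
    rw [← Set.ncard_sdiff_singleton_add_one (s := Y.neighborSet (r.vert (a + 1)))
      (show r.vert (a + 2) ∈ Y.neighborSet (r.vert (a + 1)) from r.adj (a + 1)) (hfin _)]
    congr 1
    have himg : (fun d : Y.Dart => d.snd) '' originOrbit ρ (r.edge a).symm =
        Y.neighborSet (r.vert (a + 1)) \ {r.vert (a + 2)} := by
      ext z
      constructor
      · rintro ⟨_, ⟨g, hg, rfl⟩, rfl⟩
        replace hg : ρ g (r.vert (a + 1)) = r.vert (a + 1) := hg
        have h2 := (ρ g).map_rel_iff.mpr (r.adj a).symm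
        rw [hg] at h2
        refine ⟨h2, fun h3 => ?_⟩
        replace h3 : ρ g (r.vert a) = r.vert (a + 2) := h3
        rw [← hfix g hg] at h3
        exact r.reduced a ((ρ g).injective h3)
      · rintro ⟨h2, h3⟩
        obtain ⟨g, hg, hg'⟩ := hT (a + 1) ha _ _ (r.adj a).symm (r.reduced a) h2 h3
        exact ⟨_, ⟨g, hg, rfl⟩, hg'⟩
    rw [← himg, Set.InjOn.ncard_image]
    rintro _ ⟨g, hg, rfl⟩ _ ⟨g', hg', rfl⟩ h
    refine SimpleGraph.Dart.ext _ _ (Prod.ext ?_ h)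
    exact (show (ρ g • (r.edge a).symm).fst = _ from hg).trans hg'.symm
  rw [← h1]
  push_cast
  ring

lemma exists_representatives {ι : Type*} [Finite ι] (R : ι → ι → Prop) (hR : Equivalence R) :
    ∃ J : Finset ι, (∀ i ∈ J, ∀ j ∈ J, R i j → i = j) ∧ ∀ i, ∃ j ∈ J, R i j := by
  classical
  let S : Setoid ι := ⟨R, hR⟩
  cases nonempty_fintype (Quotient S)
  refine ⟨(Finset.univ : Finset (Quotient S)).image Quotient.out, ?_, fun i => ?_⟩
  · intro i hi j hj hij
    obtain ⟨x, -, rfl⟩ := Finset.mem_image.mp hi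
    obtain ⟨y, -, rfl⟩ := Finset.mem_image.mp hj
    have : x = y := by
      rw [← Quotient.out_eq x, ← Quotient.out_eq y]
      exact Quotient.sound hij
    rw [this]
  · exact ⟨(Quotient.mk S i).out, Finset.mem_image_of_mem _ (Finset.mem_univ _),
      hR.symm (Quotient.mk_out (s := S) i)⟩

/-- The edge operator of a cuspidal lattice has the shape described by `CuspMatrix`. Rays whose
images in the quotient meet far out have the same image there; `J` selects one ray for each of
the cusps of the quotient. -/
theorem exists_cuspMatrix (hY : Y.IsTree) (hfin : ∀ x, (Y.neighborSet x).Finite)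
    (hunif : IsUniform Y) (hstab : ∀ e : Y.Dart, Finite {g : Γ // ρ g • e = e}) {m : ℕ}
    {r : Fin m → Ray Y} (hr : IsCuspDecomposition ρ r) :
    ∃ (M : ℕ) (J : Finset (Fin m)), ∀ N : Fin m → ℕ, (∀ i, M ≤ N i) →
      ∃ F : Finset (OE ρ), CuspMatrix (edgeCoeff ρ) F
        (fun (i : J) n => projE ρ ((r i).edge (N i + n)))
        (fun (i : J) n => projE ρ ((r i).edge (N i + n)).symm)
        (fun (i : J) n => (val Y ((r i).vert (N i + n + 1)) : ℂ) - 1) := by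
  obtain ⟨M, hT, hmap, hinj⟩ := exists_cusp_index hY hfin hunif hstab hr
  let R : Fin m → Fin m → Prop := fun i j =>
    ∃ a b, M ≤ a ∧ M ≤ b ∧ ∃ g : Γ, ρ g ((r i).vert a) = (r j).vert b
  have hR : Equivalence R := by
    refine ⟨fun i => ⟨M, M, le_rfl, le_rfl, 1, by simp⟩, ?_, ?_⟩
    · rintro i j ⟨a, b, ha, hb, g, hg⟩
      exact ⟨b, a, hb, ha, g⁻¹, map_inv_apply_eq hg⟩
    · rintro i j k ⟨a, b, ha, hb, g, hg⟩ ⟨b', c, hb', hc, g', hg'⟩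
      refine ⟨a + b', c + b, by omega, by omega, g' * g, ?_⟩
      rw [map_mul_apply, hmap i j a b ha hb g hg, add_comm b b',
        hmap j k b' c hb' hc g' hg']
  obtain ⟨J, hJ1, hJ2⟩ := exists_representatives R hR
  refine ⟨M, J, fun N hN => ?_⟩
  have hfix : ∀ i a, M ≤ a → ∀ g : Γ, ρ g ((r i).vert a) = (r i).vert a →
      ρ g ((r i).vert (a + 1)) = (r i).vert (a + 1) := fun i a ha g hg => hmap i i a a ha ha g hg 1
  have hVinj : ∀ (i j : J) (a b : ℕ), M ≤ a → M ≤ b →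
      projV ρ ((r i).vert a) = projV ρ ((r j).vert b) → i = j ∧ a = b := by
    intro i j a b ha hb h
    obtain ⟨g, hg⟩ := projV_eq_iff.mp h
    have hij : i = j := (Subtype.ext (hJ1 _ j.2 _ i.2 ⟨b, a, hb, ha, g, hg⟩)).symm
    subst hij
    exact ⟨rfl, (hinj i b a hb ha g hg).symm⟩
  have hM : ∀ (i : Fin m) n, M ≤ N i + n := fun i n => (hN i).trans (Nat.le_add_right _ _)
  have hM1 : ∀ (i : Fin m) n, M ≤ N i + n + 1 := fun i n => (hM i n).trans (Nat.le_succ _)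
  set e : J → ℕ → OE ρ := fun i n => projE ρ ((r i).edge (N i + n)) with he
  set f : J → ℕ → OE ρ := fun i n => projE ρ ((r i).edge (N i + n)).symm with hf
  have oe : ∀ i n, origin (e i n) = projV ρ ((r i).vert (N i + n)) := fun _ _ => rfl
  have te : ∀ i n, terminus (e i n) = projV ρ ((r i).vert (N i + n + 1)) := fun _ _ => rfl
  have of' : ∀ i n, origin (f i n) = projV ρ ((r i).vert (N i + n + 1)) := fun _ _ => rfl
  have tf : ∀ i n, terminus (f i n) = projV ρ ((r i).vert (N i + n)) := fun _ _ => rfl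
  have re : ∀ i n, rev (e i n) = f i n := fun _ _ => rfl
  have rf : ∀ i n, rev (f i n) = e i n := fun _ _ => rfl
  have e_inj : ∀ {i j n k}, e i n = e j k → i = j ∧ n = k := by
    intro i j n k h
    have := congrArg origin h
    rw [oe, oe] at this
    obtain ⟨rfl, h2⟩ := hVinj i j _ _ (hM i n) (hM j k) this
    exact ⟨rfl, by omega⟩
  have f_inj : ∀ {i j n k}, f i n = f j k → i = j ∧ n = k := by
    intro i j n k h
    have := congrArg rev h
    rw [rf, rf] at this
    exact e_inj this
  have e_ne_f : ∀ i j n k, e i n ≠ f j k := by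
    intro i j n k h
    have h1 := congrArg origin h
    have h2 := congrArg terminus h
    rw [oe, of'] at h1
    rw [te, tf] at h2
    obtain ⟨rfl, h1'⟩ := hVinj _ _ _ _ (hM _ _) (hM1 _ _) h1
    obtain ⟨-, h2'⟩ := hVinj _ _ _ _ (hM1 _ _) (hM _ _) h2
    omega
  have hout : ∀ (i : J) (n : ℕ) (x : OE ρ), origin x = projV ρ ((r i).vert (N i + n + 1)) →
      x = e i (n + 1) ∨ x = f i n := fun i n x hx => eq_of_origin_eq (hT i) (hM1 i n) hx
  have we : ∀ i n, wt (e i n) = 1 := fun i n => wt_ascending (hfix i _ (hM i n))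
  have wf : ∀ (i : J) n, (wt (f i n) : ℂ) = val Y ((r i).vert (N i + n + 1)) - 1 := fun i n =>
    wt_descending hfin (hT i) (hM1 i n) (hfix i _ (hM1 i n))
  -- The tails of all rays are covered by the tails of the rays in `J`.
  have hFfin : {x : OE ρ | (∀ i n, x ≠ e i n) ∧ ∀ i n, x ≠ f i n}.Finite := by
    have hj : ∀ i : Fin m, ∃ B, ∀ n, B ≤ n → ∃ (j : J) (k : ℕ),
        projE ρ ((r i).edge n) = e j k ∧ projE ρ ((r i).edge n).symm = f j k := by
      intro i
      obtain ⟨j, hjJ, a, b, ha, hb, g, hg⟩ := hJ2 i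
      refine ⟨a + N j, fun n hn => ⟨⟨j, hjJ⟩, b + (n - a) - N j, ?_⟩⟩
      have h1 := hmap i j a b ha hb g hg (n - a)
      have h2 := hmap i j a b ha hb g hg (n - a + 1)
      have h3 : a + (n - a) = n := by omega
      have h4 : a + (n - a + 1) = n + 1 := by omega
      have h5 : N j + (b + (n - a) - N j) = b + (n - a) := by omega
      rw [h3] at h1
      rw [h4, ← add_assoc] at h2
      simp only [he, hf, h5]
      exact ⟨(projE_eq_of g h1 h2).symm, (projE_eq_of g h2 h1).symm⟩
    choose B hB using hj
    refine (hr.2.2.union (Set.finite_iUnion fun i : Fin m => ((Set.finite_Iio (B i)).image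
      fun n => projE ρ ((r i).edge n)).union ((Set.finite_Iio (B i)).image
      fun n => projE ρ ((r i).edge n).symm))).subset ?_
    rintro x ⟨hxe, hxf⟩
    by_cases hx : ∀ i n, x ≠ projE ρ ((r i).edge n) ∧ x ≠ projE ρ ((r i).edge n).symm
    · exact Or.inl hx
    · right
      push Not at hx
      obtain ⟨i, n, hin⟩ := hx
      refine Set.mem_iUnion.mpr ⟨i, ?_⟩
      have hn : n < B i := by
        by_contra hcon
        obtain ⟨j, k, h1, h2⟩ := hB i n (not_lt.mp hcon)
        by_cases hx1 : x = projE ρ ((r i).edge n)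
        · exact hxe j k (hx1.trans h1)
        · exact hxf j k ((hin hx1).trans h2)
      by_cases hx1 : x = projE ρ ((r i).edge n)
      · exact Or.inl ⟨n, hn, hx1.symm⟩
      · exact Or.inr ⟨n, hn, (hin hx1).symm⟩
  have hFmem : ∀ x, x ∈ hFfin.toFinset ↔ (∀ i n, x ≠ e i n) ∧ ∀ i n, x ≠ f i n := fun x =>
    hFfin.mem_toFinset
  refine ⟨hFfin.toFinset, ?_⟩
  refine
    { e_inj := e_inj
      f_inj := f_inj
      e_ne_f := e_ne_f
      e_notMem := fun i n h => ((hFmem _).mp h).1 i n rfl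
      f_notMem := fun i n h => ((hFmem _).mp h).2 i n rfl
      cover := ?_
      T_ee := ?_
      T_ef := ?_
      T_ff := ?_
      of_e := ?_
      of_f := ?_
      of_f_zero := ?_
      of_mem := ?_ }
  · intro x
    by_cases hx : x ∈ hFfin.toFinset
    · exact Or.inl hx
    · right
      rw [hFmem, not_and_or] at hx
      push Not at hx
      exact hx
  · intro i n
    rw [edgeCoeff_of_ne_rev (by rw [oe, te]; rfl) (by rw [re]; exact e_ne_f _ _ _ _), we]
    simp
  · intro i n
    rw [edgeCoeff_of_eq_rev (by rw [of', te]) (re i n).symm, wf]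
  · intro i n
    rw [edgeCoeff_of_ne_rev (by rw [of', tf]; rfl) (by rw [rf]; exact (e_ne_f _ _ _ _).symm), wf]
  · intro i n y hy
    exact hout i n y (edgeCoeff_ne_zero hy).1
  · intro i n y hy
    rcases hout i n y (edgeCoeff_ne_zero hy).1 with rfl | h
    · rw [edgeCoeff_of_eq_rev (by rw [oe, tf]) (rf i (n + 1)).symm, we] at hy
      simp at hy
    · exact h
  · intro i y hy
    have h0 := (edgeCoeff_ne_zero hy).1
    rw [tf] at h0
    rw [hFmem]
    refine ⟨?_, ?_⟩
    · rintro j k rfl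
      rw [oe] at h0
      obtain ⟨rfl, h1⟩ := hVinj _ _ _ _ (hM _ _) (hM _ _) h0
      obtain rfl : k = 0 := by omega
      rw [edgeCoeff_of_eq_rev (by rw [oe, tf]) (rf j 0).symm, we] at hy
      simp at hy
    · rintro j k rfl
      rw [of'] at h0
      obtain ⟨rfl, h1⟩ := hVinj _ _ _ _ (hM1 _ _) (hM _ _) h0
      omega
  · intro x hx y hy
    rw [hFmem] at hx
    have h0 := (edgeCoeff_ne_zero hy).1
    have hno : ∀ (i : J) n, origin y ≠ projV ρ ((r i).vert (N i + n + 1)) := by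
      intro i n h
      rw [h, ← origin_rev] at h0
      rcases hout i n _ h0.symm with h1 | h1
      · exact hx.2 i (n + 1) (by rw [← re, ← h1, rev_rev])
      · exact hx.1 i n (by rw [← rf, ← h1, rev_rev])
    by_cases hyF : y ∈ hFfin.toFinset
    · exact Or.inl hyF
    · right
      rw [hFmem, not_and_or] at hyF
      push Not at hyF
      rcases hyF with ⟨i, n, rfl⟩ | ⟨i, n, rfl⟩
      · rcases n with _ | n
        · exact ⟨i, rfl⟩
        · exact absurd (oe i (n + 1)) (hno i n)
      · exact absurd (of' i n) (hno i n)

end EdgeOperator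

/-! ### The factor of a periodic cusp -/

section PeriodicCusp

/-- A series which is reproduced up to the factor `z` by a shift by `k` is determined by its first
`k` terms. -/
lemma hasSum_of_add_eq_mul {a : ℕ → ℂ} {k : ℕ} {z : ℂ} (hz : 1 - z ≠ 0) (ha : Summable a)
    (h : ∀ j, a (j + k) = z * a j) : HasSum a ((∑ j ∈ Finset.range k, a j) / (1 - z)) := by
  have h1 := ha.sum_add_tsum_nat_add k
  simp only [h, tsum_mul_left] at h1
  have h2 : (∑ j ∈ Finset.range k, a j) / (1 - z) = ∑' j, a j := by
    rw [div_eq_iff hz]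
    linear_combination h1
  rw [h2]
  exact ha.hasSum

variable {V : Type*} {Y : SimpleGraph V}

lemma PeriodicFrom.val_add_mul {r : Ray Y} {N k : ℕ} (hk : PeriodicFrom r N k) (t n : ℕ)
    (hn : N ≤ n) : val Y (r.vert (n + k * t)) = val Y (r.vert n) := by
  induction t with
  | zero => rfl
  | succ t ih => rw [mul_add_one, ← add_assoc, ← hk.2 _ (hn.trans (Nat.le_add_right _ _)), ih]

lemma cuspDenom_ne_zero {r : Ray Y} {N k : ℕ} (hk : 0 < k) {Q : ℝ}
    (hQ : ∀ x, ‖(val Y x : ℂ) - 1‖ ≤ Q) {u : ℂ} (hu : Q * ‖u‖ ^ 2 < 1) :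
    cuspDenom r N k u ≠ 0 := by
  have hQ0 : 0 ≤ Q := (norm_nonneg _).trans (hQ (r.vert 0))
  have h1 : ‖(∏ l ∈ Finset.range k, ((val Y (r.vert (N + l)) : ℂ) - 1)) * u ^ (2 * k)‖ < 1 := by
    refine lt_of_le_of_lt ?_ (pow_lt_one₀ (mul_nonneg hQ0 (sq_nonneg ‖u‖)) hu hk.ne')
    rw [norm_mul, norm_pow, mul_pow, ← pow_mul, norm_prod]
    gcongr
    refine (Finset.prod_le_prod (fun _ _ => norm_nonneg _) fun l _ => hQ (r.vert (N + l))).trans ?_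
    simp
  intro h0
  rw [cuspDenom, sub_eq_zero] at h0
  rw [← h0, norm_one] at h1
  exact lt_irrefl _ h1

/-- The series of the factor of a cusp is, up to the factor `q_0 ⋯ q_{k-1} u^{2k}`, reproduced by
a shift by one period. -/
lemma hasSum_cuspFactor {r : Ray Y} {N k : ℕ} (hk : PeriodicFrom r N k) {Q : ℝ}
    (hQ : ∀ x, ‖(val Y x : ℂ) - 1‖ ≤ Q) {u : ℂ} (hu : Q * ‖u‖ ^ 2 < 1) :
    HasSum (fun j => (∏ l ∈ Finset.range j, ((val Y (r.vert (N + l)) : ℂ) - 1)) *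
      (1 - ((val Y (r.vert (N + j)) : ℂ) - 1)) * u ^ (2 * j + 1)) (cuspFactor r N k u) := by
  have hQ0 : 0 ≤ Q := (norm_nonneg _).trans (hQ (r.vert 0))
  refine hasSum_of_add_eq_mul (cuspDenom_ne_zero hk.1 hQ hu) ?_ fun j => ?_
  · refine Summable.of_norm_bounded
      ((summable_geometric_of_lt_one (mul_nonneg hQ0 (sq_nonneg ‖u‖)) hu).mul_left
        ((1 + Q) * ‖u‖)) fun j => ?_
    rw [norm_mul, norm_mul, norm_prod, norm_pow, pow_succ, pow_mul]
    have h1 : ∏ l ∈ Finset.range j, ‖(val Y (r.vert (N + l)) : ℂ) - 1‖ ≤ Q ^ j :=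
      (Finset.prod_le_prod (fun _ _ => norm_nonneg _) fun l _ => hQ (r.vert (N + l))).trans
        (by simp)
    have h2 : ‖1 - ((val Y (r.vert (N + j)) : ℂ) - 1)‖ ≤ 1 + Q :=
      (norm_sub_le _ _).trans (by rw [norm_one]; linarith [hQ (r.vert (N + j))])
    calc _ ≤ Q ^ j * (1 + Q) * ((‖u‖ ^ 2) ^ j * ‖u‖) := by gcongr
      _ = _ := by rw [mul_pow]; ring
  · have h1 : ∀ l, val Y (r.vert (N + (k + l))) = val Y (r.vert (N + l)) := fun l => by
      rw [add_comm k l, ← add_assoc, ← hk.2 _ (Nat.le_add_right _ _)]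
    rw [add_comm j k, Finset.prod_range_add, h1]
    simp only [h1]
    ring

lemma val_map (g : Y ≃g Y) (x : V) : val Y (g x) = val Y x := by
  have : Y.neighborSet (g x) = g '' Y.neighborSet x := by
    ext y
    constructor
    · intro h
      exact ⟨g.symm y, by simpa using g.symm.map_rel_iff.mpr h, g.apply_symm_apply y⟩
    · rintro ⟨z, hz, rfl⟩
      exact g.map_rel_iff.mpr hz
  rw [val, this, Set.ncard_image_of_injective _ g.injective, val]

lemma IsUniform.exists_norm_val_le (hunif : IsUniform Y) :
    ∃ Q : ℝ, 1 ≤ Q ∧ ∀ x, ‖(val Y x : ℂ) - 1‖ ≤ Q := by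
  have := hunif.1
  let v : MulAction.orbitRel.Quotient (Y ≃g Y) V → ℝ :=
    Quotient.lift (fun x => ‖(val Y x : ℂ) - 1‖) fun a b h => by
      obtain ⟨g, rfl⟩ := h
      exact congrArg (fun n : ℕ => ‖(n : ℂ) - 1‖) (val_map g b)
  obtain ⟨Q, hQ⟩ := (Set.finite_range v).bddAbove
  exact ⟨max 1 Q, le_max_left _ _, fun x =>
    (hQ ⟨Quotient.mk _ x, rfl⟩).trans (le_max_right _ _)⟩

end PeriodicCusp

/-! ### Determinant and zeta function of a cuspidal lattice -/

section Minors

variable {I : Type*} {A : (I →₀ ℂ) →ₗ[ℂ] (I → ℂ)}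

open Classical in
lemma minor_eq_det {B : I → I → ℂ} (hA : ∀ i j, coeff A i j = Finsupp.single i 1 j - B i j)
    (E : Finset I) : minor A E = Matrix.det (1 - Matrix.of fun i j : E => B i j) := by
  rw [minor, ← Matrix.det_transpose]
  congr 1
  ext i j
  rw [Matrix.transpose_apply, Matrix.of_apply, hA, Finsupp.single_apply,
    Matrix.sub_apply, Matrix.one_apply, Matrix.of_apply]
  simp only [Subtype.ext_iff]

lemma HasDet.opDet_eq {d : ℂ} (h : HasDet A d) : opDet A = d :=
  h.limUnder_eq

lemma HasFewCycles.hasDet {B : I → I → ℂ} {s : ℝ} {F : Finset I} {h : I → ℚ}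
    (H : HasFewCycles B s F h) (hs0 : 0 ≤ s) (hs : s < 1)
    (hA : ∀ i j, coeff A i j = Finsupp.single i 1 j - B i j) :
    HasDet A (Complex.exp (-∑' l : {l : List I // l ≠ []}, cycWt B l.1 / l.1.length)) :=
  (H.tendsto_det hs0 hs).congr fun E => (minor_eq_det hA E).symm

end Minors

section EulerProduct

variable {V : Type*} {Y : SimpleGraph V} {Γ : Type*} [Group Γ] {ρ : Γ →* (Y ≃g Y)}

/-- The weight of a word for the matrix of `T` is its weight as a path of `X`, or zero if the word
is not a path. -/
lemma pathWt_edgeCoeff (x y : OE ρ) (m : List (OE ρ)) :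
    (List.IsChain (fun e e' => terminus e = origin e') (x :: (m ++ [y])) →
      pathWt (edgeCoeff ρ) x m y = pathWt wt₂ x m y) ∧
    (¬ List.IsChain (fun e e' => terminus e = origin e') (x :: (m ++ [y])) →
      pathWt (edgeCoeff ρ) x m y = 0) := by
  induction m generalizing x with
  | nil =>
    simp only [List.nil_append, List.isChain_cons_cons, List.isChain_singleton, and_true, pathWt,
      edgeCoeff]
    exact ⟨fun h => if_pos h.symm, fun h => if_neg fun h' => h h'.symm⟩
  | cons z m ih =>
    simp only [List.cons_append, List.isChain_cons_cons, pathWt]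
    constructor
    · rintro ⟨h1, h2⟩
      rw [(ih z).1 h2, edgeCoeff, if_pos h1.symm]
    · intro h
      by_cases h1 : terminus x = origin z
      · rw [(ih z).2 fun h2 => h ⟨h1, h2⟩, mul_zero]
      · rw [edgeCoeff, if_neg fun h' => h1 h'.symm, zero_mul]

lemma cycWt_edgeCoeff {l : List (OE ρ)} (hl : IsCycle (l : Cycle (OE ρ))) :
    cycWt (edgeCoeff ρ) l = wtList l := by
  rcases l with _ | ⟨x, m⟩
  · exact absurd rfl hl.1
  · rw [show wtList (x :: m) = cycWt wt₂ (x :: m) from rfl, cycWt_cons, cycWt_cons]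
    exact (pathWt_edgeCoeff x x m).1 (Cycle.chain_coe_cons _ _ _ |>.mp hl.2)

lemma cycWt_edgeCoeff_eq_zero {l : List (OE ρ)} (h0 : (l : Cycle (OE ρ)) ≠ Cycle.nil)
    (hl : ¬ IsCycle (l : Cycle (OE ρ))) : cycWt (edgeCoeff ρ) l = 0 := by
  rcases l with _ | ⟨x, m⟩
  · exact absurd rfl h0
  · rw [cycWt_cons]
    exact (pathWt_edgeCoeff x x m).2 fun h => hl ⟨h0, Cycle.chain_coe_cons _ _ _ |>.mpr h⟩

variable {u : ℂ} {s : ℝ} {F : Finset (OE ρ)} {h : OE ρ → ℚ}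

/-- The Euler product over the prime cycles is the Euler product over all primitive words: words
which are not closed paths have weight zero. -/
theorem hasProd_eulerFactor (H : HasFewCycles (fun e e' => u * edgeCoeff ρ e e') s F h)
    (hs0 : 0 ≤ s) (hs : s < 1) :
    HasProd (eulerFactor ρ u) (Complex.exp (∑' l : {l : List (OE ρ) // l ≠ []},
      cycWt (fun e e' => u * edgeCoeff ρ e e') l.1 / l.1.length)) := by
  let w : Cycle (OE ρ) → ℂ := Quotient.lift (cycWt fun e e' => u * edgeCoeff ρ e e')
    fun a b hab => by
      obtain ⟨n, rfl⟩ := hab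
      exact (cycWt_rotate _ a n).symm
  have h1 := H.hasProd_euler hs0 hs w fun _ => rfl
  let g : {c : Cycle (OE ρ) // IsPrimeCycle c} → {c : Cycle (OE ρ) // IsPrimitiveCycle c} :=
    fun c => ⟨c.1, c.2.1.1, c.2.2⟩
  have hg : Function.Injective g := fun c d hcd => Subtype.ext (congrArg Subtype.val hcd :)
  refine HasProd.congr_fun ((hg.hasProd_iff fun c hc => ?_).mpr h1) fun c => ?_
  · obtain ⟨c, hc'⟩ := c
    induction c using Quotient.inductionOn with | _ l =>
    have hl : ¬ IsCycle (l : Cycle (OE ρ)) := fun hl => hc ⟨⟨_, hl, hc'.2⟩, rfl⟩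
    change (1 - cycWt (fun e e' => u * edgeCoeff ρ e e') l)⁻¹ = 1
    rw [cycWt_mul_left, cycWt_edgeCoeff_eq_zero hc'.1 hl]
    simp
  · obtain ⟨c, hc'⟩ := c
    induction c using Quotient.inductionOn with | _ l =>
    change (1 - wtList l * u ^ l.length)⁻¹ = (1 - cycWt (fun e e' => u * edgeCoeff ρ e e') l)⁻¹
    rw [cycWt_mul_left, cycWt_edgeCoeff hc'.1, mul_comm]

lemma wtCycle_mul_pow_ne_one (H : HasFewCycles (fun e e' => u * edgeCoeff ρ e e') s F h)
    (hs0 : 0 ≤ s) (hs : s < 1) {c : Cycle (OE ρ)} (hc : IsCycle c) :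
    wtCycle c * u ^ c.length ≠ 1 := by
  induction c using Quotient.inductionOn with | _ l =>
  have hl : l ≠ [] := by
    rintro rfl
    exact hc.1 rfl
  have h1 := H.norm_cycWt_lt_one hs0 hs hl
  rw [cycWt_mul_left, cycWt_edgeCoeff hc] at h1
  intro h2
  replace h2 : wtList l * u ^ l.length = 1 := h2
  rw [mul_comm, h2, norm_one] at h1
  exact lt_irrefl _ h1

/-- The determinant formula, for `u` so small that `u T` has row sums less than one. -/
theorem inv_zeta_eq_opDet (H : HasFewCycles (fun e e' => u * edgeCoeff ρ e e') s F h)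
    (hs0 : 0 ≤ s) (hs : s < 1) :
    IsStrongDetClass (oneSub ρ u) ∧ IsDetClass (oneSub ρ u) ∧
      (∀ c : {c : Cycle (OE ρ) // IsPrimeCycle c}, wtCycle c.1 * u ^ c.1.length ≠ 1) ∧
      Multipliable (eulerFactor ρ u) ∧ (zeta ρ u)⁻¹ = opDet (oneSub ρ u) := by
  have h1 := hasProd_eulerFactor H hs0 hs
  have h2 := H.hasDet hs0 hs (coeff_oneSub u)
  refine ⟨H.isStrongDetClass hs _ (coeff_oneSub u), ⟨_, Complex.exp_ne_zero _, h2⟩,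
    fun c => wtCycle_mul_pow_ne_one H hs0 hs c.2.1, h1.multipliable, ?_⟩
  rw [zeta, h1.tprod_eq, h2.opDet_eq, Complex.exp_neg]

end EulerProduct

section Expansion

variable {V : Type*} {Y : SimpleGraph V} {Γ : Type*} [Group Γ] {ρ : Γ →* (Y ≃g Y)}

/-- A multiaffine function of some of the variables, as a function of all variables. -/
lemma exists_polynomial_extend {ι : Type*} [Fintype ι] (J : Finset ι)
    (p : Finset J → Polynomial ℂ) : ∃ p' : Finset ι → Polynomial ℂ, ∀ (u : ℂ) (D : ι → ℂ),
      ∑ S, (p S).eval u * ∏ i ∈ S, D i = ∑ S, (p' S).eval u * ∏ i ∈ S, D i := by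
  classical
  refine ⟨fun S => ∑ S' : Finset J, if S'.map (Function.Embedding.subtype _) = S then p S' else 0,
    fun u D => ?_⟩
  simp only [Polynomial.eval_finsetSum, Finset.sum_mul, apply_ite (Polynomial.eval u),
    Polynomial.eval_zero, ite_mul, zero_mul]
  rw [Finset.sum_comm]
  refine Finset.sum_congr rfl fun S' _ => ?_
  rw [Finset.sum_ite_eq]
  simp

/-- For small `u` the operator `u T` has few closed paths, and the determinant of `1 - u T` is a
multiaffine function of the factors of the cusps. Of several rays with the same image far out in the
quotient only one is used. -/
theorem exists_cusp_expansion (hY : Y.IsTree) (hfin : ∀ x, (Y.neighborSet x).Finite)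
    (hunif : IsUniform Y) (hstab : ∀ e : Y.Dart, Finite {g : Γ // ρ g • e = e}) {m : ℕ}
    {r : Fin m → Ray Y} {N k : Fin m → ℕ} (hr : IsCuspDecomposition ρ r)
    (hk : ∀ i, PeriodicFrom (r i) (N i) (k i)) :
    ∃ α : ℝ, 0 < α ∧ ∃ p : Finset (Fin m) → Polynomial ℂ, ∀ u : ℂ, ‖u‖ < α →
      (∃ s F h, 0 ≤ s ∧ s < 1 ∧ HasFewCycles (fun e e' => u * edgeCoeff ρ e e') s F h) ∧
      (∀ i, cuspDenom (r i) (N i) (k i) u ≠ 0) ∧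
      opDet (oneSub ρ u) =
        ∑ S : Finset (Fin m), (p S).eval u * ∏ i ∈ S, cuspFactor (r i) (N i) (k i) u := by
  obtain ⟨M, J, hMJ⟩ := exists_cuspMatrix hY hfin hunif hstab hr
  obtain ⟨Q, hQ1, hQ⟩ := hunif.exists_norm_val_le
  have hk0 : ∀ i, M + 1 ≤ k i * (M + 1) := fun i => Nat.le_mul_of_pos_left _ (hk i).1
  -- The tail of the `i`-th ray starts one vertex before a translate of the `N i`-th vertex by a
  -- multiple of the period: the first valency that enters the matrix is that of the terminus of
  -- the first edge of the tail.
  obtain ⟨F, HC⟩ := hMJ (fun i => N i + k i * (M + 1) - 1) fun i => by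
    have := hk0 i
    omega
  have hq : ∀ (i : Fin m) n, val Y ((r i).vert (N i + k i * (M + 1) - 1 + n + 1)) =
      val Y ((r i).vert (N i + n)) := fun i n => by
    rw [← (hk i).val_add_mul (M + 1) _ (Nat.le_add_right _ n)]
    congr 2
    have := hk0 i
    omega
  simp only [hq] at HC
  obtain ⟨C, h, hC, H⟩ := HC.exists_hasFewCycles fun _ _ => hQ _
  obtain ⟨p, hp⟩ := HC.exists_polynomial
  obtain ⟨p', hp'⟩ := exists_polynomial_extend J p
  refine ⟨min C⁻¹ Q⁻¹, lt_min (inv_pos.mpr hC) (inv_pos.mpr (by linarith)), p', fun u hu => ?_⟩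
  have hu1 : ‖u‖ * C < 1 := by
    have := (lt_min_iff.mp hu).1
    rwa [← one_div, lt_div_iff₀ hC] at this
  have hu2 : Q * ‖u‖ ^ 2 < 1 := by
    have := (lt_min_iff.mp hu).2
    rw [← one_div, lt_div_iff₀ (by linarith)] at this
    nlinarith [norm_nonneg u]
  have hs0 : 0 ≤ ‖u‖ * C := by positivity
  refine ⟨⟨_, _, _, hs0, hu1, H u⟩, fun i => cuspDenom_ne_zero (hk i).1 hQ hu2, ?_⟩
  have hd := (H u).hasDet hs0 hu1 (coeff_oneSub u)
  rw [hd.opDet_eq, ← hp']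
  exact hp u _ _ ((H u).tendsto_det hs0 hu1) fun i => hasSum_cuspFactor (hk i) hQ hu2

/-- Clearing the denominators of the factors of the cusps. -/
lemma exists_polynomial_quotient {m : ℕ} (r : Fin m → Ray Y) (N k : Fin m → ℕ)
    (p : Finset (Fin m) → Polynomial ℂ) : ∃ P Q : Polynomial ℂ, ∀ u : ℂ,
      (∀ i, cuspDenom (r i) (N i) (k i) u ≠ 0) → Q.eval u ≠ 0 ∧
        ∑ S : Finset (Fin m), (p S).eval u * ∏ i ∈ S, cuspFactor (r i) (N i) (k i) u =
          P.eval u / Q.eval u := by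
  classical
  let den : Fin m → Polynomial ℂ := fun i =>
    1 - Polynomial.C (∏ l ∈ Finset.range (k i), ((val Y ((r i).vert (N i + l)) : ℂ) - 1)) *
      Polynomial.X ^ (2 * k i)
  let num : Fin m → Polynomial ℂ := fun i => ∑ j ∈ Finset.range (k i),
    Polynomial.C ((∏ l ∈ Finset.range j, ((val Y ((r i).vert (N i + l)) : ℂ) - 1)) *
      (1 - ((val Y ((r i).vert (N i + j)) : ℂ) - 1))) * Polynomial.X ^ (2 * j + 1)
  have hden : ∀ i u, (den i).eval u = cuspDenom (r i) (N i) (k i) u := fun i u => by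
    simp only [den, cuspDenom, Polynomial.eval_sub, Polynomial.eval_one, Polynomial.eval_mul,
      Polynomial.eval_C, Polynomial.eval_pow, Polynomial.eval_X]
  have hnum : ∀ i u, cuspFactor (r i) (N i) (k i) u =
      (num i).eval u / cuspDenom (r i) (N i) (k i) u := fun i u => by
    simp only [num, cuspFactor, Polynomial.eval_finsetSum, Polynomial.eval_mul,
      Polynomial.eval_C, Polynomial.eval_pow, Polynomial.eval_X]
  refine ⟨∑ S, p S * ((∏ i ∈ S, num i) * ∏ i ∈ Sᶜ, den i), ∏ i, den i, fun u hu => ?_⟩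
  have hQ : (∏ i, den i).eval u ≠ 0 := by
    rw [Polynomial.eval_prod]
    exact Finset.prod_ne_zero_iff.mpr fun i _ => by rw [hden]; exact hu i
  refine ⟨hQ, ?_⟩
  rw [eq_div_iff hQ, Polynomial.eval_finsetSum, Finset.sum_mul]
  refine Finset.sum_congr rfl fun S _ => ?_
  have hS : ∏ i ∈ S, cuspDenom (r i) (N i) (k i) u ≠ 0 :=
    Finset.prod_ne_zero_iff.mpr fun i _ => hu i
  simp only [Polynomial.eval_mul, Polynomial.eval_prod, hden, hnum, Finset.prod_div_distrib]
  rw [← Finset.prod_mul_prod_compl S]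
  field_simp

end Expansion

end TreeLattice

theorem mainTheorem2 {V : Type*} (Y : SimpleGraph V) (hY : Y.IsTree)
    (hfin : ∀ x, (Y.neighborSet x).Finite) (hunif : TreeLattice.IsUniform Y)
    {Γ : Type*} [Group Γ] (ρ : Γ →* (Y ≃g Y)) (hlat : TreeLattice.IsTreeLattice ρ)
    (hinv : TreeLattice.ActsWithoutInversion ρ) (hcusp : TreeLattice.IsCuspidal ρ) :
    (∃ α : ℝ, 0 < α ∧
      (∀ u : ℂ, ‖u‖ < α →
        TreeLattice.IsStrongDetClass (TreeLattice.oneSub ρ u) ∧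
        TreeLattice.IsDetClass (TreeLattice.oneSub ρ u) ∧
        (∀ c : {c : Cycle (TreeLattice.OE ρ) // TreeLattice.IsPrimeCycle c},
          TreeLattice.wtCycle c.1 * u ^ c.1.length ≠ 1) ∧
        Multipliable (TreeLattice.eulerFactor ρ u) ∧
        (TreeLattice.zeta ρ u)⁻¹ = TreeLattice.opDet (TreeLattice.oneSub ρ u)) ∧
      ∃ P Q : Polynomial ℂ, ∀ u : ℂ, ‖u‖ < α →
        Q.eval u ≠ 0 ∧
        TreeLattice.opDet (TreeLattice.oneSub ρ u) = P.eval u / Q.eval u) ∧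
    (∀ (m : ℕ) (r : Fin m → TreeLattice.Ray Y) (N k : Fin m → ℕ),
      TreeLattice.IsCuspDecomposition ρ r →
      (∀ i, TreeLattice.PeriodicFrom (r i) (N i) (k i)) →
      ∃ α : ℝ, 0 < α ∧ ∃ p : Finset (Fin m) → Polynomial ℂ, ∀ u : ℂ, ‖u‖ < α →
        (∀ i, TreeLattice.cuspDenom (r i) (N i) (k i) u ≠ 0) ∧
        TreeLattice.opDet (TreeLattice.oneSub ρ u) =
          ∑ S : Finset (Fin m), (p S).eval u *
            ∏ i ∈ S, TreeLattice.cuspFactor (r i) (N i) (k i) u) := by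
  refine ⟨?_, fun m r N k hr hk => ?_⟩
  · obtain ⟨m, r, hr⟩ := hcusp
    choose N k hk using fun i => (hr.1 i).2
    obtain ⟨α, hα, p, hp⟩ := TreeLattice.exists_cusp_expansion hY hfin hunif hlat.1 hr hk
    obtain ⟨P, Q, hPQ⟩ := TreeLattice.exists_polynomial_quotient r N k p
    refine ⟨α, hα, fun u hu => ?_, P, Q, fun u hu => ?_⟩
    · obtain ⟨⟨s, F, h, hs0, hs, H⟩, -, -⟩ := hp u hu
      exact TreeLattice.inv_zeta_eq_opDet H hs0 hs
    · obtain ⟨-, h1, h2⟩ := hp u hu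
      rw [h2]
      exact hPQ u h1
  · obtain ⟨α, hα, p, hp⟩ := TreeLattice.exists_cusp_expansion hY hfin hunif hlat.1 hr hk
    exact ⟨α, hα, p, fun u hu => (hp u hu).2⟩
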